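/- **Theorem 3.** All graphs are finite, simple and undirected, and $n$ denotes the number of vertices of the input graph $G$. Let $T$ be a spanning tree of $G$ rooted at a vertex $r$. A vertex $u$ is an ancestor of a vertex $v$ (and $v$ is a descendant of $u$) if $u$ lies on the path from $r$ to $v$ in $T$; a leaf of $T$ is a vertex that has no descendant other than itself. The tree $T$ is a *DFS tree* of $G$ if for every edge $uv$ of $G$, either $uv$ is an edge of $T$, or one of $u,v$ is a descendant of the other in $T$. Consider the following two decision problems, whose input is a graph $G$ and an integer $k\ge 0$. * *Dual Min-LLT*: does $G$ have a DFS tree (with some root) with at most $n-k$ leaves? * *Dual Max-LLT*: does $G$ have a DFS tree (with some root) with at least $n-k$ leaves? Then each of Dual Min-LLT and Dual Max-LLT can be solved in $k^{O(k)}\cdot n^{O(1)}$ time. That is, for each of the two problems there are an algorithm (a random access machine program, with unit-cost instructions whose only arithmetic is addition and subtraction, and with the graph given by its adjacency matrix) and a constant $C$ such that on every graph $G$ with $n$ vertices and every integer $k\ge 0$ the algorithm halts with the correct answer after at most $C\cdot k^{Ck}\cdot (n+1)^{C}$ steps, where $0^0=1$. -/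

import Mathlib

/-! ## Depth-first search trees -/

/-- For a tree `T` rooted at `r`: `u` is an ancestor of `v` (and `v` a descendant of `u`) when `u`
lies on the path of `T` from `r` to `v`. Every vertex is an ancestor of itself. -/
def IsAncestor {V : Type*} (T : SimpleGraph V) (r u v : V) : Prop :=
  ∃ p : T.Walk r v, p.IsPath ∧ u ∈ p.support

/-- `T` is a DFS tree of `G` rooted at `r`: a spanning tree of `G` such that every edge of `G` is
an edge of `T` or joins two vertices one of which is a descendant of the other. -/
structure IsDFSTree {V : Type*} (G : SimpleGraph V) (r : V) (T : SimpleGraph V) : Prop where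
  le : T ≤ G
  isTree : T.IsTree
  edge : ∀ u v : V, G.Adj u v → T.Adj u v ∨ IsAncestor T r u v ∨ IsAncestor T r v u

/-- A leaf of the tree `T` rooted at `r` is a vertex with no descendant other than itself. In
particular the root of a one-vertex tree is a leaf, and the root of any larger tree is not. -/
def IsTreeLeaf {V : Type*} (T : SimpleGraph V) (r v : V) : Prop :=
  ∀ w : V, IsAncestor T r v w → w = v

/-- The number of leaves of the tree `T` rooted at `r`. -/
noncomputable def numLeaves {V : Type*} (T : SimpleGraph V) (r : V) : ℕ :=
  {v : V | IsTreeLeaf T r v}.ncard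

/-- Dual Min-LLT: does the `n`-vertex graph `G` have a DFS tree with at most `n - k` leaves? -/
def DualMinLLT (n : ℕ) (G : SimpleGraph (Fin n)) (k : ℕ) : Prop :=
  ∃ (r : Fin n) (T : SimpleGraph (Fin n)),
    IsDFSTree G r T ∧ (numLeaves T r : ℤ) ≤ (n : ℤ) - (k : ℤ)

/-- Dual Max-LLT: does the `n`-vertex graph `G` have a DFS tree with at least `n - k` leaves? -/
def DualMaxLLT (n : ℕ) (G : SimpleGraph (Fin n)) (k : ℕ) : Prop :=
  ∃ (r : Fin n) (T : SimpleGraph (Fin n)),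
    IsDFSTree G r T ∧ (n : ℤ) - (k : ℤ) ≤ (numLeaves T r : ℤ)

/-! ## Random access machines

A random access machine with natural-number registers and finitely many arrays addressed indirectly.
A program is a finite text over the instructions below and so uses finitely many registers and
arrays. Each instruction and each evaluation of a test costs one step. The only arithmetic is
addition and truncated subtraction (no multiplication), so in `t` steps the bit length of the
numbers in memory grows by at most `t`, and the model is polynomially equivalent to Turing
machines. -/

namespace RAM

/-- The memory: registers `reg x`, and cells `arr a i` of the arrays `a`. -/
@[ext] structure Mem where
  reg : ℕ → ℕ
  arr : ℕ → ℕ → ℕ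

/-- The elementary instructions; `x y z` name registers, `a` names an array, `c` is a constant. -/
inductive Instr where
  /-- `x := c` -/
  | const (x c : ℕ)
  /-- `x := y` -/
  | move (x y : ℕ)
  /-- `x := y + z` -/
  | add (x y z : ℕ)
  /-- `x := max (y - z) 0` -/
  | sub (x y z : ℕ)
  /-- `x := a[y]` -/
  | load (x a y : ℕ)
  /-- `a[y] := x` -/
  | store (a y x : ℕ)

/-- Assignment to a register. -/
def Mem.setReg (s : Mem) (x v : ℕ) : Mem :=
  { s with reg := Function.update s.reg x v }

/-- Assignment to an array cell. -/
def Mem.setArr (s : Mem) (a i v : ℕ) : Mem :=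
  { s with arr := Function.update s.arr a (Function.update (s.arr a) i v) }

/-- The effect of an elementary instruction. -/
def Instr.run : Instr → Mem → Mem
  | .const x c, s => s.setReg x c
  | .move x y, s => s.setReg x (s.reg y)
  | .add x y z, s => s.setReg x (s.reg y + s.reg z)
  | .sub x y z, s => s.setReg x (s.reg y - s.reg z)
  | .load x a y, s => s.setReg x (s.arr a (s.reg y))
  | .store a y x, s => s.setArr a (s.reg y) (s.reg x)

/-- The tests: comparison of two registers. -/
inductive Test where
  /-- `x < y` -/
  | lt (x y : ℕ)
  /-- `x = y` -/
  | eq (x y : ℕ)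

/-- The truth value of a test. -/
def Test.Holds : Test → Mem → Prop
  | .lt x y, s => s.reg x < s.reg y
  | .eq x y, s => s.reg x = s.reg y

/-- Programs. -/
inductive Prog where
  | skip
  | instr (i : Instr)
  | seq (p q : Prog)
  | ite (b : Test) (p q : Prog)
  | loop (b : Test) (p : Prog)

/-- `Exec p s s' t`: started with memory `s`, the program `p` halts after exactly `t` steps with
memory `s'`. Here `Prog.loop b p` is "while `b` do `p`". -/
inductive Exec : Prog → Mem → Mem → ℕ → Prop where
  | skip (s : Mem) : Exec .skip s s 1
  | instr (i : Instr) (s : Mem) : Exec (.instr i) s (i.run s) 1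
  | seq {p q : Prog} {s s' s'' : Mem} {t t' : ℕ} :
      Exec p s s' t → Exec q s' s'' t' → Exec (.seq p q) s s'' (t + t')
  | ite_true {b : Test} {p q : Prog} {s s' : Mem} {t : ℕ} :
      b.Holds s → Exec p s s' t → Exec (.ite b p q) s s' (1 + t)
  | ite_false {b : Test} {p q : Prog} {s s' : Mem} {t : ℕ} :
      ¬ b.Holds s → Exec q s s' t → Exec (.ite b p q) s s' (1 + t)
  | loop_done {b : Test} {p : Prog} {s : Mem} :
      ¬ b.Holds s → Exec (.loop b p) s s 1
  | loop_step {b : Test} {p : Prog} {s s' s'' : Mem} {t t' : ℕ} :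
      b.Holds s → Exec p s s' t → Exec (.loop b p) s' s'' t' →
        Exec (.loop b p) s s'' (1 + t + t')

/-- The machine is deterministic: result and number of steps are determined by the start. -/
theorem Exec.unique {p : Prog} {s s₁ s₂ : Mem} {t₁ t₂ : ℕ}
    (h₁ : Exec p s s₁ t₁) (h₂ : Exec p s s₂ t₂) : s₁ = s₂ ∧ t₁ = t₂ := by
  induction h₁ generalizing s₂ t₂ with
  | skip => cases h₂; exact ⟨rfl, rfl⟩
  | instr => cases h₂; exact ⟨rfl, rfl⟩
  | seq _ _ ihp ihq =>
    cases h₂ with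
    | seq a b =>
      obtain ⟨rfl, rfl⟩ := ihp a
      obtain ⟨rfl, rfl⟩ := ihq b
      exact ⟨rfl, rfl⟩
  | ite_true hb _ ih =>
    cases h₂ with
    | ite_true _ a => obtain ⟨rfl, rfl⟩ := ih a; exact ⟨rfl, rfl⟩
    | ite_false hb' _ => exact absurd hb hb'
  | ite_false hb _ ih =>
    cases h₂ with
    | ite_true hb' _ => exact absurd hb' hb
    | ite_false _ a => obtain ⟨rfl, rfl⟩ := ih a; exact ⟨rfl, rfl⟩
  | loop_done hb =>
    cases h₂ with
    | loop_done _ => exact ⟨rfl, rfl⟩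
    | loop_step hb' _ _ => exact absurd hb' hb
  | loop_step hb _ _ ihp ihq =>
    cases h₂ with
    | loop_done hb' => exact absurd hb hb'
    | loop_step _ a b =>
      obtain ⟨rfl, rfl⟩ := ihp a
      obtain ⟨rfl, rfl⟩ := ihq b
      exact ⟨rfl, rfl⟩

open Classical in
/-- The input `(G, k)`: the number `n` of vertices is in register `0`, the number `k` in
register `1`, and the adjacency matrix of `G`, row by row, in array `0`, that is, cell `i * n + j`
is `1` if the vertices `i` and `j` are adjacent and `0` if not. Everything else is `0`. -/
noncomputable def input (n : ℕ) (G : SimpleGraph (Fin n)) (k : ℕ) : Mem where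
  reg := fun x => if x = 0 then n else if x = 1 then k else 0
  arr := fun a c =>
    if a = 0 ∧ ∃ i j : Fin n, G.Adj i j ∧ c = (i : ℕ) * n + (j : ℕ) then 1 else 0

/-- The program `p` solves the decision problem `Q` on pairs of a graph and a natural number in time
`f`: on every graph with `n` vertices and every `k` it halts after at most `f n k` steps, with
`1` in register `0` if the answer is yes, and `0` if the answer is no. -/
def SolvesInTime (p : Prog) (Q : (n : ℕ) → SimpleGraph (Fin n) → ℕ → Prop) (f : ℕ → ℕ → ℕ) : Prop :=
  ∀ (n : ℕ) (G : SimpleGraph (Fin n)) (k : ℕ),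
    ∃ (s : Mem) (t : ℕ), Exec p (input n G k) s t ∧ t ≤ f n k ∧
      (Q n G k → s.reg 0 = 1) ∧ (¬ Q n G k → s.reg 0 = 0)

end RAM

/-- `Q` can be solved in `k ^ O(k) * n ^ O(1)` time: a single program solves all instances, and its
running time is bounded with a single constant. At `k = 0` the factor `k ^ (C * k)` is `1`;
`n + 1` in place of `n` only serves to cover the graph without vertices. -/
def SolvableInFPTTime (Q : (n : ℕ) → SimpleGraph (Fin n) → ℕ → Prop) : Prop :=
  ∃ (p : RAM.Prog) (C : ℕ),
    RAM.SolvesInTime p Q (fun n k => C * k ^ (C * k) * (n + 1) ^ C)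

/-! Leaves and inner vertices (vertices with a child) add up to `n`, so the questions are whether
some DFS tree has at least, respectively at most, `k` inner vertices. These form a vertex cover:
every edge joins comparable vertices, and the upper one has a child. Hence there are at least as
many inner vertices as edges in any matching. Take a greedy maximal matching. If it has more than
`k` edges, then so many inner vertices occur in every DFS tree: the answer is no for Max, and for
Min it is yes exactly if `G` is connected and has a vertex (`searchTable_lt_iff`,
`SimpleGraph.Connected.exists_isDFSRooting`). Otherwise the matched vertices form a vertex cover `X`
of size at most `2 * k`.

In that case an inner vertex outside `X` has its children in `X`, so at most `|X|` inner vertices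
lie outside `X`, and at most `4 * k` vertices matter. They are located by an exchange
(`IsDFSRooting.exists_normal`). If any two neighbours of an inner vertex `v` outside `X` have more
than `3 * |X|` common neighbours smaller than `v`, then `v` has a single child, and a smaller leaf
can take its place while `v` becomes a leaf. The number of inner vertices stays the same and the sum
of their numbers drops. So some DFS tree with equally many inner vertices has each of them either in
`X` or among the first `6 * k + 1` common neighbours of two vertices of `X`.

A certificate lists these vertices by depth, each described by three digits below `6 * k + 2`. The
list determines the tree: with all other vertices, which are leaves, placed after it, every earlier
neighbour of a vertex is an ancestor, so the parent is the last earlier neighbour (`certOk_of_key`,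
`exists_certOk`). There are `(6 * k + 2) ^ (12 * k)` digit strings, and each is checked in
polynomial time.

On the machine side, everything done for one certificate is phrased in expressions with bounded sums
and iterations. Their loops share one bound, so compiled expressions run in time polynomial in it
(`Expr.runs_compile`, `PolyBounded.cost`). -/

namespace RAM

/-! ### Bounded expressions and their compilation -/

/-- Expressions over the memory, whose loops all run up to the value of register `2`. -/
inductive Expr where
  | const (c : ℕ)
  | var (x : ℕ)
  | load (a : ℕ) (e : Expr)
  | add (e f : Expr)
  | sub (e f : Expr)
  | lt (e f : Expr)
  | eq (e f : Expr)
  | ite (b e f : Expr)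
  | sum (x : ℕ) (e : Expr)
  | iter (x : ℕ) (e f : Expr)

namespace Expr

/-- The value of an expression. -/
def eval : Expr → Mem → ℕ
  | const c, _ => c
  | var x, s => s.reg x
  | load a e, s => s.arr a (e.eval s)
  | add e f, s => e.eval s + f.eval s
  | sub e f, s => e.eval s - f.eval s
  | lt e f, s => if e.eval s < f.eval s then 1 else 0
  | eq e f, s => if e.eval s = f.eval s then 1 else 0
  | ite b e f, s => if 0 < b.eval s then e.eval s else f.eval s
  | sum x e, s => ∑ i ∈ Finset.range (s.reg 2), e.eval (s.setReg x i)
  | iter x e f, s => (fun y => f.eval (s.setReg x y))^[s.reg 2] (e.eval s)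

/-- All variables of the expression are below `d`, and register `2` is not bound. -/
def varsBelow (d : ℕ) : Expr → Bool
  | const _ => true
  | var x => decide (x < d)
  | load _ e => e.varsBelow d
  | add e f => e.varsBelow d && f.varsBelow d
  | sub e f => e.varsBelow d && f.varsBelow d
  | lt e f => e.varsBelow d && f.varsBelow d
  | eq e f => e.varsBelow d && f.varsBelow d
  | ite b e f => b.varsBelow d && (e.varsBelow d && f.varsBelow d)
  | sum x e => decide (x < d) && (decide (x ≠ 2) && e.varsBelow d)
  | iter x e f => decide (x < d) && (decide (x ≠ 2) && (e.varsBelow d && f.varsBelow d))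

/-- The program that evaluates an expression into register `d`, using only registers from `d` on
as temporaries. -/
def compile : Expr → ℕ → Prog
  | const c, d => .instr (.const d c)
  | var x, d => .instr (.move d x)
  | load a e, d => .seq (e.compile d) (.instr (.load d a d))
  | add e f, d => .seq (.seq (e.compile d) (f.compile (d + 1))) (.instr (.add d d (d + 1)))
  | sub e f, d => .seq (.seq (e.compile d) (f.compile (d + 1))) (.instr (.sub d d (d + 1)))
  | lt e f, d => .seq (.seq (e.compile d) (f.compile (d + 1)))
      (.ite (.lt d (d + 1)) (.instr (.const d 1)) (.instr (.const d 0)))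
  | eq e f, d => .seq (.seq (e.compile d) (f.compile (d + 1)))
      (.ite (.eq d (d + 1)) (.instr (.const d 1)) (.instr (.const d 0)))
  | ite b e f, d => .seq (.seq (b.compile d) (.instr (.const (d + 1) 0)))
      (.ite (.lt (d + 1) d) (e.compile d) (f.compile d))
  -- The bound variable `x`, a register below `d`, is itself the loop counter; its old value waits
  -- in `d` and is restored at the end. The sum grows in `d + 1`, and `d + 2` holds the summand and
  -- then the increment.
  | sum x e, d =>
      .seq (.seq (.instr (.move d x)) (.seq (.instr (.const (d + 1) 0)) (.instr (.const x 0))))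
      (.seq (.loop (.lt x 2) (.seq (e.compile (d + 2))
          (.seq (.instr (.add (d + 1) (d + 1) (d + 2)))
            (.seq (.instr (.const (d + 2) 1)) (.instr (.add x x (d + 2)))))))
        (.seq (.instr (.move x d)) (.instr (.move d (d + 1)))))
  -- Here `x` carries the iterated value, `d` its old content, and `d + 1` counts the rounds.
  | iter x e f, d =>
      .seq (.seq (.instr (.move d x)) (.seq (e.compile (d + 1))
        (.seq (.instr (.move x (d + 1))) (.instr (.const (d + 1) 0)))))
      (.seq (.loop (.lt (d + 1) 2) (.seq (f.compile (d + 2))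
          (.seq (.instr (.move x (d + 2)))
            (.seq (.instr (.const (d + 2) 1)) (.instr (.add (d + 1) (d + 1) (d + 2)))))))
        (.seq (.instr (.move (d + 1) x)) (.seq (.instr (.move x d)) (.instr (.move d (d + 1))))))

/-- A bound for the number of steps of `compile`, if register `2` holds `u`. -/
def cost (u : ℕ) : Expr → ℕ
  | const _ => 1
  | var _ => 1
  | load _ e => e.cost u + 1
  | add e f => e.cost u + f.cost u + 1
  | sub e f => e.cost u + f.cost u + 1
  | lt e f => e.cost u + f.cost u + 2
  | eq e f => e.cost u + f.cost u + 2
  | ite b e f => b.cost u + e.cost u + f.cost u + 2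
  | sum _ e => u * (e.cost u + 4) + 6
  | iter _ e f => e.cost u + u * (f.cost u + 4) + 7

theorem varsBelow_mono {d d' : ℕ} (h : d ≤ d') {e : Expr} (he : e.varsBelow d) : e.varsBelow d' := by
  induction e <;> simp_all [varsBelow] <;> omega

/-- An expression reads only registers below `d` and the arrays; `2 < d` is needed because loops
read their bound from register `2`. This is what allows registers from `d` on to be overwritten
between evaluations. -/
theorem eval_congr {d : ℕ} (hd : 2 < d) {e : Expr} (he : e.varsBelow d) {s s' : Mem}
    (hr : ∀ x < d, s.reg x = s'.reg x) (ha : s.arr = s'.arr) : e.eval s = e.eval s' := by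
  have key : ∀ {s s' : Mem} (x y : ℕ), (∀ x < d, s.reg x = s'.reg x) →
      ∀ z < d, (s.setReg x y).reg z = (s'.setReg x y).reg z := by
    intro s s' x y h z hz
    simp only [Mem.setReg, Function.update_apply]
    split
    · rfl
    · exact h z hz
  induction e generalizing s s' with
  | const c => rfl
  | var x => exact hr x (by simpa [varsBelow] using he)
  | load a e ih => simp only [varsBelow] at he; simp only [eval, ih he hr ha, ha]
  | add e f ihe ihf | sub e f ihe ihf | lt e f ihe ihf | eq e f ihe ihf =>
    simp only [varsBelow, Bool.and_eq_true] at he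
    simp only [eval, ihe he.1 hr ha, ihf he.2 hr ha]
  | ite b e f ihb ihe ihf =>
    simp only [varsBelow, Bool.and_eq_true] at he
    simp only [eval, ihb he.1 hr ha, ihe he.2.1 hr ha, ihf he.2.2 hr ha]
  | sum x e ih =>
    simp only [varsBelow, Bool.and_eq_true] at he
    simp only [eval, hr 2 hd]
    exact Finset.sum_congr rfl fun i _ => ih he.2.2 (key x i hr) ha
  | iter x e f ihe ihf =>
    simp only [varsBelow, Bool.and_eq_true] at he
    simp only [eval, hr 2 hd, ihe he.2.2.1 hr ha]
    congr 1
    funext y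
    exact ihf he.2.2.2 (key x y hr) ha

end Expr

/-! ### Running times of composed programs -/

/-- Started in `s`, the program `p` halts after at most `T` steps in a memory that satisfies `Q`. -/
def Runs (p : Prog) (s : Mem) (T : ℕ) (Q : Mem → Prop) : Prop :=
  ∃ (s' : Mem) (t : ℕ), Exec p s s' t ∧ t ≤ T ∧ Q s'

theorem Runs.seq {p q : Prog} {s : Mem} {T T' : ℕ} {Q R : Mem → Prop}
    (hp : Runs p s T Q) (hq : ∀ s', Q s' → Runs q s' T' R) : Runs (.seq p q) s (T + T') R := by
  obtain ⟨s', t, h, ht, hQ⟩ := hp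
  obtain ⟨s'', t', h', ht', hR⟩ := hq s' hQ
  exact ⟨s'', t + t', .seq h h', by omega, hR⟩

theorem Runs.mono {p : Prog} {s : Mem} {T T' : ℕ} {Q R : Mem → Prop}
    (hp : Runs p s T Q) (hT : T ≤ T') (hQ : ∀ s', Q s' → R s') : Runs p s T' R := by
  obtain ⟨s', t, h, ht, h'⟩ := hp
  exact ⟨s', t, h, by omega, hQ _ h'⟩

theorem Runs.instr {i : Instr} {s : Mem} {Q : Mem → Prop} (h : Q (i.run s)) :
    Runs (.instr i) s 1 Q :=
  ⟨_, 1, .instr i s, le_rfl, h⟩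

theorem Runs.ite {b : Test} {p q : Prog} {s : Mem} {T : ℕ} {Q : Mem → Prop}
    (hp : b.Holds s → Runs p s T Q) (hq : ¬ b.Holds s → Runs q s T Q) :
    Runs (.ite b p q) s (T + 1) Q := by
  by_cases hb : b.Holds s
  · obtain ⟨s', t, h, ht, h'⟩ := hp hb
    exact ⟨s', _, .ite_true hb h, by omega, h'⟩
  · obtain ⟨s', t, h, ht, h'⟩ := hq hb
    exact ⟨s', _, .ite_false hb h, by omega, h'⟩

/-- A loop that is known to perform exactly `m` rounds. -/
theorem Runs.loop {b : Test} {p : Prog} {T m : ℕ} (I : ℕ → Mem → Prop)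
    (hb : ∀ j s, I j s → j ≤ m → (b.Holds s ↔ j < m))
    (hp : ∀ j s, I j s → j < m → Runs p s T (I (j + 1))) {s : Mem} (hs : I 0 s) :
    Runs (.loop b p) s (m * (T + 1) + 1) (I m) := by
  have key : ∀ l j s, j + l = m → I j s → Runs (.loop b p) s (l * (T + 1) + 1) (I m) := by
    intro l
    induction l with
    | zero =>
      intro j s hj hI
      obtain rfl : j = m := hj
      exact ⟨s, 1, .loop_done (by rw [hb _ s hI le_rfl]; omega), by omega, hI⟩
    | succ l ih =>
      intro j s hj hI
      obtain ⟨s', t, h, ht, hI'⟩ := hp j s hI (by omega)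
      obtain ⟨s'', t', h', ht', hI''⟩ := ih (j + 1) s' (by omega) hI'
      refine ⟨s'', _, .loop_step ((hb j s hI (by omega)).2 (by omega)) h h', ?_, hI''⟩
      rw [Nat.add_mul, Nat.one_mul]
      omega
  exact key m 0 s (by omega) hs

namespace Expr

/-- The memory `s'` is a result of evaluating into register `d` from the memory `s`. -/
def Result (d : ℕ) (s : Mem) (v : ℕ) (s' : Mem) : Prop :=
  s'.reg d = v ∧ (∀ x < d, s'.reg x = s.reg x) ∧ s'.arr = s.arr

/-- The second evaluation works from `d + 1` on, so the first result survives in `d`; the first one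
changed nothing that `f` reads, so `f` still has its original value. -/
theorem runs_pair {e f : Expr} {d : ℕ} (hd : 2 < d) {s : Mem} {T T' : ℕ}
    (hfs : f.varsBelow d)
    (he : Runs (e.compile d) s T (Result d s (e.eval s)))
    (hf : ∀ s₁ : Mem, s₁.reg 2 = s.reg 2 →
      Runs (f.compile (d + 1)) s₁ T' (Result (d + 1) s₁ (f.eval s₁))) :
    Runs (.seq (e.compile d) (f.compile (d + 1))) s (T + T') (fun s' =>
      s'.reg d = e.eval s ∧ s'.reg (d + 1) = f.eval s ∧ (∀ x < d, s'.reg x = s.reg x) ∧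
        s'.arr = s.arr) := by
  refine he.seq fun s₁ ⟨h1, h2, h3⟩ => (hf s₁ (h2 2 hd)).mono le_rfl fun s₂ ⟨g1, g2, g3⟩ => ?_
  refine ⟨by rw [g2 d (by omega), h1], ?_, fun x hx => by rw [g2 x (by omega), h2 x hx],
    g3.trans h3⟩
  rw [g1]
  exact eval_congr hd hfs h2 h3

theorem runs_compile (e : Expr) {d : ℕ} (hd : 2 < d) (he : e.varsBelow d) (s : Mem) :
    Runs (e.compile d) s (e.cost (s.reg 2)) (Result d s (e.eval s)) := by
  -- Subexpressions are evaluated in other memories, but register `2` is never bound, so one fixed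
  -- `u` serves the whole induction.
  generalize hu : s.reg 2 = u
  induction e generalizing d s with
  | const c =>
    exact Runs.instr ⟨by simp [Instr.run, Mem.setReg, eval],
      fun x hx => by simp [Instr.run, Mem.setReg, hx.ne], rfl⟩
  | var y =>
    exact Runs.instr ⟨by simp [Instr.run, Mem.setReg, eval],
      fun x hx => by simp [Instr.run, Mem.setReg, hx.ne], rfl⟩
  | load a e ih =>
    refine (ih hd he s hu).seq fun s' ⟨h1, h2, h3⟩ => Runs.instr ⟨?_, fun x hx => ?_, h3⟩
    · simp [Instr.run, Mem.setReg, eval, h1, h3]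
    · simp [Instr.run, Mem.setReg, hx.ne, h2 x hx]
  | add e f ihe ihf | sub e f ihe ihf =>
    simp only [varsBelow, Bool.and_eq_true] at he
    refine Runs.seq (runs_pair hd he.2 (ihe hd he.1 s hu) fun s₁ h₁ => ihf (by omega)
      (varsBelow_mono (by omega) he.2) s₁ (h₁.trans hu)) ?_
    rintro s' ⟨h1, h2, h3, h4⟩
    refine Runs.instr ⟨?_, fun x hx => ?_, h4⟩
    · simp [Instr.run, Mem.setReg, eval, h1, h2]
    · simp [Instr.run, Mem.setReg, hx.ne, h3 x hx]
  | lt e f ihe ihf | eq e f ihe ihf =>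
    simp only [varsBelow, Bool.and_eq_true] at he
    refine Runs.seq (T' := 1 + 1) (runs_pair hd he.2 (ihe hd he.1 s hu) fun s₁ h₁ => ihf (by omega)
      (varsBelow_mono (by omega) he.2) s₁ (h₁.trans hu)) ?_
    rintro s' ⟨h1, h2, h3, h4⟩
    refine Runs.ite (fun hb => Runs.instr ⟨?_, fun x hx => ?_, h4⟩)
      (fun hb => Runs.instr ⟨?_, fun x hx => ?_, h4⟩)
    all_goals simp only [Test.Holds, h1, h2] at hb
    · simp [Instr.run, Mem.setReg, eval, hb]
    · simp [Instr.run, Mem.setReg, hx.ne, h3 x hx]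
    · simp [Instr.run, Mem.setReg, eval, hb]
    · simp [Instr.run, Mem.setReg, hx.ne, h3 x hx]
  | ite b e f ihb ihe ihf =>
    simp only [varsBelow, Bool.and_eq_true] at he
    refine Runs.mono (Runs.seq (T' := e.cost u + f.cost u + 1)
      (Q := fun s' => s'.reg d = b.eval s ∧ s'.reg (d + 1) = 0 ∧
      (∀ x < d, s'.reg x = s.reg x) ∧ s'.arr = s.arr) ((ihb hd he.1 s hu).seq
        fun s' ⟨h1, h2, h3⟩ => Runs.instr ⟨?_, ?_, fun x hx => ?_, h3⟩) ?_)
        (by simp only [cost]; omega) fun _ h => h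
    · simp [Instr.run, Mem.setReg, h1]
    · simp [Instr.run, Mem.setReg]
    · simp [Instr.run, Mem.setReg, h2 x hx, show x ≠ d + 1 by omega]
    · rintro s' ⟨h1, h2, h3, h4⟩
      have hu' : s'.reg 2 = u := by rw [h3 2 hd, hu]
      refine Runs.ite (fun hb => ?_) (fun hb => ?_)
      all_goals simp only [Test.Holds, h1, h2] at hb
      · refine (ihe hd he.2.1 s' hu').mono (by omega) fun s'' ⟨g1, g2, g3⟩ =>
          ⟨?_, fun x hx => by rw [g2 x hx, h3 x hx], g3.trans h4⟩
        rw [g1, eval, if_pos hb]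
        exact eval_congr hd he.2.1 h3 h4
      · refine (ihf hd he.2.2 s' hu').mono (by omega) fun s'' ⟨g1, g2, g3⟩ =>
          ⟨?_, fun x hx => by rw [g2 x hx, h3 x hx], g3.trans h4⟩
        rw [g1, eval, if_neg hb]
        exact eval_congr hd he.2.2 h3 h4
  | sum y e ih =>
    simp only [varsBelow, Bool.and_eq_true, decide_eq_true_eq] at he
    obtain ⟨hy, hy2, he⟩ := he
    let I : ℕ → Mem → Prop := fun j s' => s'.reg d = s.reg y ∧ s'.reg y = j ∧
      s'.reg (d + 1) = ∑ i ∈ Finset.range j, e.eval (s.setReg y i) ∧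
      (∀ x < d, x ≠ y → s'.reg x = s.reg x) ∧ s'.arr = s.arr
    refine Runs.mono (Runs.seq (T := 1 + (1 + 1)) (T' := (u * (e.cost u + (1 + (1 + 1)) + 1) + 1) + (1 + 1))
      (Q := I 0) ?_ fun s₁ hs₁ => (Runs.loop I ?_ ?_ hs₁).seq ?_) ?_ fun _ h => h
    · refine (Runs.instr rfl).seq ?_
      rintro _ rfl
      refine (Runs.instr rfl).seq ?_
      rintro _ rfl
      refine Runs.instr ⟨?_, ?_, ?_, fun x hx hxy => ?_, rfl⟩
      · simp [Instr.run, Mem.setReg, show d ≠ y by omega]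
      · simp [Instr.run, Mem.setReg]
      · simp [Instr.run, Mem.setReg, show d + 1 ≠ y by omega]
      · simp [Instr.run, Mem.setReg, hxy, show x ≠ d + 1 by omega, hx.ne]
    · rintro j s' ⟨-, h2, -, h4, -⟩ -
      simp only [Test.Holds, h2, h4 2 hd (Ne.symm hy2), hu]
    · rintro j s' ⟨h1, h2, h3, h4, h5⟩ -
      refine (ih (d := d + 2) (by omega) (varsBelow_mono (by omega) he) s'
        (by rw [h4 2 hd (Ne.symm hy2), hu])).seq ?_
      rintro s'' ⟨g1, g2, g3⟩
      refine (Runs.instr rfl).seq ?_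
      rintro _ rfl
      refine (Runs.instr rfl).seq ?_
      rintro _ rfl
      -- Below `d` the current memory differs from the initial one only in the counter `y`, which
      -- holds `j`.
      have hev : e.eval s' = e.eval (s.setReg y j) := by
        refine eval_congr hd he (fun x hx => ?_) h5
        by_cases hxy : x = y
        · simp [Mem.setReg, hxy, h2]
        · simp [Mem.setReg, hxy, h4 x hx hxy]
      refine Runs.instr ⟨?_, ?_, ?_, fun x hx hxy => ?_, g3.trans h5⟩
      · have := g2 d (by omega)
        simp [Instr.run, Mem.setReg, Function.update_apply, show d ≠ y by omega, this, h1]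
      · have := g2 y (by omega)
        simp [Instr.run, Mem.setReg, show y ≠ d + 1 by omega,
          show y ≠ d + 2 by omega, this, h2]
      · have := g2 (d + 1) (by omega)
        simp [Instr.run, Mem.setReg, Function.update_apply, show d + 1 ≠ y by omega, this, h3, g1,
          Finset.sum_range_succ, hev]
      · have := g2 x (by omega)
        simp [Instr.run, Mem.setReg, Function.update_apply, hxy, show x ≠ d + 1 by omega,
          show x ≠ d + 2 by omega, this, h4 x hx hxy]
    · rintro s' ⟨h1, h2, h3, h4, h5⟩
      refine (Runs.instr rfl).seq ?_
      rintro _ rfl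
      refine Runs.instr ⟨?_, fun x hx => ?_, h5⟩
      · simp [Instr.run, Mem.setReg, show d + 1 ≠ y by omega, h3, eval, hu]
      · by_cases hxy : x = y
        · simp [Instr.run, Mem.setReg, Function.update_apply, hxy, show y ≠ d by omega, h1]
        · simp [Instr.run, Mem.setReg, Function.update_apply, hxy, show x ≠ d by omega, h4 x hx hxy]
    · simp only [cost]; ring_nf; omega
  | iter y e f ihe ihf =>
    simp only [varsBelow, Bool.and_eq_true, decide_eq_true_eq] at he
    obtain ⟨hy, hy2, he, hf⟩ := he
    let g : ℕ → ℕ := fun z => f.eval (s.setReg y z)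
    let I : ℕ → Mem → Prop := fun j s' => s'.reg d = s.reg y ∧ s'.reg (d + 1) = j ∧
      s'.reg y = g^[j] (e.eval s) ∧
      (∀ x < d, x ≠ y → s'.reg x = s.reg x) ∧ s'.arr = s.arr
    refine Runs.mono (Runs.seq (T := 1 + (e.cost u + (1 + 1)))
      (T' := (u * (f.cost u + (1 + (1 + 1)) + 1) + 1) + (1 + (1 + 1)))
      (Q := I 0) ?_ fun s₁ hs₁ => (Runs.loop I ?_ ?_ hs₁).seq ?_) ?_ fun _ h => h
    · refine (Runs.instr rfl).seq ?_
      rintro _ rfl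
      refine (ihe (d := d + 1) (by omega) (varsBelow_mono (by omega) he) _ ?_).seq ?_
      · simp [Instr.run, Mem.setReg, show 2 ≠ d by omega, hu]
      rintro s' ⟨g1, g2, g3⟩
      refine (Runs.instr rfl).seq ?_
      rintro _ rfl
      have hev : e.eval ((Instr.move d y).run s) = e.eval s := by
        refine eval_congr hd he (fun x hx => ?_) rfl
        simp [Instr.run, Mem.setReg, show x ≠ d by omega]
      refine Runs.instr ⟨?_, ?_, ?_, fun x hx hxy => ?_, g3⟩
      · have := g2 d (by omega)
        simp [Instr.run, Mem.setReg, show d ≠ y by omega, this]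
      · simp [Instr.run, Mem.setReg]
      · simp [Instr.run, Mem.setReg, show y ≠ d + 1 by omega, g1]
        exact hev
      · have := g2 x (by omega)
        simp [Instr.run, Mem.setReg, hxy, show x ≠ d + 1 by omega, this,
          show x ≠ d by omega]
    · rintro j s' ⟨-, h2, -, h4, -⟩ -
      simp only [Test.Holds, h2, h4 2 hd (Ne.symm hy2), hu]
    · rintro j s' ⟨h1, h2, h3, h4, h5⟩ -
      refine (ihf (d := d + 2) (by omega) (varsBelow_mono (by omega) hf) s'
        (by rw [h4 2 hd (Ne.symm hy2), hu])).seq ?_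
      rintro s'' ⟨g1, g2, g3⟩
      refine (Runs.instr rfl).seq ?_
      rintro _ rfl
      refine (Runs.instr rfl).seq ?_
      rintro _ rfl
      have hev : f.eval s' = g (g^[j] (e.eval s)) := by
        refine eval_congr hd hf (fun x hx => ?_) h5
        by_cases hxy : x = y
        · simp [Mem.setReg, hxy, h3]
        · simp [Mem.setReg, hxy, h4 x hx hxy]
      refine Runs.instr ⟨?_, ?_, ?_, fun x hx hxy => ?_, g3.trans h5⟩
      · have := g2 d (by omega)
        simp [Instr.run, Mem.setReg, Function.update_apply, show d ≠ y by omega, this, h1]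
      · have := g2 (d + 1) (by omega)
        simp [Instr.run, Mem.setReg, show d + 1 ≠ y by omega, this, h2]
      · simp [Instr.run, Mem.setReg, Function.update_apply, show y ≠ d + 1 by omega,
          show y ≠ d + 2 by omega, g1, hev, Function.iterate_succ_apply', -Function.iterate_succ]
      · have := g2 x (by omega)
        simp [Instr.run, Mem.setReg, Function.update_apply, hxy, show x ≠ d + 1 by omega,
          show x ≠ d + 2 by omega, this, h4 x hx hxy]
    · rintro s' ⟨h1, h2, h3, h4, h5⟩
      refine (Runs.instr rfl).seq ?_
      rintro _ rfl
      refine (Runs.instr rfl).seq ?_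
      rintro _ rfl
      refine Runs.instr ⟨?_, fun x hx => ?_, h5⟩
      · simp [Instr.run, Mem.setReg, show d + 1 ≠ y by omega, h3, eval, hu, g]
      · by_cases hxy : x = y
        · simp [Instr.run, Mem.setReg, Function.update_apply, hxy, show y ≠ d by omega, h1]
        · simp [Instr.run, Mem.setReg, Function.update_apply, hxy, show x ≠ d by omega, h4 x hx hxy,
            show x ≠ d + 1 by omega]
    · simp only [cost]; ring_nf; omega

end Expr
@[simp] theorem reg_setReg (s : Mem) (x v y : ℕ) :
    (s.setReg x v).reg y = if y = x then v else s.reg y := by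
  simp [Mem.setReg, Function.update_apply]

@[simp] theorem arr_setReg (s : Mem) (x v : ℕ) : (s.setReg x v).arr = s.arr := rfl

/-! ### Connectives, bounded quantifiers and counting -/

namespace Expr

/-- Truth of an expression: its value is positive. -/
def Tr (e : Expr) (s : Mem) : Prop := 0 < e.eval s

/-- Conjunction. -/
def and (e f : Expr) : Expr := .ite e (.ite f (.const 1) (.const 0)) (.const 0)
/-- Disjunction. -/
def or (e f : Expr) : Expr := .ite e (.const 1) (.ite f (.const 1) (.const 0))
/-- Negation. -/
def not (e : Expr) : Expr := .eq e (.const 0)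
/-- Bounded existential quantification. -/
def any (x : ℕ) (e : Expr) : Expr := .lt (.const 0) (.sum x e)
/-- Bounded universal quantification. -/
def all (x : ℕ) (e : Expr) : Expr := .eq (.sum x (.not e)) (.const 0)
/-- The number of values of a variable that make an expression true. -/
def cnt (x : ℕ) (e : Expr) : Expr := .sum x (.ite e (.const 1) (.const 0))
/-- The least value that makes an expression true. -/
def least (x y : ℕ) (e : ℕ → Expr) : Expr :=
  .cnt x (.all y (.or (.lt (.var x) (.var y)) (.not (e y))))
/-- The value with exactly `f` smaller ones among those that make `e` true. -/
def nth (x y : ℕ) (e : ℕ → Expr) (f : Expr) : Expr :=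
  .sum x (.ite (.and (e x) (.eq (.cnt y (.and (.lt (.var y) (.var x)) (e y))) f)) (.var x)
    (.const 0))

section
variable (e f b : Expr) (s : Mem) (x c : ℕ)

theorem eval_const : (const c).eval s = c := rfl
theorem eval_var : (var x).eval s = s.reg x := rfl
theorem eval_load : (load x e).eval s = s.arr x (e.eval s) := rfl
theorem eval_add : (add e f).eval s = e.eval s + f.eval s := rfl
theorem eval_sub : (sub e f).eval s = e.eval s - f.eval s := rfl
theorem eval_sum : (sum x e).eval s = ∑ i ∈ Finset.range (s.reg 2), e.eval (s.setReg x i) := rfl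
theorem eval_iter :
    (iter x e f).eval s = (fun y => f.eval (s.setReg x y))^[s.reg 2] (e.eval s) := rfl

open Classical in
theorem eval_ite : (ite b e f).eval s = if b.Tr s then e.eval s else f.eval s := by
  simp only [eval, Tr]
  congr

theorem tr_lt : (lt e f).Tr s ↔ e.eval s < f.eval s := by
  simp only [Tr, eval]; split <;> simp_all

theorem tr_eq : (eq e f).Tr s ↔ e.eval s = f.eval s := by
  simp only [Tr, eval]; split <;> simp_all

open Classical in
theorem eval_and : (and e f).eval s = if e.Tr s ∧ f.Tr s then 1 else 0 := by
  simp only [and, eval_ite, eval_const]; split_ifs <;> simp_all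

theorem tr_and : (and e f).Tr s ↔ e.Tr s ∧ f.Tr s := by
  rw [Tr, eval_and]; split <;> simp_all

open Classical in
theorem eval_or : (or e f).eval s = if e.Tr s ∨ f.Tr s then 1 else 0 := by
  simp only [or, eval_ite, eval_const]; split_ifs <;> simp_all

theorem tr_or : (or e f).Tr s ↔ e.Tr s ∨ f.Tr s := by
  rw [Tr, eval_or]; split <;> simp_all

theorem tr_not : (not e).Tr s ↔ ¬ e.Tr s := by
  rw [not, tr_eq, Tr, eval_const]; omega

open Classical in
theorem eval_any : (any x e).eval s = if ∃ i < s.reg 2, e.Tr (s.setReg x i) then 1 else 0 := by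
  rw [any, eval]
  refine if_congr ?_ rfl rfl
  rw [eval_const, eval_sum, Nat.pos_iff_ne_zero, Ne, Finset.sum_eq_zero_iff]
  simp [Tr, Nat.pos_iff_ne_zero]

theorem tr_any : (any x e).Tr s ↔ ∃ i < s.reg 2, e.Tr (s.setReg x i) := by
  rw [Tr, eval_any]; split <;> simp_all

open Classical in
theorem eval_all : (all x e).eval s = if ∀ i < s.reg 2, e.Tr (s.setReg x i) then 1 else 0 := by
  rw [all, eval]
  refine if_congr ?_ rfl rfl
  rw [eval_const, eval_sum, Finset.sum_eq_zero_iff]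
  refine forall_congr' fun i => ?_
  rw [Finset.mem_range]
  refine imp_congr_right fun _ => ?_
  have := tr_not e (s.setReg x i)
  rw [Tr] at this
  rw [← Nat.le_zero, ← not_lt, this, not_not]

theorem tr_all : (all x e).Tr s ↔ ∀ i < s.reg 2, e.Tr (s.setReg x i) := by
  rw [Tr, eval_all]; split <;> simp_all

open Classical in
theorem eval_cnt : (cnt x e).eval s =
    ((Finset.range (s.reg 2)).filter fun i => e.Tr (s.setReg x i)).card := by
  simp only [cnt, eval_sum, eval_ite, eval_const, Finset.card_filter]

end

end Expr

/-! ### Polynomial growth of the evaluation cost -/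

/-- A function with polynomial growth. -/
def PolyBounded (f : ℕ → ℕ) : Prop := ∃ c : ℕ, ∀ u, f u ≤ c * (u + 1) ^ c

namespace PolyBounded

theorem const (c : ℕ) : PolyBounded fun _ => c :=
  ⟨c, fun u => Nat.le_mul_of_pos_right _ (by positivity)⟩

theorem id : PolyBounded fun u => u := ⟨1, fun u => by simp⟩

theorem add {f g : ℕ → ℕ} (hf : PolyBounded f) (hg : PolyBounded g) :
    PolyBounded fun u => f u + g u := by
  obtain ⟨c, hc⟩ := hf
  obtain ⟨d, hd⟩ := hg
  refine ⟨c + d, fun u => (Nat.add_le_add (hc u) (hd u)).trans ?_⟩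
  rw [Nat.add_mul]
  gcongr <;> omega

theorem mul {f g : ℕ → ℕ} (hf : PolyBounded f) (hg : PolyBounded g) :
    PolyBounded fun u => f u * g u := by
  obtain ⟨c, hc⟩ := hf
  obtain ⟨d, hd⟩ := hg
  -- One constant has to dominate both the coefficient `c * d` and the exponent `c + d`.
  refine ⟨c * d + (c + d), fun u => (Nat.mul_le_mul (hc u) (hd u)).trans ?_⟩
  calc c * (u + 1) ^ c * (d * (u + 1) ^ d) = c * d * (u + 1) ^ (c + d) := by rw [pow_add]; ring
    _ ≤ _ := Nat.mul_le_mul (Nat.le_add_right _ _)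
      (Nat.pow_le_pow_right (by omega) (Nat.le_add_left _ _))

theorem cost (e : Expr) : PolyBounded fun u => e.cost u := by
  induction e with
  | const c => exact const 1
  | var x => exact const 1
  | load a e ih => exact ih.add (const 1)
  | add e f ihe ihf => exact (ihe.add ihf).add (const 1)
  | sub e f ihe ihf => exact (ihe.add ihf).add (const 1)
  | lt e f ihe ihf => exact (ihe.add ihf).add (const 2)
  | eq e f ihe ihf => exact (ihe.add ihf).add (const 2)
  | ite b e f ihb ihe ihf => exact ((ihb.add ihe).add ihf).add (const 2)
  | sum x e ih => exact (id.mul (ih.add (const 4))).add (const 6)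
  | iter x e f ihe ihf => exact (ihe.add (id.mul (ihf.add (const 4)))).add (const 7)

end PolyBounded

/-! ### Assignments and tabulation -/

/-- Assignment of the value of an expression to a register. -/
def assign (x : ℕ) (e : Expr) : Prog := .seq (e.compile 30) (.instr (.move x 30))

/-- Tabulation: the cells `i` of the array `a` with `i` below register `2` receive, one after the
other, the value of `e`, in which register `10` stands for `i`. -/
def tab (a : ℕ) (e : Expr) : Prog :=
  .seq (.instr (.const 10 0)) (.loop (.lt 10 2) (.seq (e.compile 30)
    (.seq (.instr (.store a 10 30)) (.seq (.instr (.const 30 1)) (.instr (.add 10 10 30))))))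

/-- A bound for the number of steps of `tab`, if register `2` holds `u`. -/
def tabCost (e : Expr) (u : ℕ) : ℕ := u * (e.cost u + 4) + 2

theorem PolyBounded.tabCost (e : Expr) : PolyBounded (tabCost e) :=
  (id.mul ((cost e).add (const 4))).add (const 2)

/-- Only registers below `10` carry state from one program part to the next: those from `10` to `29`
are for bound variables and the counter of `tab`, those from `30` on for temporaries. -/
theorem runs_assign {x : ℕ} {e : Expr} (he : e.varsBelow 30) {s : Mem} {U : ℕ} (hU : s.reg 2 = U) :
    Runs (assign x e) s (e.cost U + 1) fun s' =>
      s'.reg x = e.eval s ∧ (∀ y < 10, y ≠ x → s'.reg y = s.reg y) ∧ s'.arr = s.arr := by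
  subst hU
  refine (e.runs_compile (by norm_num) he s).seq fun s' ⟨h1, h2, h3⟩ =>
    Runs.instr ⟨?_, fun y hy hyx => ?_, h3⟩
  · simp [Instr.run, h1]
  · simp [Instr.run, hyx, h2 y (by omega)]

/-- The function with the recursion equation `f i = step i f`, if `step i f` depends only on the
values of `f` below `i`. -/
def recTable (step : ℕ → (ℕ → ℕ) → ℕ) (i : ℕ) : ℕ :=
  step i fun l => if l < i then recTable step l else 0

/-- The cut-off to `0` at and above `i` only makes the recursion well-founded; a step that looks
below `i` alone does not notice it. -/
theorem recTable_eq {step : ℕ → (ℕ → ℕ) → ℕ}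
    (h : ∀ i f g, (∀ l < i, f l = g l) → step i f = step i g) (i : ℕ) :
    recTable step i = step i (recTable step) := by
  rw [recTable]
  exact h i _ _ fun l hl => if_pos hl

/-- The content `f` of the array being filled is arbitrary in `hF`, so an expression may read
earlier cells of its own table. When cell `i` is computed, the cells below `i` are final, and
`hstep` makes the others irrelevant. -/
theorem runs_tab {a : ℕ} {e : Expr} (he : e.varsBelow 30) {s : Mem} {U : ℕ} (hU : s.reg 2 = U)
    (step : ℕ → (ℕ → ℕ) → ℕ) (hstep : ∀ i f g, (∀ l < i, f l = g l) → step i f = step i g)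
    (hF : ∀ i < U, ∀ f : ℕ → ℕ,
      e.eval (Mem.setReg ⟨s.reg, Function.update s.arr a f⟩ 10 i) = step i f) :
    Runs (tab a e) s (tabCost e U) fun s' => (∀ y < 10, s'.reg y = s.reg y) ∧
      (∀ b, b ≠ a → s'.arr b = s.arr b) ∧ ∀ i < U, s'.arr a i = recTable step i := by
  subst hU
  let I : ℕ → Mem → Prop := fun j s' => s'.reg 10 = j ∧
    (∀ y < 30, y ≠ 10 → s'.reg y = s.reg y) ∧ (∀ b, b ≠ a → s'.arr b = s.arr b) ∧
      ∀ i < j, s'.arr a i = recTable step i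
  refine Runs.mono (Runs.seq (T := 1)
    (T' := s.reg 2 * (e.cost (s.reg 2) + (1 + (1 + 1)) + 1) + 1) (Q := I 0) ?_
    fun s₁ hs₁ => Runs.loop I ?_ ?_ hs₁) ?_ ?_
  · refine Runs.instr ⟨by simp [Instr.run], fun y _ hy => by simp [Instr.run, hy],
      fun _ _ => rfl, by simp⟩
  · rintro j s' ⟨h1, h2, -, -⟩ -
    simp only [Test.Holds, h1, h2 2 (by norm_num) (by norm_num)]
  · rintro j s' ⟨h1, h2, h3, h4⟩ hj
    have hr2 : s'.reg 2 = s.reg 2 := h2 2 (by norm_num) (by norm_num)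
    refine Runs.seq (by rw [← hr2]; exact e.runs_compile (by norm_num) he s') ?_
    rintro s'' ⟨g1, g2, g3⟩
    refine (Runs.instr rfl).seq ?_
    rintro _ rfl
    refine (Runs.instr rfl).seq ?_
    rintro _ rfl
    have hev : e.eval s' = recTable step j := by
      rw [recTable_eq hstep]
      refine Eq.trans (Expr.eval_congr (by norm_num) he (fun x hx => ?_) ?_)
        ((hF j hj (s'.arr a)).trans (hstep _ _ _ h4))
      · by_cases hxy : x = 10
        · simp [hxy, h1]
        · simp [hxy, h2 x hx hxy]
      · funext b
        by_cases hb : b = a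
        · simp [hb]
        · simp [hb, h3 b hb]
    refine Runs.instr ⟨?_, fun y hy hy' => ?_, fun b hb => ?_, fun i hi => ?_⟩
    · simp [Instr.run, Mem.setArr, g2 10, h1]
    · simp [Instr.run, Mem.setArr, hy', hy.ne, g2 y hy, h2 y hy hy']
    · simp [Instr.run, Mem.setArr, hb, g3, h3 b hb]
    · by_cases hij : i = j
      · simp [Instr.run, Mem.setArr, g1, g2 10, h1, hij, hev]
      · simp [Instr.run, Mem.setArr, g2 10, h1, hij, g3, h4 i (by omega)]
  · simp only [tabCost]; ring_nf; omega
  · rintro s' ⟨-, h2, h3, h4⟩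
    exact ⟨fun y hy => h2 y (by omega) (by omega), h3, h4⟩

/-- Tabulation without recursion. -/
theorem runs_tab_of_eval {a : ℕ} {e : Expr} (he : e.varsBelow 30) {s : Mem} {U : ℕ}
    (hU : s.reg 2 = U) (F : ℕ → ℕ)
    (hF : ∀ i < U, ∀ f : ℕ → ℕ,
      e.eval (Mem.setReg ⟨s.reg, Function.update s.arr a f⟩ 10 i) = F i) :
    Runs (tab a e) s (tabCost e U) fun s' => (∀ y < 10, s'.reg y = s.reg y) ∧
      (∀ b, b ≠ a → s'.arr b = s.arr b) ∧ ∀ i < U, s'.arr a i = F i := by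
  refine (runs_tab he hU (fun i _ => F i) (fun _ _ _ _ => rfl) hF).mono le_rfl ?_
  rintro s' ⟨h1, h2, h3⟩
  exact ⟨h1, h2, fun i hi => by rw [h3 i hi, recTable]⟩

/-- Adjacency of the vertices with given numbers. -/
def AdjN {n : ℕ} (G : SimpleGraph (Fin n)) (i j : ℕ) : Prop :=
  ∃ (hi : i < n) (hj : j < n), G.Adj ⟨i, hi⟩ ⟨j, hj⟩

/-! ### The tables of the algorithm as functions

In this section `A` is an adjacency relation on natural numbers, and all loops run up to `U`. -/

section Tables
open scoped Classical

/-- The least number below `U` with the property `p`, or `U` if there is none. -/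
noncomputable def leastBelow (U : ℕ) (p : ℕ → Prop) : ℕ :=
  ((Finset.range U).filter fun i => ∀ j < U, i < j ∨ ¬ p j).card

/-- The number below `U` with the property `p` that has exactly `a` predecessors with it. -/
noncomputable def nthBelow (U : ℕ) (p : ℕ → Prop) (a : ℕ) : ℕ :=
  ∑ i ∈ Finset.range U,
    if p i ∧ ((Finset.range U).filter fun j => j < i ∧ p j).card = a then i else 0

variable (n k U : ℕ) (A : ℕ → ℕ → Prop)

/-- A step of the greedy matching: the value is `j + 1` if `i` is matched with `j > i`. -/
noncomputable def matchStep (i : ℕ) (f : ℕ → ℕ) : ℕ :=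
  if ∃ l < U, l < i ∧ f l = i + 1 then 0 else
    if leastBelow U (fun j => i < j ∧ A i j ∧ ∀ l < U, l < i → f l ≠ j + 1) < U then
      leastBelow U (fun j => i < j ∧ A i j ∧ ∀ l < U, l < i → f l ≠ j + 1) + 1 else 0

/-- The greedy matching. -/
noncomputable def matchTable : ℕ → ℕ := recTable (matchStep U A)

/-- The vertices covered by the greedy matching. -/
def Covered (v : ℕ) : Prop :=
  v < n ∧ (0 < matchTable U A v ∨ ∃ l < U, l < v ∧ matchTable U A l = v + 1)

/-- The list of the covered vertices. -/
noncomputable def coverList : ℕ → ℕ := nthBelow U (Covered n U A)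

/-- A step of a graph search from the vertex `0`. -/
noncomputable def searchStep (i : ℕ) (f : ℕ → ℕ) : ℕ :=
  if i = 0 then 0 else
    leastBelow U fun v => v < n ∧ (∀ l < U, l < i → f l ≠ v) ∧ ∃ l < U, l < i ∧ A (f l) v

/-- A graph search from the vertex `0`; from some point on `U` if not all vertices are reached. -/
noncomputable def searchTable : ℕ → ℕ := recTable (searchStep n U A)

variable (dig : ℕ → ℕ)

/-- The vertex at a position of a certificate. -/
noncomputable def certVertex (p : ℕ) : ℕ :=
  -- The digits at `p`, `p + 4 * k` and `p + 8 * k` describe one vertex. A third digit `0` means the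
  -- cover vertex numbered by the first; a positive one is one more than the rank among the common
  -- neighbours of two cover vertices. Past the list the value `n` is no vertex.
  if p < 4 * k then
    if 0 < dig (p + 8 * k) then
      nthBelow U (fun v => A v (coverList n U A (dig p)) ∧
        A v (coverList n U A (dig (p + 4 * k)))) (dig (p + 8 * k) - 1)
    else coverList n U A (dig p)
  else n

/-- The first position of a vertex in a certificate, or `4 * k` if there is none. -/
noncomputable def certPos (v : ℕ) : ℕ :=
  ((Finset.range U).filter fun q =>
    q < 4 * k ∧ ∀ j < U, j ≤ q → certVertex n k U A dig j ≠ v).card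

/-- The key of a vertex. -/
noncomputable def certKey (v : ℕ) : ℕ :=
  -- Unlisted vertices get distinct keys behind all positions.
  if certPos n k U A dig v < 4 * k then certPos n k U A dig v else 4 * k + v

/-- The parent of a vertex: the last neighbour with a smaller key. -/
noncomputable def certParent (v : ℕ) : ℕ :=
  ∑ u ∈ Finset.range U, if (A u v ∧ certKey n k U A dig u < certKey n k U A dig v) ∧
    ∀ w < U, (A w v ∧ certKey n k U A dig w < certKey n k U A dig v) →
      ¬ certKey n k U A dig u < certKey n k U A dig w then u else 0

/-- The ancestor test. -/
def CertAnc (r u v : ℕ) : Prop :=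
  -- The walk towards the root stops at `u` or `r`, so that a number of rounds larger than necessary
  -- does no harm.
  (fun y => if y = u ∨ y = r then y else certParent n k U A dig y)^[U] v = u

/-- The number of inner vertices is as required: at least `k` if `b` is true, else at most `k`. -/
def Wanted (b : Bool) (c k : ℕ) : Prop := if b = true then k ≤ c else c ≤ k

/-- The certificate is accepted. -/
def CertOk (b : Bool) : Prop :=
  ∃ r < U, r < n ∧
    (∀ v < U, v < n → ¬ v = r → A (certParent n k U A dig v) v ∧
      certKey n k U A dig (certParent n k U A dig v) < certKey n k U A dig v) ∧
    (∀ u < U, ∀ v < U, A u v → CertAnc n k U A dig r u v ∨ CertAnc n k U A dig r v u) ∧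
    Wanted b ((Finset.range U).filter fun v => v < n ∧
      ∃ w < U, w < n ∧ ¬ w = r ∧ certParent n k U A dig w = v).card k

end Tables

/-! ### The expressions -/

namespace Expr

/-- Implication. -/
def imp (e f : Expr) : Expr := .or (.not e) f

theorem tr_imp (e f : Expr) (s : Mem) : (imp e f).Tr s ↔ (e.Tr s → f.Tr s) := by
  rw [imp, tr_or, tr_not, imp_iff_not_or]

/-- Adjacency. -/
def adj (e f : Expr) : Expr :=
  -- Array `1` holds the row starts. The comparisons with `n` are essential: a column number beyond
  -- `n` would point into another row.
  .and (.lt e (.var 0)) (.and (.lt f (.var 0)) (.load 0 (.add (.load 1 e) f)))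

/-- The start of the row of the adjacency matrix whose number is in register `10`. -/
def rowE : Expr :=
  -- Without multiplication, each row start is obtained from the preceding one by adding `n`.
  .ite (.lt (.const 0) (.var 10)) (.add (.load 1 (.sub (.var 10) (.const 1))) (.var 0)) (.const 0)

/-- The candidates for a greedy partner of the vertex in register `10`; see `matchStep`. -/
def matchCand (j : ℕ) : Expr :=
  .and (.lt (.var 10) (.var j)) (.and (.adj (.var 10) (.var j))
    (.all 11 (.imp (.lt (.var 11) (.var 10))
      (.not (.eq (.load 2 (.var 11)) (.add (.var j) (.const 1)))))))

/-- Evaluates `matchStep`. -/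
def matchE : Expr :=
  .ite (.any 11 (.and (.lt (.var 11) (.var 10))
      (.eq (.load 2 (.var 11)) (.add (.var 10) (.const 1))))) (.const 0)
    (.ite (.lt (.least 12 13 matchCand) (.var 2)) (.add (.least 12 13 matchCand) (.const 1))
      (.const 0))

/-- Decides `Covered`. -/
def coveredE : Expr :=
  .and (.lt (.var 10) (.var 0)) (.or (.load 2 (.var 10))
    (.any 11 (.and (.lt (.var 11) (.var 10))
      (.eq (.load 2 (.var 11)) (.add (.var 10) (.const 1))))))

/-- Evaluates `coverList`. -/
def coverListE : Expr := .nth 11 12 (fun x => .load 3 (.var x)) (.var 10)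

/-- Evaluates `searchStep`. -/
def searchE : Expr :=
  .ite (.eq (.var 10) (.const 0)) (.const 0) (.least 12 13 fun v =>
    .and (.lt (.var v) (.var 0)) (.and
      (.all 11 (.imp (.lt (.var 11) (.var 10)) (.not (.eq (.load 5 (.var 11)) (.var v)))))
      (.any 11 (.and (.lt (.var 11) (.var 10)) (.adj (.load 5 (.var 11)) (.var v))))))

/-- Evaluates `certVertex`. -/
def vertexE : Expr :=
  .ite (.lt (.var 10) (.var 3))
    (.ite (.load 6 (.add (.var 10) (.var 4)))
      (.nth 11 12 (fun x => .and (.adj (.var x) (.load 4 (.load 6 (.var 10))))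
        (.adj (.var x) (.load 4 (.load 6 (.add (.var 10) (.var 3))))))
        (.sub (.load 6 (.add (.var 10) (.var 4))) (.const 1)))
      (.load 4 (.load 6 (.var 10))))
    (.var 0)

/-- Evaluates `certPos`. -/
def posE : Expr :=
  .cnt 11 (.and (.lt (.var 11) (.var 3)) (.all 12 (.imp (.not (.lt (.var 11) (.var 12)))
    (.not (.eq (.load 8 (.var 12)) (.var 10))))))

/-- Evaluates `certKey`. -/
def keyE : Expr := .ite (.lt posE (.var 3)) posE (.add (.var 3) (.var 10))

/-- Says that `u` is adjacent to `v` and has a smaller key. -/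
def earlierE (u v : ℕ) : Expr :=
  .and (.adj (.var u) (.var v)) (.lt (.load 9 (.var u)) (.load 9 (.var v)))

/-- Evaluates `certParent`. -/
def parentE : Expr :=
  .sum 11 (.ite (.and (earlierE 11 10) (.all 12 (.imp (earlierE 12 10)
    (.not (.lt (.load 9 (.var 11)) (.load 9 (.var 12))))))) (.var 11) (.const 0))

/-- Decides `CertAnc`. -/
def ancE (u v : ℕ) : Expr :=
  .eq (.iter 13 (.var v) (.ite (.or (.eq (.var 13) (.var u)) (.eq (.var 13) (.var 20)))
    (.var 13) (.load 10 (.var 13)))) (.var u)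

/-- Counts the vertices that have a child. -/
def innerE : Expr :=
  .cnt 11 (.and (.lt (.var 11) (.var 0)) (.any 12 (.and (.lt (.var 12) (.var 0))
    (.and (.not (.eq (.var 12) (.var 20))) (.eq (.load 10 (.var 12)) (.var 11))))))

/-- Decides `CertOk`. -/
def okE (b : Bool) : Expr :=
  .any 20 (.and (.lt (.var 20) (.var 0)) (.and
    (.all 11 (.imp (.lt (.var 11) (.var 0)) (.imp (.not (.eq (.var 11) (.var 20)))
      (.and (.adj (.load 10 (.var 11)) (.var 11))
        (.lt (.load 9 (.load 10 (.var 11))) (.load 9 (.var 11)))))))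
    (.and (.all 11 (.all 12 (.imp (.adj (.var 11) (.var 12)) (.or (ancE 11 12) (ancE 12 11)))))
      (if b = true then .not (.lt innerE (.var 1)) else .not (.lt (.var 1) innerE)))))

/-- Says that there is a further certificate. -/
def moreE : Expr :=
  .any 11 (.and (.lt (.var 11) (.var 5))
    (.not (.eq (.add (.load 6 (.var 11)) (.const 1)) (.var 6))))

/-- Evaluates the digits of the next certificate. -/
def nextE : Expr :=
  .ite (.all 11 (.imp (.lt (.var 11) (.var 10))
      (.eq (.add (.load 6 (.var 11)) (.const 1)) (.var 6))))
    (.ite (.eq (.add (.load 6 (.var 10)) (.const 1)) (.var 6)) (.const 0)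
      (.add (.load 6 (.var 10)) (.const 1)))
    (.load 6 (.var 10))

/-- Decides the part of `Answer` that does not involve certificates. -/
def extraE (b : Bool) : Expr :=
  if b = true then
    .and (.lt (.var 1) (.cnt 11 (.and (.lt (.var 11) (.var 0)) (.load 2 (.var 11)))))
      -- Without vertices the search condition would hold vacuously, although no root exists.
      (.and (.lt (.const 0) (.var 0))
        (.all 11 (.imp (.lt (.var 11) (.var 0)) (.lt (.load 5 (.var 11)) (.var 0)))))
  else .const 0

end Expr

/-! ### The expressions compute the tables -/

/-- What the algorithm knows about its input from the start. -/
structure Base (n : ℕ) (G : SimpleGraph (Fin n)) (k : ℕ) (s : Mem) : Prop where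
  r0 : s.reg 0 = n
  r1 : s.reg 1 = k
  r2 : s.reg 2 = 12 * k + n + 2
  r3 : s.reg 3 = 4 * k
  r4 : s.reg 4 = 8 * k
  r5 : s.reg 5 = 12 * k
  r6 : s.reg 6 = 6 * k + 2
  r7 : s.reg 7 = 0
  adj : ∀ i < n, ∀ j < n, 0 < s.arr 0 (i * n + j) ↔ AdjN G i j
  row : ∀ i < 12 * k + n + 2, s.arr 1 i = i * n

section
variable {n : ℕ} {G : SimpleGraph (Fin n)} {k : ℕ} {s s' : Mem}

theorem Base.congr (h : Base n G k s) (hr : ∀ y < 8, s'.reg y = s.reg y)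
    (h0 : s'.arr 0 = s.arr 0) (h1 : s'.arr 1 = s.arr 1) : Base n G k s' := by
  obtain ⟨a0, a1, a2, a3, a4, a5, a6, a7, a8, a9⟩ := h
  constructor <;> simp_all

theorem base_setReg {x v : ℕ} (hx : 10 ≤ x) : Base n G k (s.setReg x v) ↔ Base n G k s := by
  have key : ∀ y < 8, (s.setReg x v).reg y = s.reg y := fun y hy => by
    simp [show y ≠ x by omega]
  exact ⟨fun h => h.congr (fun y hy => (key y hy).symm) rfl rfl, fun h => h.congr key rfl rfl⟩

theorem Base.tab (h : Base n G k s) {a : ℕ} (ha : 2 ≤ a) (f : ℕ → ℕ) (i : ℕ) :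
    Base n G k (Mem.setReg ⟨s.reg, Function.update s.arr a f⟩ 10 i) := by
  refine (base_setReg le_rfl).2 (h.congr (fun _ _ => rfl) ?_ ?_)
  · simp [show 0 ≠ a by omega]
  · simp [show 1 ≠ a by omega]

theorem Base.tr_adj (h : Base n G k s) (e f : Expr) :
    (Expr.adj e f).Tr s ↔ AdjN G (e.eval s) (f.eval s) := by
  simp only [Expr.adj, Expr.tr_and, Expr.tr_lt, Expr.eval_var, h.r0]
  constructor
  · rintro ⟨h1, h2, h3⟩
    rw [← h.adj _ h1 _ h2]
    simpa only [Expr.Tr, Expr.eval_load, Expr.eval_add,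
      h.row _ (show e.eval s < 12 * k + n + 2 by omega)] using h3
  · rintro h'
    have ⟨h1, h2, _⟩ := h'
    refine ⟨h1, h2, ?_⟩
    rw [← h.adj _ h1 _ h2] at h'
    simpa only [Expr.Tr, Expr.eval_load, Expr.eval_add,
      h.row _ (show e.eval s < 12 * k + n + 2 by omega)] using h'

end
end RAM

namespace RAM
section
open RAM.Expr
open scoped Classical
variable {n : ℕ} {G : SimpleGraph (Fin n)} {k : ℕ} {s s' : Mem}

theorem Base.eval_least (h : Base n G k s) (x y : ℕ) (e : ℕ → Expr) (p : ℕ → Prop)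
    (hx : 10 ≤ x) (hp : ∀ i < s.reg 2, ∀ j < s.reg 2,
      (e y).Tr ((s.setReg x i).setReg y j) ↔ p j) (hxy : x ≠ y) :
    (least x y e).eval s = leastBelow (12 * k + n + 2) p := by
  simp only [least, eval_cnt, leastBelow, h.r2]
  rw [h.r2] at hp
  congr 1
  refine Finset.filter_congr fun i hi => ?_
  rw [Finset.mem_range] at hi
  simp only [tr_all, reg_setReg, show 2 ≠ x by omega, if_false, h.r2, tr_or, tr_lt, eval_var,
    tr_not, hxy, if_true]
  refine forall_congr' fun j => imp_congr_right fun hj => ?_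
  rw [hp i hi j hj]

theorem Base.eval_nth (h : Base n G k s) (x y : ℕ) (e : ℕ → Expr) (f : Expr) (p : ℕ → Prop)
    (a : ℕ) (hx : 10 ≤ x) (hp : ∀ i < s.reg 2, (e x).Tr (s.setReg x i) ↔ p i)
    (hp' : ∀ i < s.reg 2, ∀ j < s.reg 2, (e y).Tr ((s.setReg x i).setReg y j) ↔ p j)
    (hf : ∀ i < s.reg 2, f.eval (s.setReg x i) = a) (hxy : x ≠ y) :
    (nth x y e f).eval s = nthBelow (12 * k + n + 2) p a := by
  simp only [nth, eval_sum, nthBelow, h.r2, eval_ite, eval_const, eval_var]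
  rw [h.r2] at hp hp' hf
  refine Finset.sum_congr rfl fun i hi => ?_
  rw [Finset.mem_range] at hi
  simp only [tr_and, tr_eq, hp i hi, hf i hi, eval_cnt, reg_setReg, show 2 ≠ x by omega, if_false,
    h.r2, tr_lt, eval_var, if_true, hxy]
  have : ((Finset.range (12 * k + n + 2)).filter fun j =>
      j < i ∧ (e y).Tr ((s.setReg x i).setReg y j)) =
      (Finset.range (12 * k + n + 2)).filter fun j => j < i ∧ p j := by
    refine Finset.filter_congr fun j hj => ?_
    rw [hp' i hi j (Finset.mem_range.1 hj)]
  rw [this]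

theorem Base.eval_matchE (h : Base n G k s) (i : ℕ) (f : ℕ → ℕ) :
    matchE.eval (Mem.setReg ⟨s.reg, Function.update s.arr 2 f⟩ 10 i) =
      matchStep (12 * k + n + 2) (AdjN G) i f := by
  have h' := h.tab le_rfl f i
  have hA : ∀ s e f, Base n G k s → ((Expr.adj e f).Tr s ↔ AdjN G (e.eval s) (f.eval s)) :=
    fun s e f h => h.tr_adj e f
  have hl := h'.eval_least 12 13 matchCand
    (fun j => i < j ∧ AdjN G i j ∧ ∀ l < 12 * k + n + 2, l < i → f l ≠ j + 1) (by norm_num)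
    (fun a _ j _ => by
      simp [matchCand, tr_and, tr_lt, hA, base_setReg, h', tr_all, tr_imp, tr_not, tr_eq, eval_load,
        eval_add, eval_const, eval_var, h.r2]) (by norm_num)
  simp only [matchE, matchStep, eval_ite, tr_lt, eval_add, hl, eval_const]
  simp [tr_any, tr_and, tr_lt, tr_eq, eval_load, eval_add, eval_var, eval_const, h.r2]

theorem Base.tr_coveredE (h : Base n G k s)
    (hm : ∀ i < 12 * k + n + 2, s.arr 2 i = matchTable (12 * k + n + 2) (AdjN G) i) (i : ℕ)
    (hi : i < 12 * k + n + 2) (f : ℕ → ℕ) :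
    coveredE.Tr (Mem.setReg ⟨s.reg, Function.update s.arr 3 f⟩ 10 i) ↔
      Covered n (12 * k + n + 2) (AdjN G) i := by
  simp only [coveredE, Covered, tr_and, tr_or, tr_lt, tr_any, tr_eq, eval_load, eval_add, eval_var,
    eval_const]
  simp only [Tr, eval_load, eval_var]
  simp [h.r2, h.r0, hm i hi]
  refine fun _ => or_congr_right ?_
  refine exists_congr fun l => and_congr_right fun hl => ?_
  rw [hm l hl]

theorem Base.eval_coverListE (h : Base n G k s)
    (hm : ∀ i < 12 * k + n + 2, 0 < s.arr 3 i ↔ Covered n (12 * k + n + 2) (AdjN G) i) (i : ℕ)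
    (f : ℕ → ℕ) : coverListE.eval (Mem.setReg ⟨s.reg, Function.update s.arr 4 f⟩ 10 i) =
      coverList n (12 * k + n + 2) (AdjN G) i := by
  have h' := h.tab (show 2 ≤ 4 by norm_num) f i
  refine h'.eval_nth 11 12 _ _ _ _ (by norm_num) (fun j hj => ?_) (fun l hl j hj => ?_)
    (fun j hj => ?_) (by norm_num)
  · rw [h'.r2] at hj
    rw [← hm j hj]
    simp [Tr, eval_load, eval_var]
  · rw [h'.r2] at hj
    rw [← hm j hj]
    simp [Tr, eval_load, eval_var]
  · simp [eval_var]

theorem Base.eval_searchE (h : Base n G k s) (i : ℕ) (f : ℕ → ℕ) :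
    searchE.eval (Mem.setReg ⟨s.reg, Function.update s.arr 5 f⟩ 10 i) =
      searchStep n (12 * k + n + 2) (AdjN G) i f := by
  have h' := h.tab (show 2 ≤ 5 by norm_num) f i
  have hA : ∀ s e f, Base n G k s → ((Expr.adj e f).Tr s ↔ AdjN G (e.eval s) (f.eval s)) :=
    fun s e f h => h.tr_adj e f
  simp only [searchE, eval_ite, searchStep, tr_eq, eval_const]
  refine if_congr (by simp [eval_var]) rfl ?_
  refine h'.eval_least 12 13 _ _ (by norm_num) (fun a _ j _ => ?_) (by norm_num)
  simp [tr_and, tr_lt, hA, base_setReg, h', tr_all, tr_imp, tr_not, tr_eq, eval_load,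
        eval_var, h.r2, h.r0, tr_any]

variable {dig : ℕ → ℕ}

theorem Base.eval_vertexE (h : Base n G k s)
    (hc : ∀ i < 12 * k + n + 2, s.arr 4 i = coverList n (12 * k + n + 2) (AdjN G) i)
    (hd : ∀ i < 12 * k, s.arr 6 i = dig i) (hB : ∀ i, dig i < 6 * k + 2) (p : ℕ) (f : ℕ → ℕ) :
    vertexE.eval (Mem.setReg ⟨s.reg, Function.update s.arr 8 f⟩ 10 p) =
      certVertex n k (12 * k + n + 2) (AdjN G) dig p := by
  have h' := h.tab (show 2 ≤ 8 by norm_num) f p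
  have hA : ∀ s e f, Base n G k s → ((Expr.adj e f).Tr s ↔ AdjN G (e.eval s) (f.eval s)) :=
    fun s e f h => h.tr_adj e f
  have hlt : ∀ i, dig i < 12 * k + n + 2 := fun i => (hB i).trans_le (by omega)
  simp only [vertexE, certVertex, eval_ite, tr_lt, eval_var]
  refine (if_congr (Q := p < 4 * k) (by simp [h.r3]) rfl rfl).trans ?_
  by_cases hp : p < 4 * k
  · have hz : (load 6 ((var 10).add (var 4))).Tr
        (Mem.setReg ⟨s.reg, Function.update s.arr 8 f⟩ 10 p) ↔ 0 < dig (p + 8 * k) := by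
      simp [Tr, eval_load, eval_add, eval_var, h.r4, hd (p + 8 * k) (by omega)]
    rw [if_pos hp, if_pos hp]
    refine if_congr hz ?_ (by simp [eval_load, eval_var, hd p (by omega), hc _ (hlt _)])
    refine h'.eval_nth 11 12 _ _ _ _ (by norm_num) (fun j hj => ?_) (fun l hl j hj => ?_)
      (fun j hj => ?_) (by norm_num)
    · simp [tr_and, hA, base_setReg, h', eval_load, eval_add, eval_var, h.r3,
        hd p (by omega), hd (p + 4 * k) (by omega), hc _ (hlt _)]
    · simp [tr_and, hA, base_setReg, h', eval_load, eval_add, eval_var, h.r3,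
        hd p (by omega), hd (p + 4 * k) (by omega), hc _ (hlt _)]
    · simp [eval_sub, eval_load, eval_add, eval_const, eval_var, h.r4, hd (p + 8 * k) (by omega)]
  · rw [if_neg hp, if_neg hp]
    simp [h.r0]

theorem Base.eval_keyE (h : Base n G k s)
    (hc : ∀ i < 12 * k + n + 2, s.arr 8 i = certVertex n k (12 * k + n + 2) (AdjN G) dig i)
    (v : ℕ) (f : ℕ → ℕ) :
    keyE.eval (Mem.setReg ⟨s.reg, Function.update s.arr 9 f⟩ 10 v) =
      certKey n k (12 * k + n + 2) (AdjN G) dig v := by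
  have hp : posE.eval (Mem.setReg ⟨s.reg, Function.update s.arr 9 f⟩ 10 v) =
      certPos n k (12 * k + n + 2) (AdjN G) dig v := by
    simp only [posE, certPos, eval_cnt]
    simp only [reg_setReg, h.r2]
    congr 1
    refine Finset.filter_congr fun q hq => ?_
    simp [tr_and, tr_lt, tr_all, tr_imp, tr_not, tr_eq, eval_load, eval_var, h.r3, h.r2]
    intro _
    refine forall_congr' fun j => imp_congr_right fun hj => ?_
    rw [hc j hj]
  simp only [keyE, certKey, eval_ite, tr_lt, eval_add, hp, eval_var]
  simp [h.r3]

theorem Base.eval_parentE (h : Base n G k s)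
    (hc : ∀ i < 12 * k + n + 2, s.arr 9 i = certKey n k (12 * k + n + 2) (AdjN G) dig i)
    (v : ℕ) (hv : v < 12 * k + n + 2) (f : ℕ → ℕ) :
    parentE.eval (Mem.setReg ⟨s.reg, Function.update s.arr 10 f⟩ 10 v) =
      certParent n k (12 * k + n + 2) (AdjN G) dig v := by
  have h' := h.tab (show 2 ≤ 10 by norm_num) f v
  have hA : ∀ s e f, Base n G k s → ((Expr.adj e f).Tr s ↔ AdjN G (e.eval s) (f.eval s)) :=
    fun s e f h => h.tr_adj e f
  simp only [parentE, certParent, eval_sum, reg_setReg, h.r2]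
  refine Finset.sum_congr rfl fun u hu => ?_
  rw [Finset.mem_range] at hu
  simp only [eval_ite, eval_const, earlierE]
  refine if_congr ?_ (by simp [eval_var]) rfl
  simp [tr_and, tr_lt, tr_all, tr_imp, tr_not, hA, base_setReg, h', eval_load, eval_var, h.r2,
    hc u hu, hc v hv]
  intro _ _
  refine forall_congr' fun w => imp_congr_right fun hw => ?_
  rw [hc w hw]

theorem Base.tr_okE (b : Bool) (h : Base n G k s)
    (hk : ∀ i < 12 * k + n + 2, s.arr 9 i = certKey n k (12 * k + n + 2) (AdjN G) dig i)
    (hp : ∀ i < 12 * k + n + 2, s.arr 10 i = certParent n k (12 * k + n + 2) (AdjN G) dig i) :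
    (okE b).Tr s ↔ CertOk n k (12 * k + n + 2) (AdjN G) dig b := by
  have hA : ∀ s e f, Base n G k s → ((Expr.adj e f).Tr s ↔ AdjN G (e.eval s) (f.eval s)) :=
    fun s e f h => h.tr_adj e f
  simp only [okE, CertOk, tr_any, tr_and, tr_lt, h.r2]
  refine exists_congr fun r => and_congr_right fun hr => and_congr (by simp [eval_var, h.r0]) ?_
  have hpar : (all 11 (.imp (.lt (.var 11) (.var 0)) (.imp (.not (.eq (.var 11) (.var 20)))
      (.and (.adj (.load 10 (.var 11)) (.var 11))
        (.lt (.load 9 (.load 10 (.var 11))) (.load 9 (.var 11))))))).Tr (s.setReg 20 r) ↔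
      ∀ v < 12 * k + n + 2, v < n → ¬ v = r →
        AdjN G (certParent n k (12 * k + n + 2) (AdjN G) dig v) v ∧
        certKey n k (12 * k + n + 2) (AdjN G) dig (certParent n k (12 * k + n + 2) (AdjN G) dig v) <
        certKey n k (12 * k + n + 2) (AdjN G) dig v := by
    simp [tr_all, tr_imp, tr_lt, tr_not, tr_eq, tr_and, hA, base_setReg, h, h.r2, h.r0, eval_var,
      eval_load]
    refine forall_congr' fun v => imp_congr_right fun hv => imp_congr_right fun _ =>
      imp_congr_right fun _ => ?_
    rw [hp v hv, hk v hv]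
    -- The key table may be read at the parent only because adjacency already makes the parent a
    -- vertex.
    refine and_congr_right fun hvp => ?_
    rw [hk _ (hvp.1.trans_le (by omega))]
  rw [hpar]
  refine and_congr_right fun hpar' => and_congr ?_ ?_
  · have hanc : ∀ σ x y, x ≠ 13 → y ≠ 13 → σ.reg 2 = 12 * k + n + 2 → σ.reg 20 = r →
        σ.arr = s.arr → σ.reg y < n →
        ((ancE x y).Tr σ ↔ CertAnc n k (12 * k + n + 2) (AdjN G) dig r (σ.reg x) (σ.reg y)) := by
      intro σ x y hx hy h2 h20 harr hlt
      simp only [ancE, tr_eq, eval_iter, eval_var, CertAnc, h2]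
      -- The iterates are compared together with the bound `n`: the parent table is known to be
      -- correct only below the loop bound, and the condition `hpar'` keeps every iterate a vertex.
      suffices H : ∀ m, (fun z => (ite ((var 13).eq (var x) |>.or ((var 13).eq (var 20))) (var 13)
          (load 10 (var 13))).eval (σ.setReg 13 z))^[m] (σ.reg y) =
          (fun z => if z = σ.reg x ∨ z = r then z else
            certParent n k (12 * k + n + 2) (AdjN G) dig z)^[m] (σ.reg y) ∧
          (fun z => if z = σ.reg x ∨ z = r then z else
            certParent n k (12 * k + n + 2) (AdjN G) dig z)^[m] (σ.reg y) < n by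
        rw [(H _).1]
      intro m
      induction m with
      | zero => exact ⟨rfl, hlt⟩
      | succ m ih =>
        rw [Function.iterate_succ_apply', Function.iterate_succ_apply', ih.1]
        refine ⟨?_, ?_⟩
        · simp only [eval_ite, tr_or, tr_eq, eval_var, eval_load, reg_setReg, arr_setReg, hx, harr,
            h20, if_true, if_false]
          refine if_congr (by simp) rfl (hp _ (ih.2.trans_le (by omega)))
        · split_ifs with hz
          · exact ih.2
          · exact (hpar' _ (ih.2.trans_le (by omega)) ih.2 fun h => hz (Or.inr h)).1.1
    simp only [tr_all, reg_setReg, h.r2, tr_imp]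
    refine forall_congr' fun u => imp_congr_right fun hu => forall_congr' fun v =>
      imp_congr_right fun hv => ?_
    rw [hA _ _ _ (by simp [base_setReg, h])]
    refine imp_congr_ctx (by simp [eval_var]) fun ⟨hu', hv', _⟩ => ?_
    have hσ := hanc (((s.setReg 20 r).setReg 11 u).setReg 12 v)
    rw [tr_or, hσ 11 12 (by norm_num) (by norm_num) (by simp [h.r2]) (by simp) rfl (by simpa),
      hσ 12 11 (by norm_num) (by norm_num) (by simp [h.r2]) (by simp) rfl (by simpa)]
    simp
  · have hcnt : innerE.eval (s.setReg 20 r) = ((Finset.range (12 * k + n + 2)).filter fun v =>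
        v < n ∧ ∃ w < 12 * k + n + 2, w < n ∧ ¬ w = r ∧
          certParent n k (12 * k + n + 2) (AdjN G) dig w = v).card := by
      simp only [innerE, eval_cnt, reg_setReg]
      simp only [h.r2, show ¬ (2 : ℕ) = 20 by norm_num, if_false]
      congr 1
      refine Finset.filter_congr fun v hv => ?_
      simp [tr_and, tr_lt, tr_any, tr_not, tr_eq, eval_var, eval_load, h.r0, h.r2]
      intro _
      refine exists_congr fun w => and_congr_right fun hw => ?_
      rw [hp w hw]
    cases b
    · simp [Wanted, tr_not, tr_lt, hcnt, eval_var, h.r1]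
    · simp [Wanted, tr_not, tr_lt, hcnt, eval_var, h.r1]

theorem Base.tr_moreE (h : Base n G k s) (hd : ∀ i < 12 * k + n + 2, s.arr 6 i = dig i) :
    moreE.Tr s ↔ ¬ ∀ i < 12 * k, dig i + 1 = 6 * k + 2 := by
  simp only [moreE, tr_any, tr_and, tr_lt, tr_not, tr_eq, eval_var, eval_add, eval_load, eval_const,
    h.r2]
  simp only [reg_setReg, arr_setReg, if_true, h.r5, h.r6, show ¬ (5 : ℕ) = 11 by norm_num,
    show ¬ (6 : ℕ) = 11 by norm_num, if_false]
  push Not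
  constructor
  · rintro ⟨i, hi, hi', h'⟩
    exact ⟨i, hi', by rwa [← hd i hi]⟩
  · rintro ⟨i, hi, h'⟩
    exact ⟨i, by omega, hi, by rwa [hd i (by omega)]⟩

theorem Base.eval_nextE (h : Base n G k s) (hd : ∀ i < 12 * k + n + 2, s.arr 6 i = dig i)
    (i : ℕ) (hi : i < 12 * k + n + 2) (f : ℕ → ℕ) :
    nextE.eval (Mem.setReg ⟨s.reg, Function.update s.arr 7 f⟩ 10 i) =
      if ∀ l < i, dig l + 1 = 6 * k + 2 then
        if dig i + 1 = 6 * k + 2 then 0 else dig i + 1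
      else dig i := by
  simp only [nextE, eval_ite, eval_load, eval_var, eval_add, eval_const, tr_eq, tr_all, tr_imp,
    tr_lt]
  simp [h.r2, h.r6, hd i hi]
  refine if_congr ⟨fun H l hl => ?_, fun H l hl hl' => ?_⟩ rfl rfl
  · rw [← hd l (by omega)]
    exact H l (by omega) hl
  · rw [hd l hl]
    exact H l hl'

theorem Base.tr_extraE (b : Bool) (h : Base n G k s)
    (hm : ∀ i < 12 * k + n + 2, s.arr 2 i = matchTable (12 * k + n + 2) (AdjN G) i)
    (hs : ∀ i < 12 * k + n + 2, s.arr 5 i = searchTable n (12 * k + n + 2) (AdjN G) i) :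
    (extraE b).Tr s ↔ b = true ∧
      k < ((Finset.range n).filter fun i => 0 < matchTable (12 * k + n + 2) (AdjN G) i).card ∧
      0 < n ∧ ∀ i < n, searchTable n (12 * k + n + 2) (AdjN G) i < n := by
  cases b
  · simp [extraE, Tr, eval_const]
  · simp only [extraE, if_true, true_and, tr_and, tr_lt, tr_all, tr_imp, eval_cnt, eval_var,
      eval_const, eval_load]
    simp only [h.r2, h.r1, h.r0, reg_setReg, arr_setReg, if_true, show ¬ (0 : ℕ) = 11 by norm_num,
      if_false]
    refine and_congr (iff_of_eq ?_) (and_congr Iff.rfl ?_)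
    · congr 2
      ext i
      simp only [Finset.mem_filter, Finset.mem_range, Tr, eval_load, eval_var, reg_setReg,
        arr_setReg, if_true]
      constructor
      · rintro ⟨h1, h2, h3⟩
        exact ⟨h2, by rwa [← hm i h1]⟩
      · rintro ⟨h1, h2⟩
        exact ⟨by omega, h1, by rwa [hm i (by omega)]⟩
    · constructor
      · intro H i hi
        rw [← hs i (by omega)]
        exact H i (by omega) hi
      · intro H i hi hi'
        rw [hs i hi]
        exact H i hi'

end
/-! ### Counting through the certificates -/

/-- The digits of `t` in base `B`. -/
def digit (B t i : ℕ) : ℕ := t / B ^ i % B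

/-- The lowest `i` digits write the number `t % B ^ i`, which is at most `B ^ i - 1`, with equality
exactly if every digit is maximal. -/
theorem digits_max_iff {B : ℕ} (hB : 0 < B) (t i : ℕ) :
    (∀ l < i, digit B t l + 1 = B) ↔ t % B ^ i + 1 = B ^ i := by
  induction i with
  | zero => simp [Nat.mod_one]
  | succ i ih =>
    have h1 : t % B ^ (i + 1) = t % B ^ i + B ^ i * digit B t i := Nat.mod_pow_succ
    have h2 : t % B ^ i < B ^ i := Nat.mod_lt _ (by positivity)
    have h3 : digit B t i < B := Nat.mod_lt _ hB
    rw [h1, pow_succ, Nat.forall_lt_succ_right, ih]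
    generalize B ^ i = b at *
    generalize digit B t i = d at *
    generalize t % b = m at *
    obtain ⟨c, rfl⟩ : ∃ c, B = d + 1 + c := ⟨B - (d + 1), by omega⟩
    constructor
    · rintro ⟨h, h'⟩
      obtain rfl : c = 0 := by omega
      have : b * (d + 1 + 0) = b * d + b := by ring
      omega
    · intro h
      have h4 : b * (d + 1 + c) = b * d + b + b * c := by ring
      have h5 : c = 0 := by
        by_contra hc
        have : b * 1 ≤ b * c := Nat.mul_le_mul_left _ (by omega)
        omega
      subst h5
      simp only [Nat.mul_zero] at h4
      omega

/-- Adding one carries into digit `i` exactly if `B ^ i` divides `t + 1`, that is, if all lower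
digits are maximal. -/
theorem digit_succ {B : ℕ} (hB : 0 < B) (t i : ℕ) : digit B (t + 1) i =
    if ∀ l < i, digit B t l + 1 = B then
      if digit B t i + 1 = B then 0 else digit B t i + 1
    else digit B t i := by
  have hb : 0 < B ^ i := by positivity
  have hd : B ^ i ∣ t + 1 ↔ t % B ^ i + 1 = B ^ i := by
    have h2 : t % B ^ i < B ^ i := Nat.mod_lt _ hb
    rw [Nat.dvd_iff_mod_eq_zero, ← Nat.mod_add_mod]
    generalize t % B ^ i = m at *
    constructor
    · intro h
      by_contra hne
      rw [Nat.mod_eq_of_lt (by omega)] at h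
      omega
    · intro h
      rw [h, Nat.mod_self]
  rw [← digits_max_iff hB] at hd
  have h3 : t / B ^ i % B < B := Nat.mod_lt _ hB
  rw [digit, Nat.succ_div]
  by_cases h : ∀ l < i, digit B t l + 1 = B
  · rw [if_pos h, if_pos (hd.2 h), ← Nat.mod_add_mod, digit]
    split_ifs with h'
    · rw [h', Nat.mod_self]
    · rw [Nat.mod_eq_of_lt (by omega)]
  · rw [if_neg h, if_neg (mt hd.1 h), Nat.add_zero, digit]

theorem digits_max_iff_of_lt {B t m : ℕ} (hB : 0 < B) (ht : t < B ^ m) :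
    (∀ l < m, digit B t l + 1 = B) ↔ t + 1 = B ^ m := by
  rw [digits_max_iff hB, Nat.mod_eq_of_lt ht]

/-! ### The program -/

section
open RAM.Expr

/-- The tables that do not depend on the certificate. -/
def preparation : Prog :=
  .seq (assign 3 (.add (.add (.var 1) (.var 1)) (.add (.var 1) (.var 1))))
  (.seq (assign 4 (.add (.var 3) (.var 3)))
  (.seq (assign 5 (.add (.var 4) (.var 3)))
  (.seq (assign 6 (.add (.add (.var 3) (.add (.var 1) (.var 1))) (.const 2)))
  (.seq (assign 2 (.add (.add (.var 5) (.var 0)) (.const 2)))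
  (.seq (tab 1 rowE) (.seq (tab 2 matchE) (.seq (tab 3 coveredE)
  (.seq (tab 4 coverListE) (.seq (tab 5 searchE) (assign 9 (.const 1)))))))))))

/-- The treatment of one certificate, and the passage to the next one. -/
def round (b : Bool) : Prog :=
  .seq (tab 8 vertexE) (.seq (tab 9 keyE) (.seq (tab 10 parentE)
  (.seq (assign 8 (.or (.var 8) (okE b))) (.seq (assign 9 moreE)
  -- The new digits go through array `7`, since the carry into a digit is decided by the old values
  -- of the lower ones.
  (.seq (tab 7 nextE) (tab 6 (.load 7 (.var 10))))))))

/-- The program for Dual Min-LLT (if `b` is true) and for Dual Max-LLT. -/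
def solver (b : Bool) : Prog :=
  .seq preparation (.seq (.loop (.lt 7 9) (round b)) (assign 0 (.or (.var 8) (extraE b))))

/-- A bound for the number of steps of `preparation`. -/
def preparationCost (u : ℕ) : ℕ :=
  30 + (tabCost rowE u + (tabCost matchE u + (tabCost coveredE u +
    (tabCost coverListE u + (tabCost searchE u + 2)))))

/-- A bound for the number of steps of `round`. -/
def roundCost (b : Bool) (u : ℕ) : ℕ :=
  tabCost vertexE u + (tabCost keyE u + (tabCost parentE u + (((Expr.or (.var 8) (okE b)).cost u + 1)
    + ((moreE.cost u + 1) + (tabCost nextE u + tabCost (.load 7 (.var 10)) u)))))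

theorem polyBounded_preparationCost : PolyBounded preparationCost :=
  (PolyBounded.const 30).add ((PolyBounded.tabCost _).add ((PolyBounded.tabCost _).add
    ((PolyBounded.tabCost _).add ((PolyBounded.tabCost _).add ((PolyBounded.tabCost _).add
      (PolyBounded.const 2))))))

theorem polyBounded_roundCost (b : Bool) : PolyBounded (roundCost b) :=
  (PolyBounded.tabCost _).add ((PolyBounded.tabCost _).add ((PolyBounded.tabCost _).add
    (((PolyBounded.cost _).add (PolyBounded.const 1)).add (((PolyBounded.cost _).add
      (PolyBounded.const 1)).add ((PolyBounded.tabCost _).add (PolyBounded.tabCost _))))))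

variable {n : ℕ} {G : SimpleGraph (Fin n)} {k : ℕ} {s : Mem}

/-- The memory holds the tables that do not depend on the certificate. -/
structure Ready (n : ℕ) (G : SimpleGraph (Fin n)) (k : ℕ) (s : Mem) : Prop where
  base : Base n G k s
  matching : ∀ i < 12 * k + n + 2, s.arr 2 i = matchTable (12 * k + n + 2) (AdjN G) i
  cover : ∀ i < 12 * k + n + 2, s.arr 4 i = coverList n (12 * k + n + 2) (AdjN G) i
  search : ∀ i < 12 * k + n + 2, s.arr 5 i = searchTable n (12 * k + n + 2) (AdjN G) i

theorem Ready.congr {s' : Mem} (h : Ready n G k s) (hr : ∀ y < 8, s'.reg y = s.reg y)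
    (ha : ∀ a < 6, s'.arr a = s.arr a) : Ready n G k s' :=
  ⟨h.base.congr hr (ha 0 (by norm_num)) (ha 1 (by norm_num)),
    by rw [ha 2 (by norm_num)]; exact h.matching, by rw [ha 4 (by norm_num)]; exact h.cover,
    by rw [ha 5 (by norm_num)]; exact h.search⟩

theorem input_adj {i j : ℕ} (hi : i < n) (hj : j < n) :
    0 < (input n G k).arr 0 (i * n + j) ↔ AdjN G i j := by
  simp only [input]
  split_ifs with h
  · obtain ⟨-, i', j', hadj, he⟩ := h
    have h1 : i = i' := by
      have := congrArg (· / n) he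
      simpa [Nat.add_comm _ j, Nat.add_comm _ (j' : ℕ), Nat.add_mul_div_right _ _ (by omega : 0 < n),
        Nat.div_eq_of_lt hj, Nat.div_eq_of_lt j'.2] using this
    have h2 : j = j' := by subst h1; omega
    subst h1 h2
    exact ⟨fun _ => ⟨hi, hj, hadj⟩, fun _ => one_pos⟩
  · refine ⟨fun h' => absurd h' (lt_irrefl _), fun ⟨_, _, hadj⟩ => absurd ⟨rfl, _, _, hadj, rfl⟩ h⟩

theorem matchStep_congr (U : ℕ) (A : ℕ → ℕ → Prop) (i : ℕ) (f g : ℕ → ℕ)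
    (h : ∀ l < i, f l = g l) : matchStep U A i f = matchStep U A i g := by
  have h1 : (∃ l < U, l < i ∧ f l = i + 1) ↔ ∃ l < U, l < i ∧ g l = i + 1 :=
    exists_congr fun l => and_congr_right fun _ => and_congr_right fun hl => by rw [h l hl]
  have h2 : (fun j => i < j ∧ A i j ∧ ∀ l < U, l < i → f l ≠ j + 1) =
      fun j => i < j ∧ A i j ∧ ∀ l < U, l < i → g l ≠ j + 1 := by
    funext j
    refine propext (and_congr_right fun _ => and_congr_right fun _ => forall_congr' fun l =>
      imp_congr_right fun _ => imp_congr_right fun hl => by rw [h l hl])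
  simp only [matchStep, h1, h2]

theorem searchStep_congr (n U : ℕ) (A : ℕ → ℕ → Prop) (i : ℕ) (f g : ℕ → ℕ)
    (h : ∀ l < i, f l = g l) : searchStep n U A i f = searchStep n U A i g := by
  have h2 : (fun v => v < n ∧ (∀ l < U, l < i → f l ≠ v) ∧ ∃ l < U, l < i ∧ A (f l) v) =
      fun v => v < n ∧ (∀ l < U, l < i → g l ≠ v) ∧ ∃ l < U, l < i ∧ A (g l) v := by
    funext j
    refine propext (and_congr_right fun _ => and_congr (forall_congr' fun l =>
      imp_congr_right fun _ => imp_congr_right fun hl => by rw [h l hl])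
      (exists_congr fun l => and_congr_right fun _ => and_congr_right fun hl => by rw [h l hl]))
  simp only [searchStep, h2]

theorem runs_preparation : Runs preparation (input n G k) (preparationCost (12 * k + n + 2))
    fun s => Ready n G k s ∧ (∀ i, s.arr 6 i = 0) ∧ s.reg 8 = 0 ∧ s.reg 9 = 1 := by
  have i0 : (input n G k).reg 0 = n := by simp [input]
  have i1 : (input n G k).reg 1 = k := by simp [input]
  have i2 : ∀ y, 2 ≤ y → (input n G k).reg y = 0 := fun y hy => by
    simp [input, show y ≠ 0 by omega, show y ≠ 1 by omega]
  -- The first five constants, with sum `30`, are the costs of the loop-free assignments, made while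
  -- register `2` is still `0`; the final `2` starts the main loop's flag.
  refine Runs.mono (T := 8 + (4 + (4 + (8 + (6 + (tabCost rowE (12 * k + n + 2) +
    (tabCost matchE (12 * k + n + 2) + (tabCost coveredE (12 * k + n + 2) +
    (tabCost coverListE (12 * k + n + 2) + (tabCost searchE (12 * k + n + 2) + 2))))))))))
    (T' := preparationCost (12 * k + n + 2))
    ?_ (by simp only [preparationCost]; omega) fun _ h => h
  refine (runs_assign (by rfl) (i2 2 le_rfl)).seq ?_
  rintro a ⟨ax, ar, aa⟩
  refine (runs_assign (by rfl) ((ar 2 (by norm_num) (by norm_num)).trans (i2 2 le_rfl))).seq ?_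
  rintro b ⟨bx, br, ba⟩
  refine (runs_assign (by rfl) (U := 0) (by simp [br, ar, i2])).seq ?_
  rintro c ⟨cx, cr, ca⟩
  refine (runs_assign (by rfl) (U := 0) (by simp [cr, br, ar, i2])).seq ?_
  rintro d ⟨dx, dr, da⟩
  refine (runs_assign (by rfl) (U := 0) (by simp [dr, cr, br, ar, i2])).seq ?_
  rintro e ⟨ex, er, ea⟩
  simp only [eval_add, eval_var, eval_const] at ax bx cx dx ex
  have e0 : e.reg 0 = n := by simp [er, dr, cr, br, ar, i0]
  have e1 : e.reg 1 = k := by simp [er, dr, cr, br, ar, i1]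
  have e3 : e.reg 3 = 4 * k := by simp [er, dr, cr, br, ax, i1]; omega
  have e4 : e.reg 4 = 8 * k := by simp [er, dr, cr, bx, ax, i1]; omega
  have e5 : e.reg 5 = 12 * k := by simp [er, dr, cx, br, bx, ax, i1]; omega
  have e6 : e.reg 6 = 6 * k + 2 := by simp [er, dx, cr, br, ar, ax, i1]; omega
  have e2 : e.reg 2 = 12 * k + n + 2 := by
    simp [ex, dr, cx, cr, br, bx, ax, ar, i1, i0]; omega
  have e7 : ∀ y, 7 ≤ y → y < 10 → e.reg y = 0 := fun y hy hy' => by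
    rw [er y hy' (by omega), dr y hy' (by omega), cr y hy' (by omega), br y hy' (by omega),
      ar y hy' (by omega), i2 y (by omega)]
  have earr : e.arr = (input n G k).arr := by rw [ea, da, ca, ba, aa]
  refine (runs_tab (by rfl) e2 (fun i f => if 0 < i then f (i - 1) + n else 0)
    (fun i f g h => ?_) fun i _ f => ?_).seq ?_
  · by_cases hi : 0 < i
    · simp [hi, h (i - 1) (by omega)]
    · simp [hi]
  · simp [rowE, eval_ite, tr_lt, eval_const, eval_var, eval_add, eval_load, eval_sub, e0]
  rintro s1 ⟨r1, a1, t1⟩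
  have hB1 : Base n G k s1 := by
    refine ⟨?_, ?_, ?_, ?_, ?_, ?_, ?_, ?_, fun i hi j hj => ?_, fun i hi => ?_⟩
    iterate 8 rw [r1 _ (by norm_num)]; first | assumption | exact e7 _ (by norm_num) (by norm_num)
    · rw [a1 0 (by norm_num), earr]
      exact input_adj hi hj
    · rw [t1 i hi]
      clear hi
      induction i with
      | zero => rw [recTable]; simp
      | succ i ih =>
        rw [recTable]
        simp [ih, Nat.succ_mul]
  refine (runs_tab (by rfl) hB1.r2 (matchStep (12 * k + n + 2) (AdjN G)) (matchStep_congr _ _)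
    fun i _ f => hB1.eval_matchE i f).seq ?_
  rintro s2 ⟨r2, a2, t2⟩
  have hB2 := hB1.congr (fun y hy => r2 y (by omega)) (a2 0 (by norm_num)) (a2 1 (by norm_num))
  classical
  refine (runs_tab_of_eval (by rfl) hB2.r2
    (fun i => if Covered n (12 * k + n + 2) (AdjN G) i then 1 else 0) fun i hi f => ?_).seq ?_
  · rw [← if_congr (hB2.tr_coveredE t2 i hi f) rfl rfl, coveredE, eval_and, ← if_congr
      (tr_and _ _ _) rfl rfl]
  rintro s3 ⟨r3, a3, t3⟩
  have hB3 := hB2.congr (fun y hy => r3 y (by omega)) (a3 0 (by norm_num)) (a3 1 (by norm_num))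
  refine (runs_tab_of_eval (by rfl) hB3.r2 (coverList n (12 * k + n + 2) (AdjN G))
    fun i hi f => hB3.eval_coverListE (fun j hj => ?_) i f).seq ?_
  · rw [t3 j hj]
    split <;> simp_all
  rintro s4 ⟨r4, a4, t4⟩
  have hB4 := hB3.congr (fun y hy => r4 y (by omega)) (a4 0 (by norm_num)) (a4 1 (by norm_num))
  refine (runs_tab (by rfl) hB4.r2 (searchStep n (12 * k + n + 2) (AdjN G))
    (searchStep_congr _ _ _) fun i _ f => hB4.eval_searchE i f).seq ?_
  rintro s5 ⟨r5, a5, t5⟩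
  have hB5 := hB4.congr (fun y hy => r5 y (by omega)) (a5 0 (by norm_num)) (a5 1 (by norm_num))
  refine (runs_assign (by rfl) hB5.r2).mono le_rfl ?_
  rintro s6 ⟨x6, r6, a6⟩
  refine ⟨⟨hB5.congr (fun y hy => r6 y (by omega) (by omega)) (by rw [a6]) (by rw [a6]),
    fun i hi => ?_, fun i hi => ?_, fun i hi => ?_⟩, fun i => ?_, ?_, x6⟩
  · rw [a6, a5 2 (by norm_num), a4 2 (by norm_num), a3 2 (by norm_num), t2 i hi, matchTable]
  · rw [a6, a5 4 (by norm_num), t4 i hi]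
  · rw [a6, t5 i hi, searchTable]
  · rw [a6, a5 6 (by norm_num), a4 6 (by norm_num), a3 6 (by norm_num), a2 6 (by norm_num),
      a1 6 (by norm_num), earr]
    simp [input]
  · rw [r6 8 (by norm_num) (by norm_num), r5 8 (by norm_num), r4 8 (by norm_num),
      r3 8 (by norm_num), r2 8 (by norm_num), r1 8 (by norm_num), e7 8 (by norm_num) (by norm_num)]

/-- The invariant of the main loop before round `t`. -/
structure Invariant (n : ℕ) (G : SimpleGraph (Fin n)) (k : ℕ) (b : Bool) (t : ℕ) (s : Mem) :
    Prop where
  ready : Ready n G k s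
  dig : ∀ i < 12 * k + n + 2, s.arr 6 i = digit (6 * k + 2) t i
  res : 0 < s.reg 8 ↔ ∃ t' < t, CertOk n k (12 * k + n + 2) (AdjN G) (digit (6 * k + 2) t') b
  go : 0 < s.reg 9 ↔ t < (6 * k + 2) ^ (12 * k)

theorem runs_round (b : Bool) {t : ℕ} (ht : t < (6 * k + 2) ^ (12 * k))
    (h : Invariant n G k b t s) :
    Runs (round b) s (roundCost b (12 * k + n + 2)) (Invariant n G k b (t + 1)) := by
  obtain ⟨hR, hdig, hres, -⟩ := h
  have hB : 0 < 6 * k + 2 := by omega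
  have h2 := hR.base.r2
  -- vertices
  refine Runs.seq (runs_tab_of_eval (by rfl) h2 _ fun p _ f => hR.base.eval_vertexE hR.cover
    (fun i hi => hdig i (by omega)) (fun i => Nat.mod_lt _ hB) p f) ?_
  rintro s1 ⟨hr1, ha1, hv⟩
  have hR1 : Ready n G k s1 :=
    hR.congr (fun y hy => hr1 y (by omega)) fun a ha => ha1 a (by omega)
  have h21 := hR1.base.r2
  -- keys
  refine Runs.seq (runs_tab_of_eval (by rfl) h21 _ fun v _ f => hR1.base.eval_keyE hv v f) ?_
  rintro s2 ⟨hr2, ha2, hk⟩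
  have hR2 : Ready n G k s2 :=
    hR1.congr (fun y hy => hr2 y (by omega)) fun a ha => ha2 a (by omega)
  have h22 := hR2.base.r2
  -- parents
  refine Runs.seq (runs_tab_of_eval (by rfl) h22 _ fun v hv f => hR2.base.eval_parentE hk v
    hv f) ?_
  rintro s3 ⟨hr3, ha3, hp⟩
  have hR3 : Ready n G k s3 :=
    hR2.congr (fun y hy => hr3 y (by omega)) fun a ha => ha3 a (by omega)
  have h23 := hR3.base.r2
  rw [← ha3 9 (by norm_num)] at hk
  have hok := hR3.base.tr_okE b hk hp
  -- result
  refine Runs.seq (runs_assign (by cases b <;> rfl) h23) ?_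
  rintro s4 ⟨hx4, hr4, ha4⟩
  have hR4 : Ready n G k s4 :=
    hR3.congr (fun y hy => hr4 y (by omega) (by omega)) fun a _ => by rw [ha4]
  have h24 := hR4.base.r2
  have hdig4 : ∀ i < 12 * k + n + 2, s4.arr 6 i = digit (6 * k + 2) t i := fun i hi => by
    rw [ha4, ha3 6 (by norm_num), ha2 6 (by norm_num), ha1 6 (by norm_num), hdig i hi]
  have hres4 : 0 < s4.reg 8 ↔
      ∃ t' < t + 1, CertOk n k (12 * k + n + 2) (AdjN G) (digit (6 * k + 2) t') b := by
    have := tr_or (.var 8) (okE b) s3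
    rw [Tr, ← hx4, hok, Tr, eval_var, hr3 8 (by norm_num), hr2 8 (by norm_num),
      hr1 8 (by norm_num), hres] at this
    rw [this, Nat.exists_lt_succ_right]
  -- continuation
  refine Runs.seq (runs_assign (by rfl) h24) ?_
  rintro s5 ⟨hx5, hr5, ha5⟩
  have hR5 : Ready n G k s5 :=
    hR4.congr (fun y hy => hr5 y (by omega) (by omega)) fun a _ => by rw [ha5]
  have h25 := hR5.base.r2
  -- The test precedes the increment: another certificate follows exactly if some digit of `t` is
  -- not maximal.
  have hgo : 0 < s5.reg 9 ↔ t + 1 < (6 * k + 2) ^ (12 * k) := by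
    have := hR4.base.tr_moreE hdig4
    rw [Tr, ← hx5, digits_max_iff_of_lt hB ht] at this
    rw [this]
    omega
  rw [← ha5] at hdig4
  -- next certificate
  refine Runs.seq (runs_tab_of_eval (by rfl) h25 (digit (6 * k + 2) (t + 1)) fun i hi f =>
    (hR5.base.eval_nextE hdig4 i hi f).trans (digit_succ hB t i).symm) ?_
  rintro s6 ⟨hr6, ha6, hn⟩
  have hR6 : Ready n G k s6 :=
    hR5.congr (fun y hy => hr6 y (by omega)) fun a ha => ha6 a (by omega)
  have h26 := hR6.base.r2
  refine (runs_tab_of_eval (by rfl) h26 (digit (6 * k + 2) (t + 1)) fun i hi f => ?_).mono le_rfl ?_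
  · simp [eval_load, eval_var, hn i hi]
  rintro s7 ⟨hr7, ha7, hd⟩
  refine ⟨hR6.congr (fun y hy => hr7 y (by omega)) fun a ha => ha7 a (by omega), hd, ?_, ?_⟩
  · rw [hr7 8 (by norm_num), hr6 8 (by norm_num), hr5 8 (by norm_num) (by norm_num), hres4]
  · rw [hr7 9 (by norm_num), hr6 9 (by norm_num), hgo]

/-- The answer that the program computes. -/
def Answer (n : ℕ) (G : SimpleGraph (Fin n)) (k : ℕ) (b : Bool) : Prop :=
  (∃ t < (6 * k + 2) ^ (12 * k),
    CertOk n k (12 * k + n + 2) (AdjN G) (digit (6 * k + 2) t) b) ∨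
  (b = true ∧
    k < ((Finset.range n).filter fun i => 0 < matchTable (12 * k + n + 2) (AdjN G) i).card ∧
    0 < n ∧ ∀ i < n, searchTable n (12 * k + n + 2) (AdjN G) i < n)

theorem runs_solver (b : Bool) : Runs (solver b) (input n G k)
    (preparationCost (12 * k + n + 2) +
      (((6 * k + 2) ^ (12 * k) * (roundCost b (12 * k + n + 2) + 1) + 1) +
        ((Expr.or (.var 8) (extraE b)).cost (12 * k + n + 2) + 1)))
    fun s => (Answer n G k b → s.reg 0 = 1) ∧ (¬ Answer n G k b → s.reg 0 = 0) := by
  refine runs_preparation.seq ?_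
  rintro s ⟨hR, hd, h8, h9⟩
  refine Runs.seq (Runs.loop (Invariant n G k b) (fun j s hs _ => ?_)
    (fun j s hs hj => runs_round b hj hs) ⟨hR, ?_, ?_, ?_⟩) ?_
  · simp only [Test.Holds, hs.ready.base.r7, hs.go]
  · intro i _
    simp [hd, digit]
  · simp [h8]
  · rw [h9]
    exact iff_of_true one_pos (by positivity)
  rintro s' ⟨hR', -, hres, -⟩
  have h2 := hR'.base.r2
  refine (runs_assign (by cases b <;> rfl) h2).mono le_rfl ?_
  rintro s'' ⟨h, -, -⟩
  rw [h, eval_or, hR'.base.tr_extraE b hR'.matching hR'.search, Tr, eval_var, hres]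
  exact ⟨fun ha => if_pos ha, fun ha => if_neg ha⟩

/-- For `k = 0` the first factor is `1`. For positive `k`, `6 * k + 2 ≤ 8 * k`, and `8 ^ (12 * k)`
is at most `k ^ (36 * k)` once `2 ≤ k`, as then `8 ≤ k ^ 3`; the case `k = 1` costs the factor `8 ^
12`. The polynomial part is split by `12 * k + n + 3 ≤ 15 * k * (n + 1)`. -/
theorem time_bound {f : ℕ → ℕ} (hf : PolyBounded f) : ∃ C : ℕ, ∀ n k : ℕ,
    (6 * k + 2) ^ (12 * k) * f (12 * k + n + 2) ≤ C * k ^ (C * k) * (n + 1) ^ C := by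
  obtain ⟨c, hc⟩ := hf
  -- The first summand bounds the coefficient, `48 + c` the multiple of `k` in the exponent of `k`,
  -- and `c` the exponent of `n + 1`.
  refine ⟨8 ^ 12 * (c * 15 ^ c) + (48 + c), fun n k => ?_⟩
  set C := 8 ^ 12 * (c * 15 ^ c) + (48 + c) with hC
  have hpos : c * 15 ^ c ≤ C := by omega
  have hn : (n + 1) ^ c ≤ (n + 1) ^ C := Nat.pow_le_pow_right (by omega) (by omega)
  refine (Nat.mul_le_mul_left _ (hc _)).trans ?_
  rcases Nat.eq_zero_or_pos k with rfl | hk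
  · simp only [Nat.mul_zero, pow_zero, one_mul, mul_one, Nat.zero_add]
    calc c * (n + 2 + 1) ^ c ≤ c * (15 * (n + 1)) ^ c := by gcongr; omega
      _ = (c * 15 ^ c) * (n + 1) ^ c := by rw [mul_pow]; ring
      _ ≤ _ := Nat.mul_le_mul hpos hn
  · have h8 : 8 ^ (12 * k) ≤ 8 ^ 12 * k ^ (36 * k) := by
      rcases Nat.lt_or_ge k 2 with h | h
      · obtain rfl : k = 1 := by omega
        norm_num
      · calc 8 ^ (12 * k) ≤ (k ^ 3) ^ (12 * k) :=
              Nat.pow_le_pow_left ((by norm_num : 8 = 2 ^ 3) ▸ Nat.pow_le_pow_left h 3) _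
          _ = 1 * k ^ (36 * k) := by rw [← pow_mul, one_mul]; congr 1; ring
          _ ≤ _ := Nat.mul_le_mul_right _ (by norm_num)
    have h1 : (6 * k + 2) ^ (12 * k) ≤ 8 ^ 12 * k ^ (48 * k) := by
      calc (6 * k + 2) ^ (12 * k) ≤ (8 * k) ^ (12 * k) := Nat.pow_le_pow_left (by omega) _
        _ = 8 ^ (12 * k) * k ^ (12 * k) := mul_pow ..
        _ ≤ 8 ^ 12 * k ^ (36 * k) * k ^ (12 * k) := Nat.mul_le_mul_right _ h8
        _ = _ := by rw [mul_assoc, ← pow_add]; congr 2; ring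
    have h2 : (12 * k + n + 2 + 1) ^ c ≤ 15 ^ c * k ^ (c * k) * (n + 1) ^ c := by
      calc (12 * k + n + 2 + 1) ^ c ≤ (15 * k * (n + 1)) ^ c := by
            refine Nat.pow_le_pow_left ?_ _
            nlinarith
        _ = 15 ^ c * k ^ c * (n + 1) ^ c := by rw [mul_pow, mul_pow]
        _ ≤ _ := by
          gcongr
          exact Nat.le_mul_of_pos_right _ hk
    calc (6 * k + 2) ^ (12 * k) * (c * (12 * k + n + 2 + 1) ^ c)
        ≤ 8 ^ 12 * k ^ (48 * k) * (c * (15 ^ c * k ^ (c * k) * (n + 1) ^ c)) :=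
          Nat.mul_le_mul h1 (Nat.mul_le_mul_left _ h2)
      _ = 8 ^ 12 * (c * 15 ^ c) * k ^ ((48 + c) * k) * (n + 1) ^ c := by
          rw [Nat.add_mul, pow_add]; ring
      _ ≤ _ := Nat.mul_le_mul (Nat.mul_le_mul (by omega)
          (Nat.pow_le_pow_right hk (Nat.mul_le_mul_right _ (by omega)))) hn

theorem exists_solves (b : Bool) {Q : (n : ℕ) → SimpleGraph (Fin n) → ℕ → Prop}
    (hQ : ∀ n G k, Q n G k ↔ Answer n G k b) : SolvableInFPTTime Q := by
  have hpoly : PolyBounded fun u => preparationCost u + ((roundCost b u + 1 + 1) +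
      ((Expr.or (.var 8) (extraE b)).cost u + 1)) :=
    polyBounded_preparationCost.add ((((polyBounded_roundCost b).add (.const 1)).add (.const 1)).add
      ((PolyBounded.cost _).add (.const 1)))
  obtain ⟨C, hC⟩ := time_bound hpoly
  refine ⟨solver b, C, fun n G k => ?_⟩
  obtain ⟨s, t, h, ht, h1, h2⟩ := runs_solver (n := n) (G := G) (k := k) b
  refine ⟨s, t, h, ht.trans (le_trans ?_ (hC n k)), ?_⟩
  · have : 1 ≤ (6 * k + 2) ^ (12 * k) := Nat.one_le_pow _ _ (by omega)
    generalize (6 * k + 2) ^ (12 * k) = M at *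
    nlinarith
  · rw [hQ]
    exact ⟨h1, h2⟩

end
end RAM

/-! ## Rooted spanning trees given by their parent functions -/

section Rooting
variable {V : Type*}

/-- The vertex `u` is reached from `v` by iterating the parent function. -/
def Above (par : V → V) (u v : V) : Prop := ∃ t : ℕ, par^[t] v = u

/-- The function `par` is the parent function of a tree with root `r`. -/
structure IsRooting (r : V) (par : V → V) : Prop where
  root : par r = r
  reach : ∀ v, Above par r v

/-- The parent function `par` describes a depth-first search tree of `G` with root `r`. -/
structure IsDFSRooting (G : SimpleGraph V) (r : V) (par : V → V) : Prop extends IsRooting r par where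
  adj : ∀ v, v ≠ r → G.Adj v (par v)
  comparable : ∀ u v, G.Adj u v → Above par u v ∨ Above par v u

open Classical in
/-- The vertices that have a child. -/
noncomputable def innerVertices [Fintype V] (r : V) (par : V → V) : Finset V :=
  Finset.univ.filter fun v => ∃ w, w ≠ r ∧ par w = v

theorem mem_innerVertices [Fintype V] {r : V} {par : V → V} {v : V} :
    v ∈ innerVertices r par ↔ ∃ w, w ≠ r ∧ par w = v := by
  simp [innerVertices]

variable {par : V → V} {r u v w : V}

theorem Above.refl (par : V → V) (v : V) : Above par v v := ⟨0, rfl⟩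

theorem Above.parent (par : V → V) (v : V) : Above par (par v) v := ⟨1, rfl⟩

theorem Above.trans (h : Above par u v) (h' : Above par v w) : Above par u w := by
  obtain ⟨t, rfl⟩ := h
  obtain ⟨t', rfl⟩ := h'
  exact ⟨t + t', Function.iterate_add_apply ..⟩

theorem above_iff : Above par u v ↔ u = v ∨ Above par u (par v) := by
  constructor
  · rintro ⟨_ | t, rfl⟩
    · exact Or.inl rfl
    · exact Or.inr ⟨t, rfl⟩
  · rintro (rfl | h)
    · exact .refl _ _
    · exact h.trans (.parent _ _)

theorem Above.total (h : Above par u w) (h' : Above par v w) : Above par u v ∨ Above par v u := by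
  obtain ⟨t, rfl⟩ := h
  obtain ⟨t', rfl⟩ := h'
  rcases le_total t t' with h | h
  · exact Or.inr ⟨t' - t, by rw [← Function.iterate_add_apply, Nat.sub_add_cancel h]⟩
  · exact Or.inl ⟨t - t', by rw [← Function.iterate_add_apply, Nat.sub_add_cancel h]⟩

theorem IsRooting.of_decreasing (hr : par r = r) (d : V → ℕ) (hd : ∀ v, v ≠ r → d (par v) < d v) :
    IsRooting r par := by
  refine ⟨hr, fun v => ?_⟩
  induction hv : d v using Nat.strong_induction_on generalizing v with
  | _ m ih =>
    by_cases h : v = r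
    · exact h ▸ .refl _ _
    · exact (ih _ (hv ▸ hd v h) _ rfl).trans (.parent _ _)

theorem IsRooting.exists_depth (h : IsRooting r par) :
    ∃ d : V → ℕ, ∀ v, v ≠ r → d (par v) < d v := by
  classical
  refine ⟨fun v => Nat.find (h.reach v), fun v hv => ?_⟩
  have h1 := Nat.find_spec (h.reach v)
  rcases hm : Nat.find (h.reach v) with _ | m
  · rw [hm] at h1
    exact absurd h1 hv
  · rw [hm] at h1
    simp only [hm]
    exact Nat.lt_succ_of_le (Nat.find_min' (h.reach (par v)) h1)

theorem Above.depth_le (hr : par r = r) {d : V → ℕ} (hd : ∀ v, v ≠ r → d (par v) < d v)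
    (h : Above par u v) : u = v ∨ d u < d v := by
  obtain ⟨t, rfl⟩ := h
  induction t generalizing v with
  | zero => exact Or.inl rfl
  | succ t ih =>
    by_cases hv : v = r
    · left
      rw [hv]
      exact Function.iterate_fixed hr _
    · right
      rw [Function.iterate_succ_apply]
      rcases ih (v := par v) with h | h
      · rw [h]
        exact hd v hv
      · exact h.trans (hd v hv)

theorem IsRooting.antisymm (h : IsRooting r par) (huv : Above par u v) (hvu : Above par v u) :
    u = v := by
  obtain ⟨d, hd⟩ := h.exists_depth
  rcases huv.depth_le h.root hd with h1 | h1
  · exact h1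
  · rcases hvu.depth_le h.root hd with h2 | h2
    · exact h2.symm
    · omega

theorem IsRooting.above_root (h : IsRooting r par) (hu : Above par u r) : u = r :=
  h.antisymm hu (h.reach u)

theorem IsRooting.parent_ne (h : IsRooting r par) (hv : v ≠ r) : par v ≠ v := by
  obtain ⟨d, hd⟩ := h.exists_depth
  intro he
  have := hd v hv
  rw [he] at this
  omega

/-- A proper ancestor has a child that is still an ancestor. -/
theorem IsRooting.exists_child (h : IsRooting r par) (huv : Above par u v) (hne : u ≠ v) :
    ∃ w, w ≠ r ∧ par w = u ∧ Above par w v := by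
  obtain ⟨t, ht⟩ := huv
  induction t generalizing v with
  | zero => exact absurd ht.symm hne
  | succ t ih =>
    by_cases hv : v = r
    · subst hv
      exact absurd ((h.above_root ⟨t + 1, ht⟩)) hne
    · by_cases hu : u = par v
      · exact ⟨v, hv, hu.symm, .refl _ _⟩
      · obtain ⟨w, h1, h2, h3⟩ := ih hu ht
        exact ⟨w, h1, h2, h3.trans (.parent _ _)⟩

variable {T G : SimpleGraph V}

/-- The path to `v` is the path to its parent prolonged by one edge; it is still a path since `v` is
not above its own parent. -/
theorem IsRooting.exists_path (h : IsRooting r par) (hT : ∀ v, v ≠ r → T.Adj v (par v)) (v : V) :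
    ∃ p : T.Walk r v, p.IsPath ∧ ∀ u, u ∈ p.support ↔ Above par u v := by
  obtain ⟨d, hd⟩ := h.exists_depth
  induction hv : d v using Nat.strong_induction_on generalizing v with
  | _ m ih =>
    by_cases hr : v = r
    · subst hr
      refine ⟨.nil, .nil, fun u => ?_⟩
      rw [SimpleGraph.Walk.support_nil, List.mem_singleton]
      exact ⟨fun hu => hu ▸ .refl _ _, h.above_root⟩
    · obtain ⟨p, hp, hs⟩ := ih _ (hv ▸ hd v hr) _ rfl
      have hv : v ∉ p.support := fun hm =>
        h.parent_ne hr (h.antisymm (.parent _ _) ((hs v).1 hm))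
      refine ⟨p.concat (hT v hr).symm, hp.concat hv _, fun u => ?_⟩
      rw [SimpleGraph.Walk.support_concat, List.mem_append, hs, List.mem_singleton,
        above_iff (v := v), or_comm]

theorem IsRooting.isAncestor_iff (h : IsRooting r par) (hT : ∀ v, v ≠ r → T.Adj v (par v))
    (hac : T.IsAcyclic) : IsAncestor T r u v ↔ Above par u v := by
  obtain ⟨p, hp, hs⟩ := h.exists_path hT v
  constructor
  · rintro ⟨q, hq, hu⟩
    rw [← hs, show p = q from congrArg Subtype.val
      ((hac.subsingleton_path _ _).elim ⟨p, hp⟩ ⟨q, hq⟩)]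
    exact hu
  · exact fun hu => ⟨p, hp, (hs u).2 hu⟩

/-- A vertex with a proper descendant has a child, so the leaves are exactly the vertices that are
not inner. This turns both problems into questions about inner vertices. -/
theorem IsRooting.numLeaves_add [Fintype V] (h : IsRooting r par)
    (hT : ∀ v, v ≠ r → T.Adj v (par v)) (hac : T.IsAcyclic) :
    numLeaves T r + (innerVertices r par).card = Fintype.card V := by
  classical
  have h1 : {v : V | IsTreeLeaf T r v} = ↑(innerVertices r par)ᶜ := by
    ext v
    rw [Set.mem_ofPred_eq, Finset.mem_coe, Finset.mem_compl, mem_innerVertices]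
    simp only [IsTreeLeaf, h.isAncestor_iff hT hac]
    constructor
    · rintro hl ⟨w, hw, rfl⟩
      exact h.parent_ne hw (hl w (.parent _ _)).symm
    · intro hl w hw
      by_contra hne
      obtain ⟨x, h1, h2, -⟩ := h.exists_child hw (Ne.symm hne)
      exact hl ⟨x, h1, h2⟩
  rw [numLeaves, h1, Set.ncard_coe_finset, Finset.card_compl]
  have := Finset.card_le_univ (innerVertices r par)
  omega

/-- The edges from each non-root vertex to its parent connect everything to the root, and there are
at most `Fintype.card V - 1` of them, so they form a tree. -/
theorem IsDFSRooting.exists_isDFSTree [Fintype V] (h : IsDFSRooting G r par) :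
    ∃ T, IsDFSTree G r T ∧ numLeaves T r + (innerVertices r par).card = Fintype.card V := by
  classical
  let T : SimpleGraph V := SimpleGraph.fromRel fun u v => u ≠ r ∧ v = par u
  have hT : ∀ v, v ≠ r → T.Adj v (par v) := fun v hv =>
    (SimpleGraph.fromRel_adj _ _ _).2 ⟨(h.parent_ne hv).symm, Or.inl ⟨hv, rfl⟩⟩
  have hTG : T ≤ G := by
    intro u v huv
    obtain ⟨-, ⟨hu, rfl⟩ | ⟨hv, rfl⟩⟩ := (SimpleGraph.fromRel_adj _ _ _).1 huv
    · exact h.adj u hu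
    · exact (h.adj v hv).symm
  have hconn : T.Connected := by
    rw [SimpleGraph.connected_iff_exists_forall_reachable]
    exact ⟨r, fun v => (h.exists_path hT v).elim fun p _ => ⟨p⟩⟩
  have htree : T.IsTree := by
    rw [SimpleGraph.isTree_iff_connected_and_card]
    refine ⟨hconn, le_antisymm ?_ hconn.card_vert_le_card_edgeSet_add_one⟩
    have hsub : T.edgeSet ⊆ ((Finset.univ.erase r).image fun v => s(v, par v) : Finset (Sym2 V)) := by
      intro e
      induction e using Sym2.ind with
      | _ u v =>
        intro huv
        rw [SimpleGraph.mem_edgeSet] at huv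
        obtain ⟨-, ⟨hu, rfl⟩ | ⟨hv, rfl⟩⟩ := (SimpleGraph.fromRel_adj _ _ _).1 huv
        · simpa using ⟨u, hu, Or.inl ⟨rfl, rfl⟩⟩
        · simpa using ⟨v, hv, Or.inr ⟨rfl, rfl⟩⟩
    have h1 := Set.ncard_le_ncard hsub (Finset.finite_toSet _)
    rw [Set.ncard_coe_finset] at h1
    have h2 : ((Finset.univ.erase r).image fun v => s(v, par v)).card ≤ Fintype.card V - 1 :=
      Finset.card_image_le.trans (by simp)
    have h3 : 0 < Fintype.card V := Fintype.card_pos_iff.2 ⟨r⟩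
    rw [Nat.card_coe_set_eq, Nat.card_eq_fintype_card]
    omega
  refine ⟨T, ⟨hTG, htree, fun u v huv => Or.inr ?_⟩,
    h.numLeaves_add hT htree.isAcyclic⟩
  rw [h.isAncestor_iff hT htree.isAcyclic, h.isAncestor_iff hT htree.isAcyclic]
  exact h.comparable u v huv

/-- The parent is a neighbour in `T` closer to the root; by uniqueness of paths its iterates are the
ancestors. -/
theorem IsDFSTree.exists_isDFSRooting [Fintype V] (h : IsDFSTree G r T) :
    ∃ par, IsDFSRooting G r par ∧
      numLeaves T r + (innerVertices r par).card = Fintype.card V := by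
  classical
  have hconn : T.Connected := h.isTree.connected
  have hstep : ∀ v, v ≠ r → ∃ u, T.Adj v u ∧ T.dist r u < T.dist r v := by
    intro v hv
    obtain ⟨p, hp⟩ := hconn.exists_walk_length_eq_dist v r
    cases p with
    | nil => exact absurd rfl hv
    | cons hadj q =>
      refine ⟨_, hadj, ?_⟩
      rw [SimpleGraph.Walk.length_cons] at hp
      rw [SimpleGraph.dist_comm, SimpleGraph.dist_comm (u := r) (v := v), ← hp]
      exact Nat.lt_succ_of_le (SimpleGraph.dist_le q)
  choose! par hadj hdist using hstep
  let par' : V → V := fun v => if v = r then r else par v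
  have hp : ∀ v, v ≠ r → par' v = par v := fun v hv => if_neg hv
  have hT : ∀ v, v ≠ r → T.Adj v (par' v) := fun v hv => hp v hv ▸ hadj v hv
  have hroot : IsRooting r par' := IsRooting.of_decreasing (if_pos rfl) (T.dist r) fun v hv =>
    hp v hv ▸ hdist v hv
  have hanc : ∀ {u v}, IsAncestor T r u v ↔ Above par' u v :=
    hroot.isAncestor_iff hT h.isTree.isAcyclic
  refine ⟨par', ⟨hroot, fun v hv => h.le (hT v hv), fun u v huv => ?_⟩,
    hroot.numLeaves_add hT h.isTree.isAcyclic⟩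
  rcases h.edge u v huv with huv | huv | huv
  · obtain ⟨p, hp, hs⟩ := hroot.exists_path hT u
    -- The definition lets tree edges pass without comparability, but it holds for them too: if `v`
    -- is not on the path to `u`, that path extends to `v`.
    by_cases hv : v ∈ p.support
    · exact Or.inr ((hs v).1 hv)
    · exact Or.inl (hanc.1 ⟨p.concat huv, hp.concat hv huv, by simp⟩)
  · exact Or.inl (hanc.1 huv)
  · exact Or.inr (hanc.1 huv)

end Rooting

/-! ### Exchanging an inner vertex for a leaf -/

section Exchange
variable {V : Type*} {G : SimpleGraph V} {par : V → V} {r u v w c d : V}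

theorem IsDFSRooting.above_of_adj_leaf (h : IsDFSRooting G r par) (hw : ∀ y, y ≠ r → par y ≠ w)
    (huw : G.Adj u w) : Above par u w := by
  rcases h.comparable u w huw with h' | h'
  · exact h'
  · obtain ⟨y, h1, h2, -⟩ := h.exists_child h' huw.ne'
    exact absurd h2 (hw y h1)

section
variable [DecidableEq V]

/-- The parent function in which the leaf `w` takes the place of the vertex `v` with the only child
`c`, and `v` becomes a child of `d`. -/
def exchangePar (r : V) (par : V → V) (v w c d : V) (x : V) : V :=
  if x = v then d else if x = w then (if v = r then w else par v) else if x = c then w else par x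

/-- The root that belongs to `exchangePar`. -/
def exchangeRoot (r v w : V) : V := if v = r then w else r

/-- Vertices other than `v` and `w` keep their mutual ancestor relations, as `w` merely replaces `v`
between `par v` and `c`. Now `v` hangs below `d`, and all its neighbours lie on the path to `d`. The
neighbours of the leaf `w` were its ancestors, hence comparable with `c`, and so they are comparable
with the new position of `w`. -/
theorem IsDFSRooting.exchange (h : IsDFSRooting G r par) (hvw : ¬ G.Adj v w)
    (hcr : c ≠ r) (hc : par c = v) (huniq : ∀ y, y ≠ r → par y = v → y = c)
    (hleaf : ∀ y, y ≠ r → par y ≠ w) (hwr : w ≠ r) (hwc : G.Adj w c)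
    (hwa : v ≠ r → G.Adj w (par v)) (hvd : G.Adj v d) (hd : ∀ x, G.Adj v x → Above par x d) :
    IsDFSRooting G (exchangeRoot r v w) (exchangePar r par v w c d) := by
  obtain ⟨δ, hδ⟩ := h.exists_depth
  have hne : v ≠ w := fun he => hleaf c hcr (hc.trans he)
  have hcv : c ≠ v := fun he => h.parent_ne hcr (hc.trans he.symm)
  have hcw : c ≠ w := hwc.ne'
  have hdv : d ≠ v := hvd.ne'
  have hdw : d ≠ w := fun he => hvw (he ▸ hvd)
  set p := exchangePar r par v w c d with hp
  have pv : p v = d := if_pos rfl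
  have pw : v ≠ r → p w = par v := fun hv => by simp [hp, exchangePar, hne.symm, hv]
  have pw' : v = r → p w = w := fun hv => by simp [hp, exchangePar, hwr, hv]
  have pc : p c = w := by simp [hp, exchangePar, hcv, hcw]
  have po : ∀ x, x ≠ v → x ≠ w → x ≠ c → p x = par x := fun x h1 h2 h3 => by
    simp [hp, exchangePar, h1, h2, h3]
  -- Both claims are proved together by induction on the depth. Only the step from `c` upwards is
  -- new: it now leads through `w` to the old parent of `v`.
  have key : ∀ y, y ≠ v → y ≠ w → (∀ x, x ≠ v → x ≠ w → Above par x y → Above p x y) ∧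
      (Above par v y → Above p w y) := by
    intro y
    induction hy : δ y using Nat.strong_induction_on generalizing y with
    | _ m ih =>
      intro yv yw
      by_cases hyr : y = r
      · subst hyr
        refine ⟨fun x _ _ hx => h.above_root hx ▸ .refl _ _, fun hv => absurd (h.above_root hv).symm yv⟩
      · by_cases hyc : y = c
        · subst hyc
          have hwy : Above p w y := pc ▸ .parent p y
          refine ⟨fun x xv xw hx => ?_, fun _ => hwy⟩
          rcases above_iff.1 hx with rfl | hx
          · exact .refl _ _
          · rw [hc] at hx
            have hvr : v ≠ r := fun hv => xv ((h.above_root (hv ▸ hx)).trans hv.symm)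
            have hx := (above_iff.1 hx).resolve_left xv
            have h1 := hδ y hyr
            have h2 := hδ v hvr
            rw [hc] at h1
            have := (ih _ (by omega) (par v) rfl (h.parent_ne hvr) (hleaf v hvr)).1 x xv xw hx
            exact this.trans (.trans (pw hvr ▸ .parent p w) hwy)
        · have hpy : p y = par y := po y yv yw hyc
          have ih := ih _ (hy ▸ hδ y hyr) (par y) rfl (fun he => hyc (huniq y hyr he)) (hleaf y hyr)
          have hup : Above p (par y) y := hpy ▸ .parent p y
          refine ⟨fun x xv xw hx => ?_, fun hx => ?_⟩
          · rcases above_iff.1 hx with rfl | hx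
            · exact .refl _ _
            · exact (ih.1 x xv xw hx).trans hup
          · exact (ih.2 ((above_iff.1 hx).resolve_left yv.symm)).trans hup
  have hreach : ∀ y, y ≠ v → y ≠ w → Above p (exchangeRoot r v w) y := by
    intro y yv yw
    by_cases hv : v = r
    · rw [exchangeRoot, if_pos hv]
      exact (key y yv yw).2 (hv ▸ h.reach y)
    · rw [exchangeRoot, if_neg hv]
      exact (key y yv yw).1 r (Ne.symm hv) hwr.symm (h.reach y)
  have hcomp : ∀ x y, x ≠ v → x ≠ w → y ≠ v → y ≠ w → G.Adj x y → Above p x y ∨ Above p y x := by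
    intro x y xv xw yv yw hxy
    exact (h.comparable x y hxy).imp ((key y yv yw).1 x xv xw) ((key x xv xw).1 y yv yw)
  have hcompv : ∀ x, G.Adj v x → Above p x v := by
    intro x hx
    have hxd := (key d hdv hdw).1 x hx.ne' (fun he => hvw (he ▸ hx)) (hd x hx)
    exact hxd.trans (pv ▸ .parent p v)
  have hcompw : ∀ x, G.Adj w x → Above p x w ∨ Above p w x := by
    intro x hx
    have xw : x ≠ w := hx.ne'
    have xv : x ≠ v := fun he => hvw (he ▸ hx).symm
    have hxw := h.above_of_adj_leaf hleaf hx.symm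
    have hcw' := h.above_of_adj_leaf hleaf hwc.symm
    rcases hxw.total hcw' with h1 | h1
    · rcases above_iff.1 h1 with rfl | h1
      · exact Or.inr (pc ▸ .parent p x)
      · rw [hc] at h1
        have hvr : v ≠ r := fun hv => xv ((h.above_root (hv ▸ h1)).trans hv.symm)
        have h1 := (above_iff.1 h1).resolve_left xv
        have := (key (par v) (h.parent_ne hvr) (hleaf v hvr)).1 x xv xw h1
        exact Or.inl (this.trans (pw hvr ▸ .parent p w))
    · have := (key x xv xw).1 c hcv hcw h1
      exact Or.inr (.trans (pc ▸ .parent p c) this)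
  refine ⟨⟨?_, fun y => ?_⟩, fun y hy => ?_, fun x y hxy => ?_⟩
  · by_cases hv : v = r
    · rw [exchangeRoot, if_pos hv, pw' hv]
    · rw [exchangeRoot, if_neg hv, po r (Ne.symm hv) hwr.symm hcr.symm, h.root]
  · by_cases yv : y = v
    · subst yv
      exact (hreach d hdv hdw).trans (pv ▸ .parent p y)
    · by_cases yw : y = w
      · subst yw
        by_cases hv : v = r
        · rw [exchangeRoot, if_pos hv]
          exact .refl _ _
        · exact (hreach (par v) (h.parent_ne hv) (hleaf v hv)).trans (pw hv ▸ .parent p y)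
      · exact hreach y yv yw
  · by_cases yv : y = v
    · rw [yv, pv]
      exact hvd
    · by_cases yw : y = w
      · subst yw
        have hv : v ≠ r := fun hv => hy (by rw [exchangeRoot, if_pos hv])
        rw [pw hv]
        exact hwa hv
      · by_cases yc : y = c
        · rw [yc, pc]
          exact hwc.symm
        · rw [po y yv yw yc]
          refine h.adj y fun hyr => ?_
          by_cases hv : v = r
          · exact yv (hyr.trans hv.symm)
          · exact hy (by rw [exchangeRoot, if_neg hv, hyr])
  · by_cases xv : x = v
    · subst xv
      exact Or.inr (hcompv y hxy)
    · by_cases yv : y = v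
      · subst yv
        exact Or.inl (hcompv x hxy.symm)
      · by_cases xw : x = w
        · subst xw
          exact (hcompw y hxy).symm
        · by_cases yw : y = w
          · subst yw
            exact hcompw x hxy.symm
          · exact hcomp x y xv xw yv yw hxy

/-- Besides `v` and `w` nothing changes status: the new parent `d` of `v` was inner before, and the
old parent of `w` stays inner because `w` has a sibling. -/
theorem innerVertices_exchange [Fintype V] (h : IsRooting r par)
    (hcr : c ≠ r) (hc : par c = v) (huniq : ∀ y, y ≠ r → par y = v → y = c)
    (hleaf : ∀ y, y ≠ r → par y ≠ w) (hwr : w ≠ r) (hwc : w ≠ c) (hdv : d ≠ v)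
    (hd : d ∈ innerVertices r par) (hw : ∃ y, y ≠ w ∧ y ≠ r ∧ par y = par w) :
    innerVertices (exchangeRoot r v w) (exchangePar r par v w c d) =
      insert w ((innerVertices r par).erase v) := by
  have hne : v ≠ w := fun he => hleaf c hcr (hc.trans he)
  have hcv : c ≠ v := fun he => h.parent_ne hcr (hc.trans he.symm)
  set p := exchangePar r par v w c d with hp
  have pv : p v = d := if_pos rfl
  have pw : v ≠ r → p w = par v := fun hv => by simp [hp, exchangePar, hne.symm, hv]
  have pc : p c = w := by simp [hp, exchangePar, hcv, hwc.symm]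
  have po : ∀ x, x ≠ v → x ≠ w → x ≠ c → p x = par x := fun x h1 h2 h3 => by
    simp [hp, exchangePar, h1, h2, h3]
  have hr1 : v = r → exchangeRoot r v w = w := fun hv => if_pos hv
  have hr2 : v ≠ r → exchangeRoot r v w = r := fun hv => if_neg hv
  have hroot : ∀ y, y ≠ w → y ≠ r → y ≠ exchangeRoot r v w := by
    intro y hy hy'
    rw [exchangeRoot]
    split_ifs <;> assumption
  ext x
  rw [Finset.mem_insert, Finset.mem_erase, mem_innerVertices]
  constructor
  · rintro ⟨y, hy, rfl⟩
    by_cases yv : y = v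
    · right
      rw [yv, pv]
      exact ⟨hdv, hd⟩
    by_cases yw : y = w
    · have hv : v ≠ r := fun hv => hy (yw.trans (hr1 hv).symm)
      right
      rw [yw, pw hv]
      exact ⟨h.parent_ne hv, mem_innerVertices.2 ⟨v, hv, rfl⟩⟩
    by_cases yc : y = c
    · left
      rw [yc, pc]
    right
    rw [po y yv yw yc]
    have hyr : y ≠ r := fun hyr => by
      by_cases hv : v = r
      · exact yv (hyr.trans hv.symm)
      · exact hy (hyr.trans (hr2 hv).symm)
    exact ⟨fun he => yc (huniq y hyr he), mem_innerVertices.2 ⟨y, hyr, rfl⟩⟩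
  · rintro (rfl | ⟨hxv, hx⟩)
    · exact ⟨c, hroot c hwc.symm hcr, pc⟩
    · obtain ⟨y, hyw, hyr, rfl⟩ : ∃ y, y ≠ w ∧ y ≠ r ∧ par y = x := by
        obtain ⟨y, hyr, hy⟩ := mem_innerVertices.1 hx
        by_cases hyw : y = w
        -- A child that is `w` itself moves away, so its sibling serves as witness.
        · obtain ⟨z, h1, h2, h3⟩ := hw
          exact ⟨z, h1, h2, by rw [h3, ← hyw, hy]⟩
        · exact ⟨y, hyw, hyr, hy⟩
      by_cases yv : y = v
      · subst yv
        exact ⟨w, by rw [hr2 hyr]; exact hwr, pw hyr⟩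
      by_cases yc : y = c
      · exact absurd (yc ▸ hc) hxv
      exact ⟨y, hroot y hyw hyr, po y yv hyw yc⟩

end

theorem IsRooting.mem_innerVertices_of_above [Fintype V] (h : IsRooting r par)
    (huv : Above par u v) (hne : u ≠ v) : u ∈ innerVertices r par := by
  obtain ⟨y, h1, h2, -⟩ := h.exists_child huv hne
  exact mem_innerVertices.2 ⟨y, h1, h2⟩

/-- The inner vertices of a depth-first search tree form a vertex cover. -/
theorem IsDFSRooting.innerVertices_cover [Fintype V] (h : IsDFSRooting G r par)
    (huv : G.Adj u v) : u ∈ innerVertices r par ∨ v ∈ innerVertices r par :=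
  (h.comparable u v huv).imp (fun h' => h.mem_innerVertices_of_above h' huv.ne)
    fun h' => h.mem_innerVertices_of_above h' huv.ne'

theorem IsRooting.root_mem_innerVertices [Fintype V] (h : IsRooting r par) (hv : v ≠ r) :
    r ∈ innerVertices r par :=
  h.mem_innerVertices_of_above (h.reach v) hv.symm

/-- Choose a child of each inner vertex outside `X`. The edge between them puts the child into `X`,
and different parents have different children. -/
theorem IsDFSRooting.card_innerVertices_sdiff_le [Fintype V] [DecidableEq V]
    (h : IsDFSRooting G r par) {X : Finset V} (hX : ∀ u v, G.Adj u v → u ∈ X ∨ v ∈ X) :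
    (innerVertices r par \ X).card ≤ X.card := by
  have hch : ∀ v ∈ innerVertices r par \ X, ∃ c, c ≠ r ∧ par c = v := fun v hv =>
    mem_innerVertices.1 (Finset.mem_sdiff.1 hv).1
  choose! c hc using hch
  refine Finset.card_le_card_of_injOn c (fun v hv => ?_) fun v hv w hw hvw => ?_
  · have hadj := h.adj _ (hc v hv).1
    rw [(hc v hv).2] at hadj
    exact (hX _ _ hadj).resolve_right (Finset.mem_sdiff.1 hv).2
  · rw [← (hc v hv).2, ← (hc w hw).2, hvw]

open Classical in
/-- Given a vertex cover `X`, there is a depth-first search tree with the same number of inner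
vertices in which every inner vertex outside of `X` is among the first common neighbours of two
vertices of `X`. -/
theorem IsDFSRooting.exists_normal {n : ℕ} {G : SimpleGraph (Fin n)} {X : Finset (Fin n)}
    (hX : ∀ u v, G.Adj u v → u ∈ X ∨ v ∈ X) {K : ℕ} (hK : 3 * X.card < K) {r : Fin n}
    {par : Fin n → Fin n} (h : IsDFSRooting G r par) :
    ∃ r' par', IsDFSRooting G r' par' ∧
      (innerVertices r' par').card = (innerVertices r par).card ∧
      ∀ v ∈ innerVertices r' par', v ∉ X → ∃ x ∈ X, ∃ y ∈ X, G.Adj v x ∧ G.Adj v y ∧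
        (Finset.univ.filter fun u => u < v ∧ G.Adj u x ∧ G.Adj u y).card < K := by
  -- Each exchange replaces an inner vertex by a smaller one, so this sum decreases.
  induction hs : ∑ v ∈ innerVertices r par, (v : ℕ) using Nat.strong_induction_on
    generalizing r par with
  | _ m ih =>
  by_cases hgood : ∀ v ∈ innerVertices r par, v ∉ X → ∃ x ∈ X, ∃ y ∈ X, G.Adj v x ∧ G.Adj v y ∧
      (Finset.univ.filter fun u => u < v ∧ G.Adj u x ∧ G.Adj u y).card < K
  · exact ⟨r, par, h, rfl, hgood⟩
  push Not at hgood
  obtain ⟨v, hv, hvX, hmany⟩ := hgood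
  have hNX : ∀ x, G.Adj v x → x ∈ X := fun x hx => (hX v x hx).resolve_left hvX
  -- a replacement for `v` between two of its neighbours
  have hrepl : ∀ x y, G.Adj v x → G.Adj v y → ∃ u, u < v ∧ G.Adj u x ∧ G.Adj u y ∧ u ∉ X ∧
      u ∉ innerVertices r par ∧ ∃ z, z ≠ u ∧ z ≠ r ∧ par z = par u := by
    intro x y hx hy
    by_contra hno
    push Not at hno
    -- A replacement needs a sibling, so that its parent stays inner. The vertices outside `X`
    -- without one have distinct parents in `X`, so there are at most `|X|` of them.
    let bad := Finset.univ.filter fun u => u ∉ X ∧ u ≠ r ∧ ∀ z, z ≠ u → z ≠ r → par z ≠ par u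
    have hbad : bad.card ≤ X.card := by
      refine Finset.card_le_card_of_injOn par (fun u hu => ?_) fun u hu u' hu' he => ?_
      · obtain ⟨-, h1, h2, -⟩ := Finset.mem_filter.1 hu
        exact (hX _ _ (h.adj u h2)).resolve_left h1
      · obtain ⟨-, -, h2, -⟩ := Finset.mem_filter.1 hu
        obtain ⟨-, -, -, h3⟩ := Finset.mem_filter.1 hu'
        by_contra hne
        exact h3 u hne h2 he
    -- If no replacement exists, the smaller common neighbours are covered by three sets of at most
    -- `|X|` elements each, against the choice of `K`.
    have hsub : (Finset.univ.filter fun u => u < v ∧ G.Adj u x ∧ G.Adj u y) ⊆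
        X ∪ (innerVertices r par \ X) ∪ bad := by
      intro u hu
      obtain ⟨-, h1, h2, h3⟩ := Finset.mem_filter.1 hu
      rw [Finset.mem_union, Finset.mem_union, Finset.mem_sdiff]
      by_cases hu1 : u ∈ X
      · exact Or.inl (Or.inl hu1)
      by_cases hu2 : u ∈ innerVertices r par
      · exact Or.inl (Or.inr ⟨hu2, hu1⟩)
      refine Or.inr (Finset.mem_filter.2 ⟨Finset.mem_univ _, hu1, fun hur => ?_,
        hno u h1 h2 h3 hu1 hu2⟩)
      refine hu2 ?_
      rw [hur]
      exact h.root_mem_innerVertices (v := x) (hur ▸ h2.ne')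
    have h1 := Finset.card_le_card hsub
    have h2 := Finset.card_union_le (X ∪ (innerVertices r par \ X)) bad
    have h3 := Finset.card_union_le X (innerVertices r par \ X)
    have h4 := h.card_innerVertices_sdiff_le hX
    have h5 := hmany x (hNX x hx) y (hNX y hy) hx hy
    omega
  have hleaf : ∀ u, u ∉ innerVertices r par → ∀ y, y ≠ r → par y ≠ u := fun u hu y hy he =>
    hu (mem_innerVertices.2 ⟨y, hy, he⟩)
  -- Any two neighbours of `v` have a common neighbour that is a leaf. It lies below both, so they
  -- are comparable.
  have hchain : ∀ x y, G.Adj v x → G.Adj v y → Above par x y ∨ Above par y x := by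
    intro x y hx hy
    obtain ⟨u, -, h1, h2, -, h3, -⟩ := hrepl x y hx hy
    exact (h.above_of_adj_leaf (hleaf u h3) h1.symm).total
      (h.above_of_adj_leaf (hleaf u h3) h2.symm)
  obtain ⟨c, hcr, hc⟩ := mem_innerVertices.1 hv
  have hadjc : G.Adj v c := by
    have := h.adj c hcr
    rw [hc] at this
    exact this.symm
  -- Two children of `v` would be comparable siblings.
  have huniq : ∀ y, y ≠ r → par y = v → y = c := by
    have key : ∀ y z, y ≠ r → z ≠ r → par y = v → par z = v → Above par y z → y = z := by
      intro y z hy hz hyv hzv hyz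
      rcases above_iff.1 hyz with h1 | h1
      · exact h1
      · rw [hzv] at h1
        have := h.antisymm h1 (hyv ▸ .parent par y)
        exact absurd (hyv.trans this.symm) (h.parent_ne hy)
    intro y hy hyv
    have hadjy : G.Adj v y := by
      have := h.adj y hy
      rw [hyv] at this
      exact this.symm
    rcases hchain y c hadjy hadjc with h1 | h1
    · exact key y c hy hcr hyv hc h1
    · exact (key c y hcr hy hc hyv h1).symm
  obtain ⟨δ, hδ⟩ := h.exists_depth
  -- As the neighbours of `v` form a chain, the deepest one lies below all of them.
  obtain ⟨d, hd, hdmax⟩ := Finset.exists_max_image (Finset.univ.filter fun x => G.Adj v x) δ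
    ⟨c, by simpa using hadjc⟩
  have hvd : G.Adj v d := by simpa using hd
  have hdeep : ∀ x, G.Adj v x → Above par x d := by
    intro x hx
    rcases hchain x d hx hvd with h1 | h1
    · exact h1
    · rcases h1.depth_le h.root hδ with h2 | h2
      · rw [h2]
        exact .refl _ _
      · have := hdmax x (by simpa using hx)
        omega
  -- The pair `d`, `d` also has a replacement: a leaf adjacent to `d`, hence a proper descendant of
  -- `d`.
  have hdin : d ∈ innerVertices r par := by
    obtain ⟨u, -, h1, -, -, h3, -⟩ := hrepl d d hvd hvd
    exact h.mem_innerVertices_of_above (h.above_of_adj_leaf (hleaf u h3) h1.symm)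
      h1.ne'
  -- The leaf has to fit between the child and the parent of `v`; if `v` is the root, only the child
  -- matters.
  obtain ⟨w, hwv, hwc, hwa, hwX, hwin, hwz⟩ : ∃ w, w < v ∧ G.Adj w c ∧ (v ≠ r → G.Adj w (par v)) ∧
      w ∉ X ∧ w ∉ innerVertices r par ∧ ∃ z, z ≠ w ∧ z ≠ r ∧ par z = par w := by
    by_cases hvr : v = r
    · obtain ⟨u, h1, h2, h3, h4⟩ := hrepl c c hadjc hadjc
      exact ⟨u, h1, h2, fun h' => absurd hvr h', h4⟩
    · obtain ⟨u, h1, h2, h3, h4⟩ := hrepl c (par v) hadjc (h.adj v hvr)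
      exact ⟨u, h1, h2, fun _ => h3, h4⟩
  have hwr : w ≠ r := by
    intro hwr
    refine hwin ?_
    rw [hwr]
    exact h.root_mem_innerVertices hcr
  have hvw : ¬ G.Adj v w := fun ha => hwX (hNX w ha)
  have hin := innerVertices_exchange h.toIsRooting hcr hc huniq (hleaf w hwin) hwr hwc.ne hvd.ne'
    hdin hwz
  have hw' : w ∉ (innerVertices r par).erase v := fun hm => hwin (Finset.mem_of_mem_erase hm)
  have hsum : ∑ u ∈ innerVertices (exchangeRoot r v w) (exchangePar r par v w c d), (u : ℕ) < m := by
    rw [hin, Finset.sum_insert hw', ← hs, ← Finset.add_sum_erase _ _ hv]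
    exact Nat.add_lt_add_right hwv _
  obtain ⟨r', par', h1, h2, h3⟩ := ih _ hsum
    (h.exchange hvw hcr hc huniq (hleaf w hwin) hwr hwc hwa hvd hdeep) rfl
  refine ⟨r', par', h1, ?_, h3⟩
  rw [h2, hin, Finset.card_insert_of_notMem hw', Finset.card_erase_add_one hv]

end Exchange

/-! ### Existence of depth-first search trees -/

section Existence
variable {V : Type*} {G : SimpleGraph V}

theorem SimpleGraph.Connected.exists_adj_boundary (hG : G.Connected) {D : Set V} {u v : V}
    (hu : u ∈ D) (hv : v ∉ D) : ∃ x ∈ D, ∃ y ∉ D, G.Adj x y := by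
  obtain ⟨p⟩ := hG.preconnected u v
  obtain ⟨d, -, h1, h2⟩ := p.exists_boundary_dart D hu hv
  exact ⟨d.fst, h1, d.snd, h2, d.adj⟩

/-- A depth-first search that has visited the vertices in `D` and is at the vertex `c`. -/
structure IsPartialDFS (G : SimpleGraph V) (r : V) (par : V → V) (D : Finset V) (c : V) : Prop where
  root : par r = r
  root_mem : r ∈ D
  mem : c ∈ D
  reach : ∀ v ∈ D, Above par r v
  parent_mem : ∀ v ∈ D, par v ∈ D
  adj : ∀ v ∈ D, v ≠ r → G.Adj v (par v)
  comparable : ∀ u ∈ D, ∀ v ∈ D, G.Adj u v → Above par u v ∨ Above par v u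
  boundary : ∀ u ∈ D, ∀ v ∉ D, G.Adj u v → Above par u c

/-- The search backtracks from `c` to the first ancestor `u` with an unvisited neighbour `v`, which
becomes its child. All visited vertices with unvisited neighbours lie above `c`, and those below `u`
have none left. -/
theorem IsPartialDFS.exists_step [DecidableEq V] {r c : V} {par : V → V} {D : Finset V}
    (h : IsPartialDFS G r par D c) {x y : V} (hx : x ∈ D) (hy : y ∉ D) (hxy : G.Adj x y) :
    ∃ par' v, v ∉ D ∧ IsPartialDFS G r par' (insert v D) v := by
  classical
  have hex : ∃ t, ∃ y ∉ D, G.Adj (par^[t] c) y := by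
    obtain ⟨t, rfl⟩ := h.boundary x hx y hy hxy
    exact ⟨t, y, hy, hxy⟩
  obtain ⟨v, hv, huv⟩ := Nat.find_spec hex
  set u := par^[Nat.find hex] c with hu
  have huD : u ∈ D := by
    rw [hu]
    generalize Nat.find hex = t
    induction t with
    | zero => exact h.mem
    | succ t ih => rw [Function.iterate_succ_apply']; exact h.parent_mem _ ih
  -- By minimality of the number of backtracking steps, no boundary vertex is met before `u`.
  have hbu : ∀ x ∈ D, ∀ y ∉ D, G.Adj x y → Above par x u := by
    intro x hx y hy hxy
    obtain ⟨t, ht⟩ := h.boundary x hx y hy hxy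
    have hle : Nat.find hex ≤ t := Nat.find_min' hex ⟨y, hy, ht ▸ hxy⟩
    exact ⟨t - Nat.find hex, by rw [hu, ← Function.iterate_add_apply, Nat.sub_add_cancel hle, ht]⟩
  let par' := Function.update par v u
  have hpD : ∀ x ∈ D, par' x = par x := fun x hx =>
    Function.update_of_ne (fun he => hv (by rw [← he]; exact hx)) _ _
  have hpv : par' v = u := Function.update_self ..
  have hup : ∀ x ∈ D, ∀ z, Above par z x → Above par' z x := by
    rintro x hx z ⟨t, rfl⟩
    induction t generalizing x with
    | zero => exact .refl _ _
    | succ t ih =>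
      rw [Function.iterate_succ_apply]
      exact (ih _ (h.parent_mem x hx)).trans (hpD x hx ▸ .parent par' x)
  have hvu : ∀ z, Above par z u → Above par' z v := fun z hz =>
    (hup u huD z hz).trans (hpv ▸ .parent par' v)
  refine ⟨par', v, hv, ?_, ?_, ?_, ?_, ?_, ?_, ?_, ?_⟩
  · rw [hpD r h.root_mem, h.root]
  · exact Finset.mem_insert_of_mem h.root_mem
  · exact Finset.mem_insert_self _ _
  · intro z hz
    rcases Finset.mem_insert.1 hz with rfl | hz
    · exact hvu r (h.reach u huD)
    · exact hup z hz r (h.reach z hz)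
  · intro z hz
    rcases Finset.mem_insert.1 hz with rfl | hz
    · rw [hpv]
      exact Finset.mem_insert_of_mem huD
    · rw [hpD z hz]
      exact Finset.mem_insert_of_mem (h.parent_mem z hz)
  · intro z hz hzr
    rcases Finset.mem_insert.1 hz with rfl | hz
    · rw [hpv]
      exact huv.symm
    · rw [hpD z hz]
      exact h.adj z hz hzr
  · intro a ha b hb hab
    rcases Finset.mem_insert.1 ha with ha' | ha'
    · subst ha'
      rcases Finset.mem_insert.1 hb with rfl | hb
      · exact absurd rfl hab.ne
      · exact Or.inr (hvu b (hbu b hb _ hv hab.symm))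
    · rcases Finset.mem_insert.1 hb with hb' | hb
      · subst hb'
        exact Or.inl (hvu a (hbu a ha' _ hv hab))
      · exact (h.comparable a ha' b hb hab).imp (hup b hb a) (hup a ha' b)
  · intro a ha b hb hab
    rcases Finset.mem_insert.1 ha with rfl | ha
    · exact .refl _ _
    · exact hvu a (hbu a ha b (fun hb' => hb (Finset.mem_insert_of_mem hb')) hab)

/-- Every finite connected graph has a depth-first search tree. -/
theorem SimpleGraph.Connected.exists_isDFSRooting [Fintype V] (hG : G.Connected) :
    ∃ r par, IsDFSRooting G r par := by
  classical
  obtain ⟨r⟩ := hG.nonempty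
  have key : ∀ m, m + 1 ≤ Fintype.card V →
      ∃ par D c, D.card = m + 1 ∧ IsPartialDFS G r par D c := by
    intro m
    induction m with
    | zero =>
      intro _
      refine ⟨fun v => v, {r}, r, rfl, rfl, by simp, by simp, ?_, by simp, by simp, ?_, ?_⟩
      · intro v hv
        rw [Finset.mem_singleton.1 hv]
        exact .refl _ _
      · intro u hu v hv huv
        exact absurd ((Finset.mem_singleton.1 hu).trans (Finset.mem_singleton.1 hv).symm) huv.ne
      · intro u hu v _ _
        rw [Finset.mem_singleton.1 hu]
        exact .refl _ _
    | succ m ih =>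
      intro hm
      obtain ⟨par, D, c, hD, h⟩ := ih (by omega)
      obtain ⟨z, hz⟩ : ∃ z, z ∉ D := by
        by_contra hall
        push Not at hall
        rw [Finset.eq_univ_of_forall hall, Finset.card_univ] at hD
        omega
      obtain ⟨x, hx, y, hy, hxy⟩ := hG.exists_adj_boundary (D := ↑D) h.mem hz
      obtain ⟨par', v, hv, h'⟩ := h.exists_step hx hy hxy
      exact ⟨par', _, v, by rw [Finset.card_insert_of_notMem hv, hD], h'⟩
  have hpos : 0 < Fintype.card V := Fintype.card_pos_iff.2 ⟨r⟩
  obtain ⟨par, D, c, hD, h⟩ := key (Fintype.card V - 1) (by omega)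
  have hu : D = Finset.univ := Finset.eq_univ_of_card D (by omega)
  subst hu
  exact ⟨r, par, ⟨h.root, fun v => h.reach v (Finset.mem_univ _)⟩,
    fun v => h.adj v (Finset.mem_univ _),
    fun u v => h.comparable u (Finset.mem_univ _) v (Finset.mem_univ _)⟩

end Existence

/-! ### Least elements, ranks, graph search and greedy matching -/

namespace RAM

/-- The numbers counted are those with no element of `p` up to and including themselves: the initial
segment below the least element, or all of the range. -/
theorem leastBelow_spec {U : ℕ} {p : ℕ → Prop} :
    (leastBelow U p < U ∧ p (leastBelow U p)) ∨ (leastBelow U p = U ∧ ∀ x < U, ¬ p x) := by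
  classical
  by_cases h : ∃ x, x < U ∧ p x
  · left
    have h1 := Nat.find_spec h
    have : leastBelow U p = Nat.find h := by
      rw [leastBelow, ← Finset.card_range (Nat.find h)]
      congr 1
      ext i
      rw [Finset.mem_filter, Finset.mem_range, Finset.mem_range]
      constructor
      · rintro ⟨-, hi⟩
        exact (hi _ h1.1).resolve_right (not_not.2 h1.2)
      · intro hi
        refine ⟨by omega, fun j hj => ?_⟩
        by_cases hij : i < j
        · exact Or.inl hij
        · exact Or.inr fun hp => Nat.find_min h (show j < Nat.find h by omega) ⟨hj, hp⟩
    rw [this]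
    exact h1
  · right
    push Not at h
    refine ⟨?_, h⟩
    rw [leastBelow, Finset.filter_true_of_mem, Finset.card_range]
    exact fun i _ j hj => Or.inr (h j hj)

-- Ranks increase strictly along the numbers with property `p`, so only the summand at `x` meets the
-- condition.
open Classical in
theorem nthBelow_eq {U : ℕ} {p : ℕ → Prop} {x : ℕ} (hx : x < U) (hp : p x) :
    nthBelow U p ((Finset.range x).filter p).card = x := by
  have hfil : ∀ i < U, ((Finset.range U).filter fun j => j < i ∧ p j) =
      (Finset.range i).filter p := by
    intro i hi
    ext j
    simp only [Finset.mem_filter, Finset.mem_range]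
    constructor
    · rintro ⟨-, h⟩; exact h
    · rintro h; exact ⟨by omega, h⟩
  have hlt : ∀ a b, p a → a < b →
      ((Finset.range a).filter p).card < ((Finset.range b).filter p).card := by
    intro a b ha hab
    refine Finset.card_lt_card (Finset.ssubset_iff_of_subset
      (Finset.filter_subset_filter _ (Finset.range_mono hab.le)) |>.2 ⟨a, ?_, ?_⟩)
    · simp [hab, ha]
    · simp
  rw [nthBelow, Finset.sum_eq_single x]
  · rw [if_pos]
    refine ⟨hp, ?_⟩
    rw [← hfil x hx]
  · intro i hi hix
    rw [Finset.mem_range] at hi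
    refine if_neg fun ⟨h1, h2⟩ => ?_
    have h2 : ((Finset.range i).filter p).card = ((Finset.range x).filter p).card := by
      rw [← h2, ← hfil i hi]
    rcases lt_or_gt_of_ne hix with h | h
    · have := hlt i x h1 h; omega
    · have := hlt x i hp h; omega
  · intro h
    exact absurd (Finset.mem_range.2 hx) h

section
variable {n : ℕ} {G : SimpleGraph (Fin n)} {U : ℕ}

theorem adjN_val {u v : Fin n} : AdjN G u v ↔ G.Adj u v := ⟨fun ⟨_, _, h⟩ => h, fun h => ⟨_, _, h⟩⟩

theorem AdjN.symm {i j : ℕ} (h : AdjN G i j) : AdjN G j i := by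
  obtain ⟨h1, h2, h3⟩ := h
  exact ⟨h2, h1, h3.symm⟩

theorem searchTable_eq (n U : ℕ) (A : ℕ → ℕ → Prop) (i : ℕ) :
    searchTable n U A i = searchStep n U A i (searchTable n U A) :=
  recTable_eq (searchStep_congr n U A) i

theorem searchTable_zero (n U : ℕ) (A : ℕ → ℕ → Prop) : searchTable n U A 0 = 0 := by
  rw [searchTable_eq, searchStep, if_pos rfl]

/-- While entries stay below `n`, each is a new vertex adjacent to an earlier one, so `n` of them
exhaust a connected graph. Conversely, fewer than `n` visited vertices of a connected graph leave an
edge to an unvisited one. A failed search shows as `U ≥ n`. -/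
theorem searchTable_lt_iff (hn : 0 < n) (hU : n ≤ U) :
    (∀ i < n, searchTable n U (AdjN G) i < n) ↔ G.Connected := by
  classical
  set S := searchTable n U (AdjN G) with hS
  have hspec : ∀ i, i ≠ 0 → S i = leastBelow U fun v => v < n ∧ (∀ l < U, l < i → S l ≠ v) ∧
      ∃ l < U, l < i ∧ AdjN G (S l) v := by
    intro i hi
    rw [hS, searchTable_eq, searchStep, if_neg hi]
  constructor
  · intro hlt
    have hgood : ∀ i < n, i ≠ 0 → (∀ l < i, S l ≠ S i) ∧ ∃ l < i, AdjN G (S l) (S i) := by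
      intro i hi h0
      have h1 := hlt i hi
      rcases leastBelow_spec (U := U) (p := fun v => v < n ∧ (∀ l < U, l < i → S l ≠ v) ∧
        ∃ l < U, l < i ∧ AdjN G (S l) v) with h | h
      · rw [← hspec i h0] at h
        obtain ⟨-, -, h2, l, -, h3, h4⟩ := h
        exact ⟨fun l hl => h2 l (by omega) hl, l, h3, h4⟩
      · rw [← hspec i h0] at h
        omega
    let f : Fin n → Fin n := fun i => ⟨S i, hlt i i.2⟩
    have hinj : Function.Injective f := by
      have hne : ∀ i j : Fin n, i < j → f i ≠ f j := by
        intro i j hij he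
        exact (hgood j j.2 (by have := Fin.lt_def.1 hij; omega)).1 i hij (congrArg Fin.val he)
      intro i j he
      rcases lt_trichotomy i j with h | h | h
      · exact absurd he (hne i j h)
      · exact h
      · exact absurd he.symm (hne j i h)
    have hreach : ∀ i (hi : i < n), G.Reachable (f ⟨0, hn⟩) (f ⟨i, hi⟩) := by
      intro i
      induction i using Nat.strong_induction_on with
      | _ i ih =>
        intro hi
        by_cases h0 : i = 0
        · subst h0
          exact .refl _
        · obtain ⟨-, l, hl, ha, hb, hab⟩ := hgood i hi h0
          exact (ih l hl (by omega)).trans hab.reachable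
    rw [SimpleGraph.connected_iff_exists_forall_reachable]
    refine ⟨f ⟨0, hn⟩, fun v => ?_⟩
    obtain ⟨i, rfl⟩ := (Finite.injective_iff_surjective.1 hinj) v
    exact hreach i i.2
  · intro hG i
    induction i using Nat.strong_induction_on with
    | _ i ih =>
      intro hi
      by_cases h0 : i = 0
      · rw [h0, hS, searchTable_zero]
        exact hn
      let D : Finset (Fin n) := Finset.univ.filter fun v => ∃ l < i, S l = v
      have hcard : D.card ≤ i := by
        have : D.card ≤ ((Finset.range i).image S).card := by
          refine Finset.card_le_card_of_injOn Fin.val (fun v hv => ?_) Fin.val_injective.injOn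
          obtain ⟨-, l, hl, he⟩ := Finset.mem_filter.1 hv
          exact Finset.mem_coe.2 (Finset.mem_image.2 ⟨l, Finset.mem_range.2 hl, he⟩)
        exact this.trans (Finset.card_image_le.trans (by simp))
      obtain ⟨z, hz⟩ : ∃ z, z ∉ D := by
        by_contra hall
        push Not at hall
        rw [Finset.eq_univ_of_forall hall, Finset.card_univ, Fintype.card_fin] at hcard
        omega
      have hmem : (⟨S 0, ih 0 (by omega) hn⟩ : Fin n) ∈ D :=
        Finset.mem_filter.2 ⟨Finset.mem_univ _, 0, by omega, rfl⟩
      obtain ⟨x, hx, y, hy, hxy⟩ := hG.exists_adj_boundary (D := ↑D) hmem hz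
      obtain ⟨-, l, hl, hlx⟩ := Finset.mem_filter.1 hx
      rcases leastBelow_spec (U := U) (p := fun v => v < n ∧ (∀ l < U, l < i → S l ≠ v) ∧
        ∃ l < U, l < i ∧ AdjN G (S l) v) with h | h
      · rw [← hspec i h0] at h
        exact h.2.1
      · refine absurd ⟨y.2, fun l' _ hl' he => hy ?_, l, by omega, hl, ?_⟩ (h.2 y (by omega))
        · exact Finset.mem_coe.2 (Finset.mem_filter.2 ⟨Finset.mem_univ _, l', hl', he⟩)
        · rw [hlx]
          exact adjN_val.2 hxy

theorem matchTable_eq (U : ℕ) (A : ℕ → ℕ → Prop) (i : ℕ) :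
    matchTable U A i = matchStep U A i (matchTable U A) :=
  recTable_eq (matchStep_congr U A) i

theorem matchTable_spec (hU : n ≤ U) (i : ℕ) (hi : i < n) :
    (∃ j, matchTable U (AdjN G) i = j + 1 ∧ i < j ∧ AdjN G i j ∧
      ∀ l < i, matchTable U (AdjN G) l ≠ i + 1 ∧ matchTable U (AdjN G) l ≠ j + 1) ∨
    (matchTable U (AdjN G) i = 0 ∧ ((∃ l < i, matchTable U (AdjN G) l = i + 1) ∨
      ∀ j, i < j → AdjN G i j → ∃ l < i, matchTable U (AdjN G) l = j + 1)) := by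
  set M := matchTable U (AdjN G) with hM
  have h : M i = matchStep U (AdjN G) i M := by rw [hM, ← matchTable_eq]
  rw [matchStep] at h
  by_cases h1 : ∃ l < U, l < i ∧ M l = i + 1
  · rw [if_pos h1] at h
    obtain ⟨l, -, h2⟩ := h1
    exact Or.inr ⟨h, Or.inl ⟨l, h2⟩⟩
  rw [if_neg h1] at h
  push Not at h1
  rcases leastBelow_spec (U := U) (p := fun j => i < j ∧ AdjN G i j ∧
    ∀ l < U, l < i → M l ≠ j + 1) with h2 | h2
  · rw [if_pos h2.1] at h
    obtain ⟨-, h3, h4, h5⟩ := h2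
    exact Or.inl ⟨_, h, h3, h4, fun l hl => ⟨h1 l (by omega) hl, h5 l (by omega) hl⟩⟩
  · rw [if_neg (by omega)] at h
    refine Or.inr ⟨h, Or.inr fun j hij ha => ?_⟩
    by_contra hno
    push Not at hno
    have hj : j < n := ha.2.1
    exact h2.2 j (by omega) ⟨hij, ha, fun l _ hl => hno l hl⟩

open Classical in
/-- The vertices covered by the greedy matching. -/
noncomputable def coverSet (U : ℕ) (G : SimpleGraph (Fin n)) : Finset (Fin n) :=
  Finset.univ.filter fun v => Covered n U (AdjN G) v

theorem mem_coverSet {v : Fin n} : v ∈ coverSet U G ↔ Covered n U (AdjN G) v := by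
  simp [coverSet]

/-- The greedy matching is maximal: at the turn of the smaller end of an edge, that end is already
taken or becomes matched, or else the larger end is taken. -/
theorem coverSet_cover (hU : n ≤ U) (u v : Fin n) (huv : G.Adj u v) :
    u ∈ coverSet U G ∨ v ∈ coverSet U G := by
  have key : ∀ u v : Fin n, u < v → G.Adj u v → u ∈ coverSet U G ∨ v ∈ coverSet U G := by
    intro u v hlt huv
    rw [mem_coverSet, mem_coverSet]
    rcases matchTable_spec (G := G) hU u u.2 with ⟨j, hj, -⟩ | ⟨-, ⟨l, hl, he⟩ | h⟩
    · exact Or.inl ⟨u.2, Or.inl (by omega)⟩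
    · exact Or.inl ⟨u.2, Or.inr ⟨l, by omega, hl, he⟩⟩
    · obtain ⟨l, hl, he⟩ := h v hlt (adjN_val.2 huv)
      exact Or.inr ⟨v.2, Or.inr ⟨l, by omega, hl.trans hlt, he⟩⟩
  rcases lt_or_gt_of_ne huv.ne with h | h
  · exact key u v h huv
  · exact (key v u h huv.symm).symm

theorem card_coverSet_le : (coverSet U G).card ≤
    2 * ((Finset.range n).filter fun i => 0 < matchTable U (AdjN G) i).card := by
  classical
  set M := (Finset.range n).filter fun i => 0 < matchTable U (AdjN G) i with hM
  have h1 : (coverSet U G).card ≤ (M ∪ M.image fun l => matchTable U (AdjN G) l - 1).card := by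
    refine Finset.card_le_card_of_injOn Fin.val (fun v hv => ?_) Fin.val_injective.injOn
    rw [Finset.mem_coe, Finset.mem_union, Finset.mem_image]
    obtain ⟨h1, h2 | ⟨l, -, hl, he⟩⟩ := mem_coverSet.1 hv
    · exact Or.inl (Finset.mem_filter.2 ⟨Finset.mem_range.2 h1, h2⟩)
    · have hl' : l ∈ M := Finset.mem_filter.2 ⟨Finset.mem_range.2 (by omega), by rw [he]; omega⟩
      exact Or.inr ⟨l, hl', by rw [he]; rfl⟩
  have h2 := Finset.card_union_le M (M.image fun l => matchTable U (AdjN G) l - 1)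
  have h3 : (M.image fun l => matchTable U (AdjN G) l - 1).card ≤ M.card := Finset.card_image_le
  omega

/-- Every matching edge has an end in `C`, and disjoint edges give different ends. -/
theorem card_matching_le (hU : n ≤ U) {C : Finset (Fin n)}
    (hC : ∀ u v, G.Adj u v → u ∈ C ∨ v ∈ C) :
    ((Finset.range n).filter fun i => 0 < matchTable U (AdjN G) i).card ≤ C.card := by
  classical
  set M := matchTable U (AdjN G) with hM
  have hspec : ∀ i, i ∈ (Finset.range n).filter (fun i => 0 < M i) → ∃ j, M i = j + 1 ∧ i < j ∧
      AdjN G i j ∧ ∀ l < i, M l ≠ i + 1 ∧ M l ≠ j + 1 := by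
    intro i hi
    obtain ⟨hi, hpos⟩ := Finset.mem_filter.1 hi
    rcases matchTable_spec (G := G) hU i (Finset.mem_range.1 hi) with h | h
    · exact h
    · have : M i = 0 := h.1
      omega
  rw [← Finset.card_map Fin.valEmbedding (s := C)]
  refine Finset.card_le_card_of_injOn
    (fun i => if i ∈ C.map Fin.valEmbedding then i else M i - 1) (fun i hi => ?_) ?_
  · obtain ⟨j, hj, -, ⟨h1, h2, h3⟩, -⟩ := hspec i hi
    dsimp only
    split_ifs with hm
    · exact hm
    · rcases hC _ _ h3 with h | h
      · exact absurd (Finset.mem_map.2 ⟨_, h, rfl⟩) hm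
      · rw [hj]
        exact Finset.mem_coe.2 (Finset.mem_map.2 ⟨_, h, rfl⟩)
  · have hne : ∀ i i', i ∈ (Finset.range n).filter (fun i => 0 < M i) →
        i' ∈ (Finset.range n).filter (fun i => 0 < M i) → i < i' →
        (if i ∈ C.map Fin.valEmbedding then i else M i - 1) ≠
          if i' ∈ C.map Fin.valEmbedding then i' else M i' - 1 := by
      intro i i' hi hi' hlt
      obtain ⟨j, hj, hij, -⟩ := hspec i hi
      obtain ⟨j', hj', hij', -, h⟩ := hspec i' hi'
      have := h i hlt
      split_ifs <;> omega
    intro i hi i' hi' he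
    rcases lt_trichotomy i i' with h | h | h
    · exact absurd he (hne i i' hi hi' h)
    · exact h
    · exact absurd he.symm (hne i' i hi' hi h)

end

/-! ### Certificates and depth-first search trees -/

section
variable {n : ℕ} {G : SimpleGraph (Fin n)} {k : ℕ} {b : Bool} {dig : ℕ → ℕ}

theorem card_filter_fin {p : ℕ → Prop} [DecidablePred fun v => v < n ∧ p v] {s : Finset (Fin n)}
    {U : ℕ} (hU : n ≤ U) (hs : ∀ v, v ∈ s ↔ p v) :
    ((Finset.range U).filter fun v => v < n ∧ p v).card = s.card := by
  rw [← Finset.card_map Fin.valEmbedding]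
  congr 1
  ext v
  simp only [Finset.mem_filter, Finset.mem_range, Finset.mem_map, Fin.valEmbedding_apply]
  constructor
  · rintro ⟨-, h1, h2⟩
    exact ⟨⟨v, h1⟩, (hs _).2 h2, rfl⟩
  · rintro ⟨w, h, rfl⟩
    exact ⟨w.2.trans_le hU, w.2, (hs w).1 h⟩

/-- An accepted certificate yields a depth-first search tree. -/
theorem CertOk.exists_isDFSRooting {U : ℕ} (hU : n ≤ U) (h : CertOk n k U (AdjN G) dig b) :
    ∃ r par, IsDFSRooting G r par ∧ Wanted b (innerVertices r par).card k := by
  classical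
  obtain ⟨r, -, hr, hpar, hcomp, hw⟩ := h
  have hpar : ∀ v : Fin n, v ≠ ⟨r, hr⟩ → AdjN G (certParent n k U (AdjN G) dig v) v ∧
      certKey n k U (AdjN G) dig (certParent n k U (AdjN G) dig v) <
        certKey n k U (AdjN G) dig v := fun v hv =>
    hpar v (v.2.trans_le hU) v.2 fun he => hv (Fin.ext he)
  -- The certificate condition says nothing about the parent of `r`, so it is set by hand.
  let par : Fin n → Fin n := fun v => if h : v = ⟨r, hr⟩ then ⟨r, hr⟩ else
    ⟨certParent n k U (AdjN G) dig v, (hpar v h).1.1⟩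
  have hval : ∀ v, v ≠ ⟨r, hr⟩ → (par v : ℕ) = certParent n k U (AdjN G) dig v := fun v hv => by
    simp only [par, dif_neg hv]
  have hroot : IsRooting ⟨r, hr⟩ par := by
    refine IsRooting.of_decreasing (dif_pos rfl) (fun v => certKey n k U (AdjN G) dig v)
      fun v hv => ?_
    rw [hval v hv]
    exact (hpar v hv).2
  have hanc : ∀ u v : Fin n, CertAnc n k U (AdjN G) dig r u v → Above par u v := by
    intro u v ha
    have key : ∀ m, ∃ w, Above par w v ∧ (w : ℕ) = (fun y => if y = (u : ℕ) ∨ y = r then y else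
        certParent n k U (AdjN G) dig y)^[m] v := by
      intro m
      induction m with
      | zero => exact ⟨v, .refl _ _, rfl⟩
      | succ m ih =>
        obtain ⟨w, h1, h2⟩ := ih
        rw [Function.iterate_succ_apply', ← h2]
        split_ifs with hc
        · exact ⟨w, h1, rfl⟩
        · refine ⟨par w, .trans (.parent par w) h1, hval w fun he => hc (Or.inr ?_)⟩
          rw [he]
    obtain ⟨w, h1, h2⟩ := key U
    rw [CertAnc] at ha
    rw [ha] at h2
    exact Fin.ext h2 ▸ h1
  refine ⟨⟨r, hr⟩, par, ⟨hroot, fun v hv => ?_, fun u v huv => ?_⟩, ?_⟩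
  · rw [← adjN_val, hval v hv]
    exact (hpar v hv).1.symm
  · exact (hcomp u (u.2.trans_le hU) v (v.2.trans_le hU) (adjN_val.2 huv)).imp (hanc u v) (hanc v u)
  · rwa [card_filter_fin (s := innerVertices ⟨r, hr⟩ par) hU] at hw
    intro v
    rw [mem_innerVertices]
    constructor
    · rintro ⟨w, h1, rfl⟩
      exact ⟨w, w.2.trans_le hU, w.2, fun he => h1 (Fin.ext he), (hval w h1).symm⟩
    · rintro ⟨w, -, h1, h2, h3⟩
      have hne : (⟨w, h1⟩ : Fin n) ≠ ⟨r, hr⟩ := fun he => h2 (congrArg Fin.val he)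
      exact ⟨⟨w, h1⟩, hne, Fin.ext ((hval _ hne).trans h3)⟩

/-- A certificate is accepted if its keys increase along a depth-first search tree. -/
theorem certOk_of_key {U : ℕ} (hU : 4 * k + n ≤ U) {r : Fin n} {par : Fin n → Fin n}
    (h : IsDFSRooting G r par) (hw : Wanted b (innerVertices r par).card k)
    (hkey : ∀ v : Fin n, v ≠ r →
      certKey n k U (AdjN G) dig (par v) < certKey n k U (AdjN G) dig v) :
    CertOk n k U (AdjN G) dig b := by
  classical
  set key := certKey n k U (AdjN G) dig with hkd
  have hlt : ∀ {u v : Fin n}, Above par u v → u = v ∨ key u < key v := fun ha =>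
    ha.depth_le h.root (d := fun v => key v) hkey
  have hUn : n ≤ U := by omega
  -- Keys drop along the way to the root, so `U` rounds of the ancestor test reach every ancestor.
  have hbound : ∀ v : Fin n, key v < U := by
    intro v
    have := v.2
    rw [hkd, certKey]
    split_ifs <;> omega
  -- A neighbour with a smaller key is comparable with `v` and cannot be below it, so it is a proper
  -- ancestor. Hence the parent has the largest key among them.
  have hearlier : ∀ (v : Fin n) (u : ℕ), v ≠ r → (AdjN G u v ∧ key u < key v) →
      ∃ hu : u < n, Above par ⟨u, hu⟩ (par v) := by
    rintro v u hv ⟨⟨hu, _, ha⟩, hl⟩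
    refine ⟨hu, ?_⟩
    rcases h.comparable _ _ ha with h1 | h1
    · exact (above_iff.1 h1).resolve_left ha.ne
    · rcases hlt h1 with h2 | h2
      · exact absurd h2 ha.ne'
      · exact absurd hl (not_lt.2 (le_of_lt h2))
  have hpar : ∀ v : Fin n, v ≠ r → certParent n k U (AdjN G) dig v = par v := by
    intro v hv
    have hQ : AdjN G (par v) v ∧ key (par v) < key v := ⟨adjN_val.2 (h.adj v hv).symm, hkey v hv⟩
    rw [certParent, Finset.sum_eq_single (par v : ℕ)]
    · rw [if_pos]
      refine ⟨hQ, fun w _ hQw => ?_⟩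
      obtain ⟨hw, ha⟩ := hearlier v w hv hQw
      rcases hlt ha with h1 | h1
      · rw [← h1]
        exact lt_irrefl _
      · exact not_lt.2 (le_of_lt h1)
    · intro u _ hne
      refine if_neg fun ⟨hQu, hmax⟩ => ?_
      obtain ⟨hu, ha⟩ := hearlier v u hv hQu
      rcases hlt ha with h1 | h1
      · exact hne (congrArg Fin.val h1)
      · exact hmax _ ((par v).2.trans_le hUn) hQ h1
    · intro hm
      exact absurd (Finset.mem_range.2 ((par v).2.trans_le hUn)) hm
  have hanc : ∀ u v : Fin n, Above par u v → CertAnc n k U (AdjN G) dig r u v := by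
    intro u v ha
    have H : ∀ m (v : Fin n), key v ≤ m → Above par u v →
        (fun y => if y = (u : ℕ) ∨ y = (r : ℕ) then y else
          certParent n k U (AdjN G) dig y)^[m] v = u := by
      intro m
      induction m with
      | zero =>
        intro v hv ha
        rcases hlt ha with h1 | h1
        · rw [h1]
          rfl
        · omega
      | succ m ih =>
        intro v hv ha
        by_cases huv : u = v
        · subst huv
          exact Function.iterate_fixed (by simp) _
        · have hvr : v ≠ r := by
            rintro rfl
            exact huv (h.above_root ha)
          rw [Function.iterate_succ_apply, if_neg, hpar v hvr]
          · have := hkey v hvr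
            exact ih _ (by omega) ((above_iff.1 ha).resolve_left huv)
          · rintro (h1 | h1)
            · exact huv (Fin.ext h1.symm)
            · exact hvr (Fin.ext h1)
    exact H U v (hbound v).le ha
  refine ⟨r, r.2.trans_le hUn, r.2, ?_, ?_, ?_⟩
  · intro v _ hv hvr
    have hne : (⟨v, hv⟩ : Fin n) ≠ r := fun he => hvr (congrArg Fin.val he)
    have h1 := hpar ⟨v, hv⟩ hne
    dsimp only at h1
    rw [h1]
    exact ⟨adjN_val.2 (h.adj ⟨v, hv⟩ hne).symm, hkey ⟨v, hv⟩ hne⟩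
  · rintro u - v - ⟨hu, hv, ha⟩
    exact (h.comparable _ _ ha).imp (hanc ⟨u, hu⟩ ⟨v, hv⟩) (hanc ⟨v, hv⟩ ⟨u, hu⟩)
  · rwa [card_filter_fin (s := innerVertices r par) hUn]
    intro v
    rw [mem_innerVertices]
    constructor
    · rintro ⟨w, h1, rfl⟩
      exact ⟨w, w.2.trans_le hUn, w.2, fun he => h1 (Fin.ext he), hpar w h1⟩
    · rintro ⟨w, -, h1, h2, h3⟩
      have hne : (⟨w, h1⟩ : Fin n) ≠ r := fun he => h2 (congrArg Fin.val he)
      exact ⟨⟨w, h1⟩, hne, Fin.ext ((hpar ⟨w, h1⟩ hne).symm.trans h3)⟩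

theorem certPos_eq {U : ℕ} (hU : 4 * k ≤ U) {A : ℕ → ℕ → Prop} {v i : ℕ} (hi : i < 4 * k)
    (hv : certVertex n k U A dig i = v) (hlt : ∀ j < i, certVertex n k U A dig j ≠ v) :
    certPos n k U A dig v = i := by
  rw [certPos, ← Finset.card_range i]
  congr 1
  ext q
  rw [Finset.mem_filter, Finset.mem_range, Finset.mem_range]
  constructor
  · rintro ⟨-, -, h⟩
    by_contra hq
    exact h i (by omega) (by omega) hv
  · intro hq
    exact ⟨by omega, by omega, fun j _ hj => hlt j (by omega)⟩

/-- Only a lower bound is claimed: a vertex missing from the first `i` positions may still occur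
later or not at all. -/
theorem le_certPos {U : ℕ} (hU : 4 * k ≤ U) {A : ℕ → ℕ → Prop} {v i : ℕ} (hi : i ≤ 4 * k)
    (hlt : ∀ j < i, certVertex n k U A dig j ≠ v) : i ≤ certPos n k U A dig v := by
  rw [certPos]
  conv_lhs => rw [← Finset.card_range i]
  refine Finset.card_le_card fun q hq => ?_
  rw [Finset.mem_range] at hq
  exact Finset.mem_filter.2 ⟨Finset.mem_range.2 (by omega), by omega, fun j _ hj => hlt j (by omega)⟩

/-- Every sequence of digits occurs. -/
theorem exists_digit_eq {B : ℕ} (m : ℕ) (hB : ∀ i, dig i < B) :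
    ∃ t < B ^ m, ∀ i < m, digit B t i = dig i := by
  let f : Fin m → Fin B := fun i => ⟨dig i, hB i⟩
  refine ⟨finFunctionFinEquiv f, (finFunctionFinEquiv f).2, fun i hi => ?_⟩
  exact congrArg Fin.val (congrFun (finFunctionFinEquiv.symm_apply_apply f) ⟨i, hi⟩)

theorem exists_coverList_eq {U : ℕ} (hU : n ≤ U) {x : Fin n} (hx : x ∈ coverSet U G) :
    ∃ a ≤ (coverSet U G).card, coverList n U (AdjN G) a = x := by
  classical
  refine ⟨_, ?_, nthBelow_eq (x.2.trans_le hU) (mem_coverSet.1 hx)⟩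
  rw [← Finset.card_map Fin.valEmbedding (s := coverSet U G)]
  refine Finset.card_le_card fun i hi => ?_
  obtain ⟨-, h⟩ := Finset.mem_filter.1 hi
  exact Finset.mem_map.2 ⟨⟨i, h.1⟩, mem_coverSet.2 h, rfl⟩

/-- A depth-first search tree yields an accepted certificate. -/
theorem exists_certOk (hX : (coverSet (12 * k + n + 2) G).card ≤ 2 * k) {r : Fin n}
    {par : Fin n → Fin n} (h : IsDFSRooting G r par)
    (hw : Wanted b (innerVertices r par).card k) :
    ∃ t < (6 * k + 2) ^ (12 * k),
      CertOk n k (12 * k + n + 2) (AdjN G) (digit (6 * k + 2) t) b := by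
  classical
  set U := 12 * k + n + 2 with hUdef
  have hUn : n ≤ U := by omega
  set X := coverSet U G with hXdef
  have hcov : ∀ u v, G.Adj u v → u ∈ X ∨ v ∈ X := coverSet_cover hUn
  -- The cover has at most `2 * k` vertices, so `6 * k + 1` exceeds three times its size.
  obtain ⟨r, par, h, hcard, hnormal⟩ := h.exists_normal hcov (K := 6 * k + 1) (by omega)
  rw [← hcard] at hw
  let S := X ∪ (innerVertices r par \ X)
  have hS : S.card ≤ 4 * k := by
    have h1 := Finset.card_union_le X (innerVertices r par \ X)
    have h2 := h.card_innerVertices_sdiff_le hcov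
    change (X ∪ (innerVertices r par \ X)).card ≤ 4 * k
    omega
  have hinS : ∀ v ∈ innerVertices r par, v ∈ S := fun v hv => by
    by_cases hvX : v ∈ X
    · exact Finset.mem_union_left _ hvX
    · exact Finset.mem_union_right _ (Finset.mem_sdiff.2 ⟨hv, hvX⟩)
  -- the description of a vertex by three digits
  have hdesc : ∀ v ∈ S, ∃ a b c, a < 6 * k + 2 ∧ b < 6 * k + 2 ∧ c < 6 * k + 2 ∧
      (if 0 < c then nthBelow U (fun u => AdjN G u (coverList n U (AdjN G) a) ∧
        AdjN G u (coverList n U (AdjN G) b)) (c - 1) else coverList n U (AdjN G) a) = v := by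
    intro v hv
    rcases Finset.mem_union.1 hv with hvX | hv
    · obtain ⟨a, ha, he⟩ := exists_coverList_eq hUn hvX
      rw [← hXdef] at ha
      exact ⟨a, 0, 0, by omega, by omega, by omega, he⟩
    · obtain ⟨hv, hvX⟩ := Finset.mem_sdiff.1 hv
      obtain ⟨x, hx, y, hy, hvx, hvy, hlt⟩ := hnormal v hv hvX
      obtain ⟨a, ha, hea⟩ := exists_coverList_eq hUn hx
      obtain ⟨b, hb, heb⟩ := exists_coverList_eq hUn hy
      rw [← hXdef] at ha hb
      have hN := nthBelow_eq (U := U) (p := fun u => AdjN G u x ∧ AdjN G u y) (x := v)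
        (v.2.trans_le hUn) ⟨adjN_val.2 hvx, adjN_val.2 hvy⟩
      have hc : ((Finset.range v).filter fun u => AdjN G u x ∧ AdjN G u y).card < 6 * k + 1 := by
        refine lt_of_le_of_lt (le_of_le_of_eq ?_ (Finset.card_map Fin.valEmbedding)) hlt
        refine Finset.card_le_card fun i hi => ?_
        obtain ⟨h1, h2, h3⟩ := Finset.mem_filter.1 hi
        have hin : i < n := h2.1
        refine Finset.mem_map.2 ⟨⟨i, hin⟩, Finset.mem_filter.2 ⟨Finset.mem_univ _,
          Finset.mem_range.1 h1, adjN_val.1 h2, adjN_val.1 h3⟩, rfl⟩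
      -- The rank is shifted by one since the digit `0` marks a cover vertex; it is at most `6 * k`,
      -- which explains the base `6 * k + 2`.
      refine ⟨a, b, _ + 1, by omega, by omega, Nat.succ_lt_succ hc, ?_⟩
      rw [if_pos (Nat.succ_pos _), hea, heb, Nat.add_sub_cancel]
      convert hN
  choose! α β γ hα hβ hγ hval using hdesc
  -- the vertices of `S` in the order of their depth
  obtain ⟨δ, hδ⟩ := h.exists_depth
  let L := S.toList.mergeSort fun u v => decide (δ u ≤ δ v)
  have hLmem : ∀ v, v ∈ L ↔ v ∈ S := fun v => by simp [L]
  have hLnodup : L.Nodup := (List.mergeSort_perm _ _).nodup_iff.2 S.nodup_toList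
  have hLlen : L.length ≤ 4 * k := by simpa [L] using hS
  have hLsorted : L.Pairwise fun u v => δ u ≤ δ v := by
    have := List.pairwise_mergeSort (le := fun u v => decide (δ u ≤ δ v))
      (fun a b c => by simpa using le_trans) (fun a b => by simpa using le_total _ _) S.toList
    simpa using this
  let at' : (Fin n → ℕ) → ℕ → ℕ := fun f p => if hp : p < L.length then f L[p] else 0
  let dig : ℕ → ℕ := fun i => if i < 4 * k then at' α i else
    if i < 8 * k then at' β (i - 4 * k) else at' γ (i - 8 * k)
  have hat : ∀ f, (∀ v ∈ S, f v < 6 * k + 2) → ∀ p, at' f p < 6 * k + 2 := by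
    intro f hf p
    dsimp only [at']
    split_ifs with hp
    · exact hf _ ((hLmem _).1 (List.getElem_mem hp))
    · omega
  have hdig : ∀ i, dig i < 6 * k + 2 := by
    intro i
    dsimp only [dig]
    split_ifs
    · exact hat α hα _
    · exact hat β hβ _
    · exact hat γ hγ _
  obtain ⟨t, ht, htd⟩ := exists_digit_eq (12 * k) hdig
  refine ⟨t, ht, certOk_of_key (by omega) h hw fun v hv => ?_⟩
  have hvert : ∀ p (hp : p < L.length),
      certVertex n k U (AdjN G) (digit (6 * k + 2) t) p = (L[p] : Fin n) := by
    intro p hp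
    have hp4 : p < 4 * k := by omega
    have h1 : digit (6 * k + 2) t p = α L[p] := by
      rw [htd p (by omega)]
      simp only [dig, at', if_pos hp4, dif_pos hp]
    have h2 : digit (6 * k + 2) t (p + 4 * k) = β L[p] := by
      rw [htd _ (by omega)]
      simp only [dig, at', if_neg (show ¬ p + 4 * k < 4 * k by omega),
        if_pos (show p + 4 * k < 8 * k by omega), Nat.add_sub_cancel, dif_pos hp]
    have h3 : digit (6 * k + 2) t (p + 8 * k) = γ L[p] := by
      rw [htd _ (by omega)]
      simp only [dig, at', if_neg (show ¬ p + 8 * k < 4 * k by omega),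
        if_neg (show ¬ p + 8 * k < 8 * k by omega), Nat.add_sub_cancel, dif_pos hp]
    rw [certVertex, if_pos hp4, h1, h2, h3]
    exact hval _ ((hLmem _).1 (List.getElem_mem hp))
  have hkey : ∀ p (hp : p < L.length),
      certKey n k U (AdjN G) (digit (6 * k + 2) t) (L[p] : Fin n) = p := by
    intro p hp
    have hpos := certPos_eq (by omega) (show p < 4 * k by omega) (hvert p hp) fun j hj he => by
      rw [hvert j (by omega)] at he
      have := (hLnodup.getElem_inj_iff).1 (Fin.ext he)
      omega
    rw [certKey, hpos, if_pos (by omega)]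
  -- A parent is inner and therefore listed, so its key is its position in the order of depth.
  have hparS : par v ∈ S := hinS _ (mem_innerVertices.2 ⟨v, hv, rfl⟩)
  obtain ⟨p, hp, hpe⟩ := List.getElem_of_mem ((hLmem _).2 hparS)
  rw [← hpe, hkey p hp]
  by_cases hvS : v ∈ S
  · obtain ⟨q, hq, hqe⟩ := List.getElem_of_mem ((hLmem _).2 hvS)
    have hd := hδ v hv
    rw [← hpe, ← hqe] at hd
    rw [← hqe, hkey q hq]
    by_contra hle
    rcases (not_lt.1 hle).eq_or_lt with h1 | h1
    · subst h1
      exact lt_irrefl _ hd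
    · exact absurd hd (not_lt.2 (List.pairwise_iff_getElem.1 hLsorted q p hq hp h1))
  -- The padding zeros behind the list may happen to name `v`, but only at a position after all of
  -- `L`, and thus after the parent.
  · have hle := le_certPos (U := U) (n := n) (A := AdjN G) (dig := digit (6 * k + 2) t) (v := v)
      (by omega) hLlen fun j hj he => by
        rw [hvert j hj] at he
        exact hvS ((hLmem _).1 (Fin.ext he ▸ List.getElem_mem hj))
    rw [certKey]
    split_ifs <;> omega

theorem IsDFSRooting.card_matching_le {r : Fin n} {par : Fin n → Fin n}
    (h : IsDFSRooting G r par) {U : ℕ} (hU : n ≤ U) :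
    ((Finset.range n).filter fun i => 0 < matchTable U (AdjN G) i).card ≤
      (innerVertices r par).card :=
  RAM.card_matching_le hU fun _ _ => h.innerVertices_cover

end

/-! ### The two problems in terms of the computed answer -/

theorem dualMinLLT_iff (n : ℕ) (G : SimpleGraph (Fin n)) (k : ℕ) :
    DualMinLLT n G k ↔ Answer n G k true := by
  have hU : n ≤ 12 * k + n + 2 := by omega
  constructor
  · rintro ⟨r, T, hT, hle⟩
    obtain ⟨par, h, hcard⟩ := hT.exists_isDFSRooting
    rw [Fintype.card_fin] at hcard
    have hM := card_coverSet_le (G := G) (U := 12 * k + n + 2)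
    -- A matching with more than `k` edges makes every DFS tree a solution, so connectedness
    -- decides; otherwise the cover is small enough for certificates.
    by_cases hk : k < ((Finset.range n).filter fun i =>
        0 < matchTable (12 * k + n + 2) (AdjN G) i).card
    · have hn : 0 < n := r.pos
      exact Or.inr ⟨rfl, hk, hn, (searchTable_lt_iff hn hU).2 (hT.isTree.connected.mono hT.le)⟩
    · exact Or.inl (exists_certOk (by omega) h (by rw [Wanted, if_pos rfl]; omega))
  · intro h
    obtain ⟨r, par, h, hk⟩ : ∃ r par, IsDFSRooting G r par ∧ k ≤ (innerVertices r par).card := by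
      rcases h with ⟨t, -, h⟩ | ⟨-, hk, hn, h⟩
      · exact h.exists_isDFSRooting hU
      · obtain ⟨r, par, h⟩ := ((searchTable_lt_iff hn hU).1 h).exists_isDFSRooting
        exact ⟨r, par, h, hk.le.trans (IsDFSRooting.card_matching_le h hU)⟩
    obtain ⟨T, hT, hcard⟩ := h.exists_isDFSTree
    rw [Fintype.card_fin] at hcard
    exact ⟨r, T, hT, by omega⟩

theorem dualMaxLLT_iff (n : ℕ) (G : SimpleGraph (Fin n)) (k : ℕ) :
    DualMaxLLT n G k ↔ Answer n G k false := by
  have hU : n ≤ 12 * k + n + 2 := by omega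
  constructor
  · rintro ⟨r, T, hT, hle⟩
    obtain ⟨par, h, hcard⟩ := hT.exists_isDFSRooting
    rw [Fintype.card_fin] at hcard
    have hM := card_coverSet_le (G := G) (U := 12 * k + n + 2)
    have hM' := IsDFSRooting.card_matching_le h hU
    -- At most `k` inner vertices bound the matching by `k` and the cover by `2 * k`, so here a
    -- certificate always exists.
    exact Or.inl (exists_certOk (by omega) h (by rw [Wanted, if_neg (by simp)]; omega))
  · rintro (⟨t, -, h⟩ | ⟨h, -⟩)
    · obtain ⟨r, par, h, hk⟩ := h.exists_isDFSRooting hU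
      obtain ⟨T, hT, hcard⟩ := h.exists_isDFSTree
      rw [Fintype.card_fin] at hcard
      rw [Wanted, if_neg (by simp)] at hk
      exact ⟨r, T, hT, by omega⟩
    · exact absurd h (by simp)

end RAM

theorem theorem3 : SolvableInFPTTime DualMinLLT ∧ SolvableInFPTTime DualMaxLLT :=
  ⟨RAM.exists_solves true RAM.dualMinLLT_iff, RAM.exists_solves false RAM.dualMaxLLT_iff⟩
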